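/- Let $k$ be an algebraically closed field of characteristic $0$, let $\zeta\in k$ be a primitive cube root of unity, and let $\mathfrak q=(q_{ij})_{1\le i,j\le 2}$ have entries in $k^\times$ with $q_{11}=q_{22}=\zeta$ and $q_{12}q_{21}=\zeta^{-1}$. Let $V$ be the vector space with basis $x_1,x_2$ and braiding $c(x_i\otimes x_j)=q_{ij}\,x_j\otimes x_i$. The tensor algebra $T(V)$ is a braided Hopf algebra in which $x_1,x_2$ are primitive. Let $\mathcal B_{\mathfrak q}=T(V)/\mathcal J_{\mathfrak q}$ be the Nichols algebra, where $\mathcal J_{\mathfrak q}$ is the largest graded Hopf ideal of $T(V)$ intersecting $k\oplus V$ trivially. Write $x_{i_1i_2\cdots i_m}=(\mathrm{ad}_c x_{i_1})\cdots(\mathrm{ad}_c x_{i_{m-1}})\,x_{i_m}$, where $\mathrm{ad}_c$ is the braided adjoint action, and put $$\widehat{\mathcal B}=T(V)/\langle x_{1112},\,x_{2221},\,x_{2112},\,x_{1221}\rangle .$$ Let $\mathcal Z\subseteq\widehat{\mathcal B}$ be the subalgebra generated by $z_1=x_2^3$, $z_2=x_{221}$, $z_3=x_{112}$, $z_4=x_1^3$,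 $z_5=x_{12}^3$. Then the braided Hopf algebra structure of $T(V)$ induces braided Hopf algebra structures on $\widehat{\mathcal B}$ and on $\mathcal B_{\mathfrak q}$, the projection $T(V)\to\mathcal B_{\mathfrak q}$ induces a map $\pi\colon\widehat{\mathcal B}\to\mathcal B_{\mathfrak q}$, and: 1. $\mathcal Z$ is a braided Hopf subalgebra of $\widehat{\mathcal B}$, and it is normal, that is, stable under the braided adjoint action of $\widehat{\mathcal B}$. 2. The $z_i$ $q$-commute: for all $i,j$ there is $r_{ij}\in k^\times$ with $c(z_i\otimes z_j)=r_{ij}\,z_j\otimes z_i$ and $z_iz_j=r_{ij}\,z_jz_i$. The monomials $z_1^{n_1}z_2^{n_2}z_3^{n_3}z_4^{n_4}z_5^{n_5}$, $n_1,\dots,n_5\in\mathbb N_0$, form a basis of $\mathcal Z$ (indexed by $(n_1,\dots,n_5)$). 3. $k\to\mathcal Z\hookrightarrow\widehat{\mathcal B}\xrightarrow{\ \pi\ }\mathcal B_{\mathfrak q}\to k$ is an extension of braided Hopf algebras: the inclusion and $\pi$ are morphisms of braided Hopf algebras, respectively injective and surjective, $\ker\pi=\widehat{\mathcal B}\,\mathcal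 Z^+$ where $\mathcal Z^+=\mathcal Z\cap\ker\varepsilon$, and $\mathcal Z={}^{\mathrm{co}\,\pi}\widehat{\mathcal B}=\{x\in\widehat{\mathcal B} : (\pi\otimes\mathrm{id})\Delta(x)=1\otimes x\}$. -/

import Mathlib

open scoped TensorProduct

noncomputable section

/-! ### Braided Hopf algebras

The triple tensor power of `A` is written `A ⊗ (A ⊗ A)` throughout. -/

section General

variable {k : Type*} [Field k]

/-- `c ⊗ id`, on the triple tensor power. -/
def braid12 {A : Type*} [Ring A] [Algebra k A] (c : A ⊗[k] A →ₗ[k] A ⊗[k] A) :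
    A ⊗[k] (A ⊗[k] A) →ₗ[k] A ⊗[k] (A ⊗[k] A) :=
  (TensorProduct.assoc k A A A).toLinearMap ∘ₗ c.rTensor A ∘ₗ
    (TensorProduct.assoc k A A A).symm.toLinearMap

/-- `id ⊗ c`, on the triple tensor power. -/
def braid23 {A : Type*} [Ring A] [Algebra k A] (c : A ⊗[k] A →ₗ[k] A ⊗[k] A) :
    A ⊗[k] (A ⊗[k] A) →ₗ[k] A ⊗[k] (A ⊗[k] A) :=
  c.lTensor A

/-- The multiplication `(μ ⊗ μ) (id ⊗ c ⊗ id)` of the braided tensor square of `A`. -/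
def braidedSquareMul {A : Type*} [Ring A] [Algebra k A] (c : A ⊗[k] A →ₗ[k] A ⊗[k] A) :
    (A ⊗[k] A) ⊗[k] (A ⊗[k] A) →ₗ[k] A ⊗[k] A :=
  TensorProduct.map (LinearMap.mul' k A) (LinearMap.mul' k A) ∘ₗ
    (TensorProduct.assoc k A A (A ⊗[k] A)).symm.toLinearMap ∘ₗ
    (braid12 c).lTensor A ∘ₗ
    (TensorProduct.assoc k A A (A ⊗[k] A)).toLinearMap

/-- A braided Hopf algebra structure on the associative unital algebra `A`: an invertible solution
of the braid equation, a coalgebra structure such that all structure maps commute with the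
braiding and such that the comultiplication and the counit are algebra maps for the braided tensor
square, and a bijective antipode. -/
structure BraidedHopf (k : Type*) [Field k] (A : Type*) [Ring A] [Algebra k A] where
  /-- the braiding -/
  c : A ⊗[k] A ≃ₗ[k] A ⊗[k] A
  /-- the comultiplication -/
  comul : A →ₗ[k] A ⊗[k] A
  /-- the counit -/
  counit : A →ₗ[k] k
  /-- the antipode -/
  antipode : A →ₗ[k] A
  braid_eq : braid12 c.toLinearMap ∘ₗ braid23 c.toLinearMap ∘ₗ braid12 c.toLinearMap =
    braid23 c.toLinearMap ∘ₗ braid12 c.toLinearMap ∘ₗ braid23 c.toLinearMap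
  c_one_left : ∀ a : A, c (1 ⊗ₜ a) = a ⊗ₜ 1
  c_one_right : ∀ a : A, c (a ⊗ₜ 1) = 1 ⊗ₜ a
  c_mul_left : c.toLinearMap ∘ₗ (LinearMap.mul' k A).rTensor A ∘ₗ
      (TensorProduct.assoc k A A A).symm.toLinearMap =
    (LinearMap.mul' k A).lTensor A ∘ₗ braid12 c.toLinearMap ∘ₗ braid23 c.toLinearMap
  c_mul_right : c.toLinearMap ∘ₗ (LinearMap.mul' k A).lTensor A =
    (LinearMap.mul' k A).rTensor A ∘ₗ (TensorProduct.assoc k A A A).symm.toLinearMap ∘ₗ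
      braid23 c.toLinearMap ∘ₗ braid12 c.toLinearMap
  c_counit_left : (TensorProduct.rid k A).toLinearMap ∘ₗ counit.lTensor A ∘ₗ c.toLinearMap =
    (TensorProduct.lid k A).toLinearMap ∘ₗ counit.rTensor A
  c_counit_right : (TensorProduct.lid k A).toLinearMap ∘ₗ counit.rTensor A ∘ₗ c.toLinearMap =
    (TensorProduct.rid k A).toLinearMap ∘ₗ counit.lTensor A
  c_comul_left : comul.lTensor A ∘ₗ c.toLinearMap =
    braid12 c.toLinearMap ∘ₗ braid23 c.toLinearMap ∘ₗ
      (TensorProduct.assoc k A A A).toLinearMap ∘ₗ comul.rTensor A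
  c_comul_right : (TensorProduct.assoc k A A A).toLinearMap ∘ₗ comul.rTensor A ∘ₗ c.toLinearMap =
    braid23 c.toLinearMap ∘ₗ braid12 c.toLinearMap ∘ₗ comul.lTensor A
  coassoc : (TensorProduct.assoc k A A A).toLinearMap ∘ₗ comul.rTensor A ∘ₗ comul =
    comul.lTensor A ∘ₗ comul
  counit_comul_left : ∀ a : A, counit.rTensor A (comul a) = 1 ⊗ₜ a
  counit_comul_right : ∀ a : A, counit.lTensor A (comul a) = a ⊗ₜ 1
  comul_one : comul 1 = 1 ⊗ₜ 1
  comul_mul : ∀ a b : A,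
    comul (a * b) = braidedSquareMul c.toLinearMap (comul a ⊗ₜ comul b)
  counit_one : counit 1 = 1
  counit_mul : ∀ a b : A, counit (a * b) = counit a * counit b
  antipode_left : ∀ a : A,
    LinearMap.mul' k A (antipode.rTensor A (comul a)) = algebraMap k A (counit a)
  antipode_right : ∀ a : A,
    LinearMap.mul' k A (antipode.lTensor A (comul a)) = algebraMap k A (counit a)
  antipode_bijective : Function.Bijective antipode

namespace BraidedHopf

variable {A B C : Type*} [Ring A] [Algebra k A] [Ring B] [Algebra k B] [Ring C] [Algebra k C]

/-- The braided adjoint action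
`(ad_c x) y = μ (μ ⊗ S) (id ⊗ c) (Δ ⊗ id) (x ⊗ y)`. -/
def ad (H : BraidedHopf k A) (x y : A) : A :=
  (LinearMap.mul' k A ∘ₗ TensorProduct.map (LinearMap.mul' k A) H.antipode ∘ₗ
    (TensorProduct.assoc k A A A).symm.toLinearMap ∘ₗ braid23 H.c.toLinearMap ∘ₗ
    (TensorProduct.assoc k A A A).toLinearMap ∘ₗ H.comul.rTensor A) (x ⊗ₜ y)

/-- The algebra map `f` is a morphism of braided Hopf algebras. -/
structure IsHom (H : BraidedHopf k A) (K : BraidedHopf k B) (f : A →ₐ[k] B) : Prop where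
  map_c : ∀ t, TensorProduct.map f.toLinearMap f.toLinearMap (H.c t) =
    K.c (TensorProduct.map f.toLinearMap f.toLinearMap t)
  map_comul : ∀ a, TensorProduct.map f.toLinearMap f.toLinearMap (H.comul a) = K.comul (f a)
  map_counit : ∀ a, K.counit (f a) = H.counit a
  map_antipode : ∀ a, f (H.antipode a) = K.antipode (f a)

/-- `P ⊗ Q` as a subspace of `A ⊗ A`. -/
def tensorSub (P Q : Submodule k A) : Submodule k (A ⊗[k] A) :=
  LinearMap.range (TensorProduct.mapIncl P Q)

/-- A two-sided ideal `I`, as a subspace. -/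
def idealSub (k : Type*) [Field k] {A : Type*} [Ring A] [Algebra k A] (I : TwoSidedIdeal A) :
    Submodule k A :=
  I.asIdeal.restrictScalars k

/-- Hopf ideals of a braided Hopf algebra: two-sided ideals `I` with
`Δ(I) ⊆ I ⊗ A + A ⊗ I`, `ε(I) = 0`, `S(I) = I`, and such that the braiding preserves
`I ⊗ A + A ⊗ I`. -/
structure IsHopfIdeal (H : BraidedHopf k A) (I : TwoSidedIdeal A) : Prop where
  map_c : (tensorSub (idealSub k I) ⊤ ⊔ tensorSub ⊤ (idealSub k I)).map H.c.toLinearMap =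
    tensorSub (idealSub k I) ⊤ ⊔ tensorSub ⊤ (idealSub k I)
  comul_mem : ∀ x ∈ I,
    H.comul x ∈ tensorSub (idealSub k I) ⊤ ⊔ tensorSub ⊤ (idealSub k I)
  counit_eq : ∀ x ∈ I, H.counit x = 0
  map_antipode : (idealSub k I).map H.antipode = idealSub k I

/-- Braided Hopf subalgebras: subalgebras `Z` compatible with the braiding of the ambient algebra
(`c(Z ⊗ A) = A ⊗ Z` and `c(A ⊗ Z) = Z ⊗ A`) with `Δ(Z) ⊆ Z ⊗ Z` and `S(Z) = Z`. -/
structure IsHopfSubalgebra (H : BraidedHopf k A) (Z : Subalgebra k A) : Prop where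
  map_c_left : (tensorSub (Subalgebra.toSubmodule Z) ⊤).map H.c.toLinearMap =
    tensorSub ⊤ (Subalgebra.toSubmodule Z)
  map_c_right : (tensorSub ⊤ (Subalgebra.toSubmodule Z)).map H.c.toLinearMap =
    tensorSub (Subalgebra.toSubmodule Z) ⊤
  comul_mem : ∀ z ∈ Z,
    H.comul z ∈ tensorSub (Subalgebra.toSubmodule Z) (Subalgebra.toSubmodule Z)
  map_antipode : (Subalgebra.toSubmodule Z).map H.antipode = Subalgebra.toSubmodule Z

/-- `Z` is stable under the braided adjoint action of the whole algebra. -/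
def IsNormal (H : BraidedHopf k A) (Z : Subalgebra k A) : Prop :=
  ∀ x : A, ∀ z ∈ Z, H.ad x z ∈ Z

/-- The sequence `k → A → C → B → k` given by `f : A → C` and `g : C → B` is an extension of
braided Hopf algebras: `f` is an injective and `g` a surjective morphism of braided Hopf algebras,
the kernel of `g` is `C f(A⁺)` with `A⁺ = ker ε`, and the image of `f` is the algebra
of left coinvariants `{x | (g ⊗ id) Δ(x) = 1 ⊗ x}` of `g`. -/
structure IsExtension (HA : BraidedHopf k A) (HC : BraidedHopf k C) (HB : BraidedHopf k B)
    (f : A →ₐ[k] C) (g : C →ₐ[k] B) : Prop where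
  hom_left : IsHom HA HC f
  hom_right : IsHom HC HB g
  injective : Function.Injective f
  surjective : Function.Surjective g
  ker_eq : RingHom.ker g = Ideal.span (f '' {a | HA.counit a = 0})
  range_eq : (f.range : Set C) =
    {x | g.toLinearMap.rTensor C (HC.comul x) = 1 ⊗ₜ[k] x}

end BraidedHopf

end General

/-! ### The tensor algebra of a braided vector space of diagonal type

`V` has basis `x i`, `i : ι`, and braiding `x i ⊗ x j ↦ q i j • x j ⊗ x i`; its tensor algebra is
`FreeAlgebra k ι`. -/

namespace DiagTensor

variable {k : Type*} [Field k] {ι : Type*} (q : ι → ι → kˣ)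

/-- The basis of words of the tensor algebra. -/
def word (k : Type*) [Field k] (ι : Type*) :
    Module.Basis (FreeMonoid ι) k (FreeAlgebra k ι) :=
  FreeAlgebra.basisFreeMonoid k ι

/-- The bicharacter of `q` on words: `chi u v = ∏ q i j` over all letters `i` of `u`, `j` of `v`. -/
def chi : FreeMonoid ι →* FreeMonoid ι →* kˣ :=
  FreeMonoid.lift fun i => FreeMonoid.lift fun j => q i j

/-- The algebra automorphism `v ↦ chi u v • v` by which the degree of the word `u` acts. -/
def act (u : FreeMonoid ι) : FreeAlgebra k ι →ₐ[k] FreeAlgebra k ι :=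
  FreeAlgebra.lift k fun j => (chi q u (FreeMonoid.of j) : k) • FreeAlgebra.ι k j

/-- The braiding `u ⊗ v ↦ chi u v • v ⊗ u`, `u`, `v` words. -/
def braid : FreeAlgebra k ι ⊗[k] FreeAlgebra k ι →ₗ[k] FreeAlgebra k ι ⊗[k] FreeAlgebra k ι :=
  ((word k ι).tensorProduct (word k ι)).constr k
    fun p => (chi q p.1 p.2 : k) • (word k ι p.2 ⊗ₜ[k] word k ι p.1)

/-- The inverse braiding `v ⊗ u ↦ (chi u v)⁻¹ • u ⊗ v`. -/
def braidInv :
    FreeAlgebra k ι ⊗[k] FreeAlgebra k ι →ₗ[k] FreeAlgebra k ι ⊗[k] FreeAlgebra k ι :=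
  ((word k ι).tensorProduct (word k ι)).constr k
    fun p => ((chi q p.2 p.1)⁻¹ : kˣ).val • (word k ι p.2 ⊗ₜ[k] word k ι p.1)

/-- Left multiplication by `Δ(x i) = x i ⊗ 1 + 1 ⊗ x i` in the braided tensor square:
`a ⊗ b ↦ x i a ⊗ b + (deg (x i) · a) ⊗ x i b`. -/
def primMul (i : ι) : Module.End k (FreeAlgebra k ι ⊗[k] FreeAlgebra k ι) :=
  (LinearMap.mulLeft k (FreeAlgebra.ι k i)).rTensor _ +
    TensorProduct.map (act q (FreeMonoid.of i)).toLinearMap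
      (LinearMap.mulLeft k (FreeAlgebra.ι k i))

/-- The comultiplication: the algebra map to the braided tensor square for which all `x i` are
primitive, that is, `Δ(x i y) = (x i ⊗ 1 + 1 ⊗ x i) Δ(y)` and `Δ(1) = 1 ⊗ 1`. -/
def comul : FreeAlgebra k ι →ₗ[k] FreeAlgebra k ι ⊗[k] FreeAlgebra k ι :=
  LinearMap.applyₗ (1 ⊗ₜ[k] 1) ∘ₗ (FreeAlgebra.lift k (primMul q)).toLinearMap

/-- The counit: `x i ↦ 0`. -/
def counit (k : Type*) [Field k] (ι : Type*) : FreeAlgebra k ι →ₐ[k] k :=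
  FreeAlgebra.lift k fun _ => 0

/-- The coefficient `(-1)ⁿ ∏ q i j`, product over all letters `i` of a word of length `n` and all
letters `j` to the right of `i`. -/
def antipodeCoeff : List ι → kˣ
  | [] => 1
  | i :: w => -(chi q (FreeMonoid.of i) (FreeMonoid.ofList w)) * antipodeCoeff w

/-- The antipode: a word goes to its `antipodeCoeff` times the reversed word. -/
def antipode : FreeAlgebra k ι →ₗ[k] FreeAlgebra k ι :=
  (word k ι).constr k fun w => (antipodeCoeff q w.toList : k) • word k ι w.reverse

/-! #### Verification of the axioms -/

theorem word_one : word k ι 1 = 1 := by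
  simp [word, FreeAlgebra.basisFreeMonoid, FreeAlgebra.equivMonoidAlgebraFreeMonoid]

theorem word_eq (w : FreeMonoid ι) : word k ι w = FreeMonoid.lift (FreeAlgebra.ι k) w := by
  simp [word, FreeAlgebra.basisFreeMonoid, FreeAlgebra.equivMonoidAlgebraFreeMonoid]

theorem word_mul (u v : FreeMonoid ι) : word k ι (u * v) = word k ι u * word k ι v := by
  simp only [word_eq, map_mul]

theorem word_of (i : ι) : word k ι (FreeMonoid.of i) = FreeAlgebra.ι k i := by
  simp only [word_eq, FreeMonoid.lift_eval_of]

theorem hom_ext2 {M : Type*} [AddCommGroup M] [Module k M]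
    {f g : FreeAlgebra k ι ⊗[k] FreeAlgebra k ι →ₗ[k] M}
    (h : ∀ u v, f (word k ι u ⊗ₜ word k ι v) = g (word k ι u ⊗ₜ word k ι v)) : f = g :=
  ((word k ι).tensorProduct (word k ι)).ext fun p => by
    simpa only [Module.Basis.tensorProduct_apply'] using h p.1 p.2

theorem hom_ext3 {M : Type*} [AddCommGroup M] [Module k M]
    {f g : FreeAlgebra k ι ⊗[k] (FreeAlgebra k ι ⊗[k] FreeAlgebra k ι) →ₗ[k] M}
    (h : ∀ u v w, f (word k ι u ⊗ₜ (word k ι v ⊗ₜ word k ι w)) =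
      g (word k ι u ⊗ₜ (word k ι v ⊗ₜ word k ι w))) : f = g :=
  ((word k ι).tensorProduct ((word k ι).tensorProduct (word k ι))).ext fun p => by
    simpa only [Module.Basis.tensorProduct_apply'] using h p.1 p.2.1 p.2.2

theorem act_word (u v : FreeMonoid ι) :
    act q u (word k ι v) = (chi q u v : k) • word k ι v := by
  induction v using FreeMonoid.inductionOn' with
  | one => simp [word_one]
  | of_mul i v ih =>
    rw [word_mul, map_mul, ih, word_of, act, FreeAlgebra.lift_ι_apply, map_mul, Units.val_mul,
      smul_mul_smul_comm]

theorem braid_word (u v : FreeMonoid ι) : braid q (word k ι u ⊗ₜ word k ι v) =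
    (chi q u v : k) • (word k ι v ⊗ₜ[k] word k ι u) := by
  rw [← Module.Basis.tensorProduct_apply, braid, Module.Basis.constr_basis]

theorem braidInv_word (u v : FreeMonoid ι) : braidInv q (word k ι u ⊗ₜ word k ι v) =
    ((chi q v u)⁻¹ : kˣ).val • (word k ι v ⊗ₜ[k] word k ι u) := by
  rw [← Module.Basis.tensorProduct_apply, braidInv, Module.Basis.constr_basis]

/-- The braiding of the tensor algebra, as a linear equivalence. -/
def braidEquiv :
    FreeAlgebra k ι ⊗[k] FreeAlgebra k ι ≃ₗ[k] FreeAlgebra k ι ⊗[k] FreeAlgebra k ι :=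
  LinearEquiv.ofLinearMap (braid q) (braidInv q)
    (hom_ext2 fun u v => by
      simp [braid_word, braidInv_word, smul_smul])
    (hom_ext2 fun u v => by
      simp [braid_word, braidInv_word, smul_smul])

theorem braid_word_left (u : FreeMonoid ι) (y : FreeAlgebra k ι) :
    braid q (word k ι u ⊗ₜ y) = act q u y ⊗ₜ word k ι u := by
  have : braid q ∘ₗ TensorProduct.mk k _ _ (word k ι u) =
      (TensorProduct.mk k _ _).flip (word k ι u) ∘ₗ (act q u).toLinearMap :=
    (word k ι).ext fun v => by
      simp [braid_word, act_word, TensorProduct.smul_tmul']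
  exact LinearMap.congr_fun this y

/-- The automorphism `u ↦ chi u v • u`. -/
def actR (v : FreeMonoid ι) : FreeAlgebra k ι →ₐ[k] FreeAlgebra k ι :=
  FreeAlgebra.lift k fun j => (chi q (FreeMonoid.of j) v : k) • FreeAlgebra.ι k j

theorem actR_word (u v : FreeMonoid ι) :
    actR q u (word k ι v) = (chi q v u : k) • word k ι v := by
  induction v using FreeMonoid.inductionOn' with
  | one => simp [word_one]
  | of_mul i v ih =>
    rw [word_mul, map_mul, ih, word_of, actR, FreeAlgebra.lift_ι_apply, map_mul,
      MonoidHom.mul_apply, Units.val_mul, smul_mul_smul_comm]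

theorem braid_word_right (v : FreeMonoid ι) (y : FreeAlgebra k ι) :
    braid q (y ⊗ₜ word k ι v) = word k ι v ⊗ₜ actR q v y := by
  have : braid q ∘ₗ (TensorProduct.mk k _ _).flip (word k ι v) =
      (TensorProduct.mk k _ _) (word k ι v) ∘ₗ (actR q v).toLinearMap :=
    (word k ι).ext fun v => by
      simp [braid_word, actR_word]
  exact LinearMap.congr_fun this y

theorem comul_one : comul q 1 = 1 ⊗ₜ 1 := by
  simp [comul]

theorem comul_ι_mul (i : ι) (y : FreeAlgebra k ι) :
    comul q (FreeAlgebra.ι k i * y) = primMul q i (comul q y) := by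
  simp [comul]

theorem primMul_word (i : ι) (a b : FreeMonoid ι) : primMul q i (word k ι a ⊗ₜ word k ι b) =
    word k ι (FreeMonoid.of i * a) ⊗ₜ word k ι b +
      (chi q (FreeMonoid.of i) a : k) • (word k ι a ⊗ₜ[k] word k ι (FreeMonoid.of i * b)) := by
  simp [primMul, word_mul, word_of, act_word, TensorProduct.smul_tmul']

/-- Linear maps which agree on `1`, and which agree on `x i y` when they agree on `y`, are equal. -/
theorem word_induction {M : Type*} [AddCommGroup M] [Module k M] {f g : FreeAlgebra k ι →ₗ[k] M}
    (h1 : f 1 = g 1)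
    (h : ∀ i w, f (word k ι w) = g (word k ι w) →
      f (FreeAlgebra.ι k i * word k ι w) = g (FreeAlgebra.ι k i * word k ι w)) : f = g := by
  refine (word k ι).ext fun w => ?_
  induction w using FreeMonoid.inductionOn' with
  | one => rw [word_one, h1]
  | of_mul i w ih => rw [word_mul, word_of]; exact h i w ih

theorem comul_act (u : FreeMonoid ι) (y : FreeAlgebra k ι) :
    comul q (act q u y) =
      TensorProduct.map (act q u).toLinearMap (act q u).toLinearMap (comul q y) := by
  have key : ∀ i, TensorProduct.map (act q u).toLinearMap (act q u).toLinearMap ∘ₗ primMul q i =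
      (chi q u (FreeMonoid.of i) : k) •
        primMul q i ∘ₗ TensorProduct.map (act q u).toLinearMap (act q u).toLinearMap := fun i =>
    hom_ext2 fun a b => by
      simp only [LinearMap.comp_apply, LinearMap.smul_apply, primMul_word, map_add, map_smul,
        TensorProduct.map_tmul, AlgHom.toLinearMap_apply, act_word, TensorProduct.tmul_smul,
        ← TensorProduct.smul_tmul', map_mul, Units.val_mul]
      module
  have : comul q ∘ₗ (act q u).toLinearMap =
      TensorProduct.map (act q u).toLinearMap (act q u).toLinearMap ∘ₗ comul q := by
    refine word_induction (by simp [comul_one]) fun i w ih => ?_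
    have := LinearMap.congr_fun (key i) (comul q (word k ι w))
    simp only [LinearMap.comp_apply, AlgHom.toLinearMap_apply] at ih this ⊢
    rw [comul_ι_mul, this, map_mul, act, FreeAlgebra.lift_ι_apply, ← act, smul_mul_assoc, map_smul,
      comul_ι_mul, ih]
    rfl
  exact LinearMap.congr_fun this y

theorem comul_actR (u : FreeMonoid ι) (y : FreeAlgebra k ι) :
    comul q (actR q u y) =
      TensorProduct.map (actR q u).toLinearMap (actR q u).toLinearMap (comul q y) := by
  have key : ∀ i, TensorProduct.map (actR q u).toLinearMap (actR q u).toLinearMap ∘ₗ primMul q i =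
      (chi q (FreeMonoid.of i) u : k) •
        primMul q i ∘ₗ TensorProduct.map (actR q u).toLinearMap (actR q u).toLinearMap := fun i =>
    hom_ext2 fun a b => by
      simp only [LinearMap.comp_apply, LinearMap.smul_apply, primMul_word, map_add, map_smul,
        TensorProduct.map_tmul, AlgHom.toLinearMap_apply, actR_word, TensorProduct.tmul_smul,
        ← TensorProduct.smul_tmul', map_mul, MonoidHom.mul_apply, Units.val_mul]
      module
  have : comul q ∘ₗ (actR q u).toLinearMap =
      TensorProduct.map (actR q u).toLinearMap (actR q u).toLinearMap ∘ₗ comul q := by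
    refine word_induction (by simp [comul_one]) fun i w ih => ?_
    have := LinearMap.congr_fun (key i) (comul q (word k ι w))
    simp only [LinearMap.comp_apply, AlgHom.toLinearMap_apply] at ih this ⊢
    rw [comul_ι_mul, this, map_mul, actR, FreeAlgebra.lift_ι_apply, ← actR, smul_mul_assoc,
      map_smul, comul_ι_mul, ih]
    rfl
  exact LinearMap.congr_fun this y

theorem counit_word_of_mul (i : ι) (w : FreeMonoid ι) :
    counit k ι (word k ι (FreeMonoid.of i * w)) = 0 := by
  simp [word_mul, word_of, counit]

theorem counit_act (u : FreeMonoid ι) (y : FreeAlgebra k ι) :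
    counit k ι (act q u y) = counit k ι y := by
  have : (counit k ι).comp (act q u) = counit k ι := by
    ext i; simp [counit, act]
  exact DFunLike.congr_fun this y

theorem counit_actR (u : FreeMonoid ι) (y : FreeAlgebra k ι) :
    counit k ι (actR q u y) = counit k ι y := by
  have : (counit k ι).comp (actR q u) = counit k ι := by
    ext i; simp [counit, actR]
  exact DFunLike.congr_fun this y

theorem braid12_word (u v w : FreeMonoid ι) :
    braid12 (braid q) (word k ι u ⊗ₜ (word k ι v ⊗ₜ word k ι w)) =
      (chi q u v : k) • word k ι v ⊗ₜ[k] (word k ι u ⊗ₜ[k] word k ι w) := by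
  simp [braid12, braid_word, TensorProduct.smul_tmul']

theorem braid23_word (u v w : FreeMonoid ι) :
    braid23 (braid q) (word k ι u ⊗ₜ (word k ι v ⊗ₜ word k ι w)) =
      (chi q v w : k) • word k ι u ⊗ₜ[k] (word k ι w ⊗ₜ[k] word k ι v) := by
  simp [braid23, braid_word]

theorem squareMul_word (a b a' b' : FreeMonoid ι) :
    braidedSquareMul (braid q)
      ((word k ι a ⊗ₜ word k ι b) ⊗ₜ (word k ι a' ⊗ₜ word k ι b')) =
      (chi q b a' : k) • word k ι (a * a') ⊗ₜ[k] word k ι (b * b') := by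
  simp [braidedSquareMul, braid12_word, word_mul]

theorem primMul_squareMul (i : ι) (s t : FreeAlgebra k ι ⊗[k] FreeAlgebra k ι) :
    primMul q i (braidedSquareMul (braid q) (s ⊗ₜ t)) =
      braidedSquareMul (braid q) (primMul q i s ⊗ₜ t) := by
  have : (TensorProduct.mk k _ _).compr₂ (primMul q i ∘ₗ braidedSquareMul (braid q)) =
      (TensorProduct.mk k _ _).compr₂ (braidedSquareMul (braid q)) ∘ₗ primMul q i := by
    refine hom_ext2 fun a b => hom_ext2 fun a' b' => ?_
    simp only [LinearMap.comp_apply, LinearMap.compr₂_apply, TensorProduct.mk_apply, primMul_word,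
      squareMul_word, map_add, map_smul, LinearMap.add_apply, LinearMap.smul_apply, ← mul_assoc,
      map_mul, MonoidHom.mul_apply, Units.val_mul]
    simp only [mul_assoc]
    module
  exact LinearMap.congr_fun (LinearMap.congr_fun this s) t

theorem comul_mul (x y : FreeAlgebra k ι) :
    comul q (x * y) = braidedSquareMul (braid q) (comul q x ⊗ₜ comul q y) := by
  have : (LinearMap.mul k (FreeAlgebra k ι)).compr₂ (comul q) =
      ((TensorProduct.mk k (FreeAlgebra k ι ⊗[k] FreeAlgebra k ι)
        (FreeAlgebra k ι ⊗[k] FreeAlgebra k ι)).compr₂ (braidedSquareMul (braid q)) ∘ₗ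
          comul q).compl₂ (comul q) := by
    refine word_induction
      (M := FreeAlgebra k ι →ₗ[k] FreeAlgebra k ι ⊗[k] FreeAlgebra k ι) ?_ fun i w ih => ?_
    · refine LinearMap.ext fun y => ?_
      have : braidedSquareMul (braid q) ∘ₗ TensorProduct.mk k (FreeAlgebra k ι ⊗[k] FreeAlgebra k ι)
          (FreeAlgebra k ι ⊗[k] FreeAlgebra k ι) (1 ⊗ₜ 1) = LinearMap.id :=
        hom_ext2 fun a b => by
          simp only [LinearMap.comp_apply, TensorProduct.mk_apply, ← word_one, squareMul_word]
          simp
      have := LinearMap.congr_fun this (comul q y)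
      simp at this
      simp [comul_one, this]
    · refine LinearMap.ext fun y => ?_
      have := LinearMap.congr_fun ih y
      simp at this ⊢
      rw [mul_assoc, comul_ι_mul, this, comul_ι_mul, primMul_squareMul]
  exact LinearMap.congr_fun (LinearMap.congr_fun this x) y

theorem comul_coassoc :
    (TensorProduct.assoc k _ _ _).toLinearMap ∘ₗ (comul q).rTensor (FreeAlgebra k ι) ∘ₗ comul q =
      (comul q).lTensor (FreeAlgebra k ι) ∘ₗ comul q := by
  let T := FreeAlgebra k ι
  let L (i : ι) : T →ₗ[k] T := LinearMap.mulLeft k (FreeAlgebra.ι k i)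
  let g (i : ι) : T →ₗ[k] T := (act q (FreeMonoid.of i)).toLinearMap
  let E (i : ι) : T ⊗[k] (T ⊗[k] T) →ₗ[k] T ⊗[k] (T ⊗[k] T) :=
    (TensorProduct.assoc k T T T).toLinearMap ∘ₗ LinearMap.rTensor T (primMul q i) ∘ₗ
      (TensorProduct.assoc k T T T).symm.toLinearMap +
      TensorProduct.map (g i) (TensorProduct.map (g i) (L i))
  let E' (i : ι) : T ⊗[k] (T ⊗[k] T) →ₗ[k] T ⊗[k] (T ⊗[k] T) :=
    (L i).rTensor _ + TensorProduct.map (g i) (primMul q i)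
  have hE (i : ι) : E i = E' i := hom_ext3 fun a b c => by
    simp [E, E', L, g, primMul, TensorProduct.tmul_add, add_assoc]
  have h1 (i : ι) (t : T ⊗[k] T) :
      TensorProduct.assoc k T T T ((comul q).rTensor T (primMul q i t)) =
        E i (TensorProduct.assoc k T T T ((comul q).rTensor T t)) := by
    induction t with
    | zero => simp
    | add s t hs ht => simp only [map_add, hs, ht]
    | tmul a b =>
      have h2 (s : T ⊗[k] T) : TensorProduct.assoc k T T T
          (TensorProduct.map (g i) (g i) s ⊗ₜ (FreeAlgebra.ι k i * b)) =
          TensorProduct.map (g i) (TensorProduct.map (g i) (L i))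
            (TensorProduct.assoc k T T T (s ⊗ₜ b)) := by
        induction s with
        | zero => simp
        | add s t hs ht => simp only [map_add, TensorProduct.add_tmul, hs, ht]
        | tmul s t => simp [L]
      simp only [primMul, LinearMap.add_apply, map_add, LinearMap.rTensor_tmul,
        TensorProduct.map_tmul, LinearMap.mulLeft_apply, AlgHom.toLinearMap_apply, comul_act,
        comul_ι_mul, E, h2, LinearMap.comp_apply, LinearEquiv.coe_coe,
        LinearEquiv.symm_apply_apply, g]
  have h3 (i : ι) (t : T ⊗[k] T) :
      (comul q).lTensor T (primMul q i t) = E' i ((comul q).lTensor T t) := by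
    induction t with
    | zero => simp
    | add s t hs ht => simp only [map_add, hs, ht]
    | tmul a b => simp [primMul, E', L, g, comul_ι_mul]
  refine word_induction (by simp [comul_one]) fun i w ih => ?_
  simp only [LinearMap.comp_apply, LinearEquiv.coe_coe] at ih ⊢
  rw [comul_ι_mul, h1, h3, ← hE, ih]

theorem counit_left (y : FreeAlgebra k ι) :
    (counit k ι).toLinearMap.rTensor (FreeAlgebra k ι) (comul q y) = 1 ⊗ₜ y := by
  have h (i : ι) (t : FreeAlgebra k ι ⊗[k] FreeAlgebra k ι) :
      (counit k ι).toLinearMap.rTensor (FreeAlgebra k ι) (primMul q i t) =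
        (LinearMap.mulLeft k (FreeAlgebra.ι k i)).lTensor k
          ((counit k ι).toLinearMap.rTensor (FreeAlgebra k ι) t) := by
    induction t with
    | zero => simp
    | add s t hs ht => simp only [map_add, hs, ht]
    | tmul a b => simp [primMul, counit_act]; simp [counit]
  have : (counit k ι).toLinearMap.rTensor (FreeAlgebra k ι) ∘ₗ comul q =
      TensorProduct.mk k k (FreeAlgebra k ι) 1 := by
    refine word_induction (by simp [comul_one]) fun i w ih => ?_
    simp only [LinearMap.comp_apply] at ih ⊢
    rw [comul_ι_mul, h, ih]
    simp
  exact LinearMap.congr_fun this y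

theorem counit_right (y : FreeAlgebra k ι) :
    (counit k ι).toLinearMap.lTensor (FreeAlgebra k ι) (comul q y) = y ⊗ₜ 1 := by
  have h (i : ι) (t : FreeAlgebra k ι ⊗[k] FreeAlgebra k ι) :
      (counit k ι).toLinearMap.lTensor (FreeAlgebra k ι) (primMul q i t) =
        (LinearMap.mulLeft k (FreeAlgebra.ι k i)).rTensor k
          ((counit k ι).toLinearMap.lTensor (FreeAlgebra k ι) t) := by
    induction t with
    | zero => simp
    | add s t hs ht => simp only [map_add, hs, ht]
    | tmul a b => simp [primMul]; simp [counit]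
  have : (counit k ι).toLinearMap.lTensor (FreeAlgebra k ι) ∘ₗ comul q =
      (TensorProduct.mk k (FreeAlgebra k ι) k).flip 1 := by
    refine word_induction (by simp [comul_one]) fun i w ih => ?_
    simp only [LinearMap.comp_apply] at ih ⊢
    rw [comul_ι_mul, h, ih]
    simp
  exact LinearMap.congr_fun this y

theorem antipode_word (w : FreeMonoid ι) : antipode q (word k ι w) =
    (antipodeCoeff q w.toList : k) • word k ι w.reverse := by
  rw [antipode, Module.Basis.constr_basis]

theorem antipode_ι_mul (i : ι) (y : FreeAlgebra k ι) :
    antipode q (FreeAlgebra.ι k i * y) =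
      -(antipode q (act q (FreeMonoid.of i) y) * FreeAlgebra.ι k i) := by
  have : antipode q ∘ₗ LinearMap.mulLeft k (FreeAlgebra.ι k i) =
      -(LinearMap.mulRight k (FreeAlgebra.ι k i) ∘ₗ antipode q ∘ₗ
        (act q (FreeMonoid.of i)).toLinearMap) := (word k ι).ext fun w => by
    have h : antipodeCoeff q (FreeMonoid.of i * w).toList =
        -(chi q (FreeMonoid.of i) w) * antipodeCoeff q w.toList := rfl
    simp only [LinearMap.comp_apply, LinearMap.mulLeft_apply, ← word_of, ← word_mul,
      antipode_word, h, LinearMap.neg_apply, AlgHom.toLinearMap_apply, act_word, map_smul,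
      LinearMap.mulRight_apply, FreeMonoid.reverse_mul, FreeMonoid.reverse_of]
    simp [smul_smul]
  exact LinearMap.congr_fun this y

theorem antipode_act (i : ι) (y : FreeAlgebra k ι) :
    antipode q (act q (FreeMonoid.of i) y) = act q (FreeMonoid.of i) (antipode q y) := by
  have hr (w : FreeMonoid ι) : chi q (FreeMonoid.of i) w.reverse = chi q (FreeMonoid.of i) w := by
    induction w using FreeMonoid.inductionOn' with
    | one => rfl
    | of_mul j w ih => rw [FreeMonoid.reverse_mul, map_mul, ih, FreeMonoid.reverse_of, map_mul,
        mul_comm]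
  have : antipode q ∘ₗ (act q (FreeMonoid.of i)).toLinearMap =
      (act q (FreeMonoid.of i)).toLinearMap ∘ₗ antipode q := (word k ι).ext fun w => by
    simp [act_word, antipode_word, hr, smul_smul, mul_comm]
  exact LinearMap.congr_fun this y

theorem antipode_left (y : FreeAlgebra k ι) :
    LinearMap.mul' k _ ((antipode q).rTensor (FreeAlgebra k ι) (comul q y)) =
      algebraMap k _ (counit k ι y) := by
  have h (i : ι) (t : FreeAlgebra k ι ⊗[k] FreeAlgebra k ι) :
      LinearMap.mul' k _ ((antipode q).rTensor (FreeAlgebra k ι) (primMul q i t)) = 0 := by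
    induction t with
    | zero => simp
    | add s t hs ht => simp only [map_add, hs, ht, add_zero]
    | tmul a b => simp [primMul, antipode_ι_mul, mul_assoc]
  have : LinearMap.mul' k _ ∘ₗ (antipode q).rTensor (FreeAlgebra k ι) ∘ₗ comul q =
      Algebra.linearMap k _ ∘ₗ (counit k ι).toLinearMap := by
    refine word_induction ?_ fun i w ih => ?_
    · have : antipode q (1 : FreeAlgebra k ι) = 1 := by
        rw [← word_one, antipode_word]
        change ((1 : kˣ) : k) • word k ι 1 = _
        simp
      simp [comul_one, this]
    · simp only [LinearMap.comp_apply, comul_ι_mul, h]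
      simp [counit]
  exact LinearMap.congr_fun this y

theorem antipode_right (y : FreeAlgebra k ι) :
    LinearMap.mul' k _ ((antipode q).lTensor (FreeAlgebra k ι) (comul q y)) =
      algebraMap k _ (counit k ι y) := by
  have h (i : ι) (t : FreeAlgebra k ι ⊗[k] FreeAlgebra k ι) :
      LinearMap.mul' k _ ((antipode q).lTensor (FreeAlgebra k ι) (primMul q i t)) =
        FreeAlgebra.ι k i * LinearMap.mul' k _ ((antipode q).lTensor (FreeAlgebra k ι) t) -
        act q (FreeMonoid.of i) (LinearMap.mul' k _ ((antipode q).lTensor (FreeAlgebra k ι) t)) *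
          FreeAlgebra.ι k i := by
    induction t with
    | zero => simp
    | add s t hs ht => simp only [map_add, hs, ht]; noncomm_ring
    | tmul a b => simp [primMul, antipode_ι_mul, mul_assoc, antipode_act, sub_eq_add_neg]
  have : LinearMap.mul' k _ ∘ₗ (antipode q).lTensor (FreeAlgebra k ι) ∘ₗ comul q =
      Algebra.linearMap k _ ∘ₗ (counit k ι).toLinearMap := by
    refine word_induction ?_ fun i w ih => ?_
    · have : antipode q (1 : FreeAlgebra k ι) = 1 := by
        rw [← word_one, antipode_word]
        change ((1 : kˣ) : k) • word k ι 1 = _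
        simp
      simp [comul_one, this]
    · simp only [LinearMap.comp_apply] at ih
      simp only [LinearMap.comp_apply, comul_ι_mul, h, ih]
      simp [counit, ← Algebra.commutes]
  exact LinearMap.congr_fun this y

theorem antipode_bijective : Function.Bijective (antipode q) := by
  let S' : FreeAlgebra k ι →ₗ[k] FreeAlgebra k ι := (word k ι).constr k fun w =>
    ((antipodeCoeff q w.reverse.toList)⁻¹ : kˣ).val • word k ι w.reverse
  have hS' (w : FreeMonoid ι) : S' (word k ι w) =
      ((antipodeCoeff q w.reverse.toList)⁻¹ : kˣ).val • word k ι w.reverse := by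
    simp only [S', Module.Basis.constr_basis]
  have h1 : S' ∘ₗ antipode q = LinearMap.id := (word k ι).ext fun w => by
    simp [hS', antipode_word, smul_smul]
  have h2 : antipode q ∘ₗ S' = LinearMap.id := (word k ι).ext fun w => by
    simp [hS', antipode_word, smul_smul]
  exact Function.bijective_iff_has_inverse.mpr
    ⟨S', fun x => LinearMap.congr_fun h1 x, fun x => LinearMap.congr_fun h2 x⟩

/-- The tensor algebra of a braided vector space of diagonal type, as a braided Hopf algebra with
primitive generators. -/
def hopf : BraidedHopf k (FreeAlgebra k ι) where
  c := braidEquiv q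
  comul := comul q
  counit := (counit k ι).toLinearMap
  antipode := antipode q
  braid_eq := hom_ext3 fun u v w => by
    change (braid12 (braid q) ∘ₗ braid23 (braid q) ∘ₗ braid12 (braid q)) _ =
      (braid23 (braid q) ∘ₗ braid12 (braid q) ∘ₗ braid23 (braid q)) _
    simp only [LinearMap.comp_apply, braid12_word, braid23_word, map_smul]
    module
  c_one_left a := by
    change braid q _ = _
    rw [← word_one, braid_word_left]
    congr 1
    have : act q (1 : FreeMonoid ι) = AlgHom.id k _ := by ext; simp [act]
    rw [this]; rfl
  c_one_right a := by
    change braid q _ = _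
    rw [← word_one, braid_word_right]
    congr 1
    have : actR q (1 : FreeMonoid ι) = AlgHom.id k _ := by ext; simp [actR]
    rw [this]; rfl
  c_mul_left := hom_ext3 fun u v w => by
    change (braid q ∘ₗ _) _ = (_ ∘ₗ braid12 (braid q) ∘ₗ braid23 (braid q)) _
    simp only [LinearMap.comp_apply, braid12_word, braid23_word, map_smul, LinearEquiv.coe_coe,
      TensorProduct.assoc_symm_tmul, LinearMap.rTensor_tmul, LinearMap.lTensor_tmul,
      LinearMap.mul'_apply, ← word_mul, braid_word, map_mul, MonoidHom.mul_apply, Units.val_mul]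
    module
  c_mul_right := hom_ext3 fun u v w => by
    change (braid q ∘ₗ _) _ = (_ ∘ₗ _ ∘ₗ braid23 (braid q) ∘ₗ braid12 (braid q)) _
    simp only [LinearMap.comp_apply, braid12_word, braid23_word, map_smul, LinearEquiv.coe_coe,
      TensorProduct.assoc_symm_tmul, LinearMap.rTensor_tmul, LinearMap.lTensor_tmul,
      LinearMap.mul'_apply, ← word_mul, braid_word, map_mul, Units.val_mul]
    module
  c_counit_left := by
    refine TensorProduct.ext (LinearMap.ext fun x => (word k ι).ext fun v => ?_)
    change TensorProduct.rid k _ ((counit k ι).toLinearMap.lTensor _ (braid q _)) = _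
    simp [braid_word_right, counit_actR]
  c_counit_right := by
    refine TensorProduct.ext ((word k ι).ext fun v => LinearMap.ext fun x => ?_)
    change TensorProduct.lid k _ ((counit k ι).toLinearMap.rTensor _ (braid q _)) = _
    simp [braid_word_left, counit_act]
  c_comul_left := by
    refine TensorProduct.ext (LinearMap.ext fun x => (word k ι).ext fun v => ?_)
    change (comul q).lTensor _ (braid q (x ⊗ₜ word k ι v)) =
      braid12 (braid q) (braid23 (braid q) (TensorProduct.assoc k _ _ _
        (comul q x ⊗ₜ word k ι v)))
    rw [braid_word_right, LinearMap.lTensor_tmul, comul_actR]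
    induction comul q x with
    | zero => simp
    | add s t hs ht => simp only [map_add, TensorProduct.add_tmul, TensorProduct.tmul_add, hs, ht]
    | tmul s t => simp [braid12, braid23, braid_word_right]
  c_comul_right := by
    refine TensorProduct.ext ((word k ι).ext fun v => LinearMap.ext fun x => ?_)
    change TensorProduct.assoc k _ _ _ ((comul q).rTensor _ (braid q (word k ι v ⊗ₜ x))) =
      braid23 (braid q) (braid12 (braid q) (word k ι v ⊗ₜ comul q x))
    rw [braid_word_left, LinearMap.rTensor_tmul, comul_act]
    induction comul q x with
    | zero => simp
    | add s t hs ht => simp only [map_add, TensorProduct.add_tmul, TensorProduct.tmul_add, hs, ht]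
    | tmul s t => simp [braid12, braid23, braid_word_left]
  coassoc := comul_coassoc q
  counit_comul_left := counit_left q
  counit_comul_right := counit_right q
  comul_one := comul_one q
  comul_mul := comul_mul q
  counit_one := by simp
  counit_mul := by simp
  antipode_left := antipode_left q
  antipode_right := antipode_right q
  antipode_bijective := antipode_bijective q

/-! #### The Nichols algebra and iterated adjoint actions -/

/-- The projection of the tensor algebra to its homogeneous component `V^{⊗ n}`. -/
def degreeProj (k : Type*) [Field k] (ι : Type*) (n : ℕ) : FreeAlgebra k ι →ₗ[k] FreeAlgebra k ι :=
  (word k ι).constr k fun w => if w.length = n then word k ι w else 0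

/-- The ideal `I` is graded for the grading of the tensor algebra by word length. -/
def IsGraded (I : TwoSidedIdeal (FreeAlgebra k ι)) : Prop :=
  ∀ x ∈ I, ∀ n, degreeProj k ι n x ∈ I

/-- The defining ideal of the Nichols algebra: the largest graded Hopf ideal of the tensor algebra
which intersects `k ⊕ V` trivially (sums of such ideals are again such ideals). -/
def nicholsIdeal : TwoSidedIdeal (FreeAlgebra k ι) :=
  sSup {I | (hopf q).IsHopfIdeal I ∧ IsGraded I ∧
    ∀ x ∈ I, x ∈ Submodule.span k ({1} ∪ Set.range (FreeAlgebra.ι k)) → x = 0}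

/-- The Nichols algebra of the braided vector space given by `q`. -/
abbrev Nichols : Type _ := FreeAlgebra k ι ⧸ (nicholsIdeal q).asIdeal

/-- The element `(ad_c x i₁) ⋯ (ad_c x iₘ) (x j)` of the tensor algebra, for the list
`[i₁, …, iₘ]`. -/
def adWord (l : List ι) (j : ι) : FreeAlgebra k ι :=
  l.foldr (fun i y => (hopf q).ad (FreeAlgebra.ι k i) y) (FreeAlgebra.ι k j)

end DiagTensor

/-! ### The pre-Nichols algebra `B̂` in rank two

The basis of `V` is `x₁ = ι 0`, `x₂ = ι 1`. -/

namespace RankTwo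

open DiagTensor

variable {k : Type*} [Field k] (q : Fin 2 → Fin 2 → kˣ)

/-- The ideal generated by `x₁₁₁₂`, `x₂₂₂₁`, `x₂₁₁₂`, `x₁₂₂₁`. -/
def hatIdeal : TwoSidedIdeal (FreeAlgebra k (Fin 2)) :=
  TwoSidedIdeal.span {adWord q [0, 0, 0] 1, adWord q [1, 1, 1] 0, adWord q [1, 0, 0] 1,
    adWord q [0, 1, 1] 0}

/-- The algebra `B̂ = T(V) / ⟨x₁₁₁₂, x₂₂₂₁, x₂₁₁₂, x₁₂₂₁⟩`. -/
abbrev Hat : Type _ := FreeAlgebra k (Fin 2) ⧸ (hatIdeal q).asIdeal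

/-- The projection `T(V) → B̂`. -/
def toHat : FreeAlgebra k (Fin 2) →ₐ[k] Hat q := Ideal.Quotient.mkₐ k (hatIdeal q).asIdeal

/-- The projection of `T(V)` to the Nichols algebra. -/
def toNichols : FreeAlgebra k (Fin 2) →ₐ[k] Nichols q :=
  Ideal.Quotient.mkₐ k (nicholsIdeal q).asIdeal

/-- The elements `x₂³`, `x₂₂₁`, `x₁₁₂`, `x₁³`, `x₁₂³` of `B̂`. -/
def z : Fin 5 → Hat q :=
  ![toHat q (FreeAlgebra.ι k 1 ^ 3), toHat q (adWord q [1, 1] 0), toHat q (adWord q [0, 0] 1),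
    toHat q (FreeAlgebra.ι k 0 ^ 3), toHat q (adWord q [0] 1 ^ 3)]

/-- The subalgebra `Z` of `B̂` generated by the five elements `z i`. -/
def Z : Subalgebra k (Hat q) := Algebra.adjoin k (Set.range (z q))

/-- The ordered monomial `z₁^{n₁} z₂^{n₂} z₃^{n₃} z₄^{n₄} z₅^{n₅}`. -/
def zMonomial (n : Fin 5 → ℕ) : Hat q :=
  z q 0 ^ n 0 * z q 1 ^ n 1 * z q 2 ^ n 2 * z q 3 ^ n 3 * z q 4 ^ n 4

end RankTwo

end

/-!
On `T(V)` the braiding of a homogeneous element with anything is given by a diagonal automorphism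
(`DiagTensor.act`, `DiagTensor.actR`), and an ideal generated by homogeneous elements is a Hopf
ideal as soon as the comultiplication, the counit and the antipode and its inverse behave on the
generators (`DiagTensor.isHopfIdeal_span`). The elements `x₂³`, `x₂₂₁`, `x₁₁₂`, `x₁³` are
primitive in `T(V)`, and their double braiding with any word is the identity
(`RankTwo.IsCubicA2.monodromy`), so their braided commutators with the generators are again
primitive. The relations of `B̂` are such commutators; hence `B̂` is a braided Hopf algebra, and
`x₂³`, `x₂₂₁`, `x₁₁₂`, `x₁³`, `x₁₂³` commute with everything in `B̂` up to the braiding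
(`RankTwo.IsCubicA2.z_mul`). For the cubes this rests on the relations `PBWRelations`, which also
give `Δ(x₁₂³) = x₁₂³ ⊗ 1 + a x₁³ ⊗ x₂³ + c x₁₁₂ ⊗ x₂₂₁ + 1 ⊗ x₁₂³` with `a ≠ 0`. So `Z` is a Hopf
subalgebra on which the adjoint action is through the counit, and it is spanned by the ordered
monomials.

The remaining claims use the skew derivations `(φ ⊗ id) Δ` of `B̂`, where `φ` is the coefficient
of a word of length one or three (`RankTwo.skewDeriv`); such a coefficient is well defined since
the relations have degree four.

* Those of degree three lower the exponents of `x₂³`, `x₂₂₁`, `x₁₁₂`, `x₁³` in an ordered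
  monomial, and the composite of those for `x₁³` and `x₂³` lowers the exponent of `x₁₂³`, because
  of the nonzero coefficient `a`. This gives the linear independence.
* Those of degree one, `∂₁` and `∂₂`, kill `Z`, while `B̂` is the sum of the subspaces `x₂ᵃ x₁₂ᵇ
  x₁ᶜ Z` with `a, b, c ≤ 2`. The operators `∂₂`, `∂₂ ∂₁`, `∂₁` lower the three exponents.
  Therefore an element killed by `∂₁` and `∂₂` lies in `Z`, and the span of the `x₂ᵃ x₁₂ᵇ x₁ᶜ`
  meets trivially every subspace which is stable under `∂₁`, `∂₂` and on which the counit vanishes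
  (`RankTwo.IsCubicA2.derivation_criterion`).

The second assertion, applied to the image in `B̂` of a graded Hopf ideal without linear terms,
shows that the defining ideal of the Nichols algebra is generated by the five elements
(`RankTwo.IsCubicA2.nicholsIdeal_eq`), whence the kernel of `π`. The first one determines the left
coinvariants, as `∂₁` and `∂₂` factor through the coaction of the Nichols algebra.
-/

open scoped TensorProduct

noncomputable section

/-! ### Transport of braided Hopf algebra structures along algebra maps -/

section Transport

open TensorProduct

variable {k A B : Type*} [Field k] [Ring A] [Algebra k A] [Ring B] [Algebra k B]

/-- A linear map descends along a surjection whose kernel it kills. -/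
theorem exists_descend {M N P : Type*} [AddCommGroup M] [Module k M] [AddCommGroup N] [Module k N]
    [AddCommGroup P] [Module k P] (g : M →ₗ[k] N) (hg : Function.Surjective g) (h : M →ₗ[k] P)
    (hk : ∀ x, g x = 0 → h x = 0) : ∃ h' : N →ₗ[k] P, ∀ x, h' (g x) = h x := by
  refine ⟨(LinearMap.ker g).liftQ h (fun x hx => hk x hx) ∘ₗ
    (g.quotKerEquivOfSurjective hg).symm.toLinearMap, fun x => ?_⟩
  have : (g.quotKerEquivOfSurjective hg).symm (g x) = Submodule.Quotient.mk x :=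
    (LinearEquiv.symm_apply_eq _).mpr (by simp)
  simp only [LinearMap.comp_apply, LinearEquiv.coe_coe, this]
  exact Submodule.liftQ_apply _ _ _

/-- A linear map lifts along an injection whose range contains its range. -/
theorem exists_lift {M N P : Type*} [AddCommGroup M] [Module k M] [AddCommGroup N] [Module k N]
    [AddCommGroup P] [Module k P] (g : N →ₗ[k] P) (hg : Function.Injective g) (h : M →ₗ[k] P)
    (hr : ∀ x, h x ∈ LinearMap.range g) : ∃ h' : M →ₗ[k] N, ∀ x, g (h' x) = h x := by
  refine ⟨(LinearEquiv.ofInjective g hg).symm.toLinearMap ∘ₗ h.codRestrict _ hr, fun x => ?_⟩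
  have := (LinearEquiv.ofInjective g hg).apply_symm_apply (h.codRestrict _ hr x)
  exact congrArg Subtype.val this

variable (f : A →ₐ[k] B)

/-- The linear map `f ⊗ f`. -/
abbrev tmap2 : A ⊗[k] A →ₗ[k] B ⊗[k] B := TensorProduct.map f.toLinearMap f.toLinearMap

/-- The linear map `f ⊗ (f ⊗ f)`. -/
abbrev tmap3 : A ⊗[k] (A ⊗[k] A) →ₗ[k] B ⊗[k] (B ⊗[k] B) :=
  TensorProduct.map f.toLinearMap (tmap2 f)

theorem tmap3_assoc (t : (A ⊗[k] A) ⊗[k] A) : tmap3 f (TensorProduct.assoc k A A A t) =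
    TensorProduct.assoc k B B B (TensorProduct.map (tmap2 f) f.toLinearMap t) :=
  TensorProduct.map_map_assoc _ _ _ t

theorem tmap3_assoc_symm (t : A ⊗[k] (A ⊗[k] A)) :
    TensorProduct.map (tmap2 f) f.toLinearMap ((TensorProduct.assoc k A A A).symm t) =
    (TensorProduct.assoc k B B B).symm (tmap3 f t) :=
  TensorProduct.map_map_assoc_symm _ _ _ t

theorem tmap2_mul (t : A ⊗[k] A) :
    f (LinearMap.mul' k A t) = LinearMap.mul' k B (tmap2 f t) := by
  induction t with
  | zero => simp
  | add s t hs ht => simp only [map_add, hs, ht]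
  | tmul a b => simp

variable {f} {c : A ⊗[k] A →ₗ[k] A ⊗[k] A} {c' : B ⊗[k] B →ₗ[k] B ⊗[k] B}

theorem tmap_rTensor {M M' : Type*} [AddCommGroup M] [Module k M] [AddCommGroup M'] [Module k M']
    {g : A →ₗ[k] M} {g' : B →ₗ[k] M'} {h : M →ₗ[k] M'} (hg : ∀ a, h (g a) = g' (f a))
    {N N' : Type*} [AddCommGroup N] [Module k N] [AddCommGroup N'] [Module k N'] (e : N →ₗ[k] N')
    (t : A ⊗[k] N) : TensorProduct.map h e (g.rTensor N t) =
      g'.rTensor N' (TensorProduct.map f.toLinearMap e t) := by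
  induction t with
  | zero => simp
  | add s t hs ht => simp only [map_add, hs, ht]
  | tmul a b => simp [hg]

theorem tmap_lTensor {M M' : Type*} [AddCommGroup M] [Module k M] [AddCommGroup M'] [Module k M']
    {g : A →ₗ[k] M} {g' : B →ₗ[k] M'} {h : M →ₗ[k] M'} (hg : ∀ a, h (g a) = g' (f a))
    {N N' : Type*} [AddCommGroup N] [Module k N] [AddCommGroup N'] [Module k N'] (e : N →ₗ[k] N')
    (t : N ⊗[k] A) : TensorProduct.map e h (g.lTensor N t) =
      g'.lTensor N' (TensorProduct.map e f.toLinearMap t) := by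
  induction t with
  | zero => simp
  | add s t hs ht => simp only [map_add, hs, ht]
  | tmul a b => simp [hg]

theorem tmap_rTensor2 {M M' : Type*} [AddCommGroup M] [Module k M] [AddCommGroup M'] [Module k M']
    {g : A ⊗[k] A →ₗ[k] M} {g' : B ⊗[k] B →ₗ[k] M'} {h : M →ₗ[k] M'}
    (hg : ∀ a, h (g a) = g' (tmap2 f a))
    {N N' : Type*} [AddCommGroup N] [Module k N] [AddCommGroup N'] [Module k N'] (e : N →ₗ[k] N')
    (t : (A ⊗[k] A) ⊗[k] N) : TensorProduct.map h e (g.rTensor N t) =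
      g'.rTensor N' (TensorProduct.map (tmap2 f) e t) := by
  induction t with
  | zero => simp
  | add s t hs ht => simp only [map_add, hs, ht]
  | tmul a b => simp [hg]

theorem tmap_lTensor2 {M M' : Type*} [AddCommGroup M] [Module k M] [AddCommGroup M'] [Module k M']
    {g : A ⊗[k] A →ₗ[k] M} {g' : B ⊗[k] B →ₗ[k] M'} {h : M →ₗ[k] M'}
    (hg : ∀ a, h (g a) = g' (tmap2 f a))
    {N N' : Type*} [AddCommGroup N] [Module k N] [AddCommGroup N'] [Module k N'] (e : N →ₗ[k] N')
    (t : N ⊗[k] (A ⊗[k] A)) : TensorProduct.map e h (g.lTensor N t) =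
      g'.lTensor N' (TensorProduct.map e (tmap2 f) t) := by
  induction t with
  | zero => simp
  | add s t hs ht => simp only [map_add, hs, ht]
  | tmul a b => simp [hg]

theorem tmap3_braid23 (hc : ∀ t, tmap2 f (c t) = c' (tmap2 f t)) (t : A ⊗[k] (A ⊗[k] A)) :
    tmap3 f (braid23 c t) = braid23 c' (tmap3 f t) :=
  tmap_lTensor2 hc _ t

theorem tmap3_braid12 (hc : ∀ t, tmap2 f (c t) = c' (tmap2 f t)) (t : A ⊗[k] (A ⊗[k] A)) :
    tmap3 f (braid12 c t) = braid12 c' (tmap3 f t) := by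
  simp only [braid12, LinearMap.comp_apply, LinearEquiv.coe_coe]
  rw [tmap3_assoc, tmap_rTensor2 hc, tmap3_assoc_symm]

theorem tmap2_braidedSquareMul (hc : ∀ t, tmap2 f (c t) = c' (tmap2 f t))
    (s t : A ⊗[k] A) : tmap2 f (braidedSquareMul c (s ⊗ₜ t)) =
      braidedSquareMul c' (tmap2 f s ⊗ₜ tmap2 f t) := by
  have h1 (u : (A ⊗[k] A) ⊗[k] (A ⊗[k] A)) :
      tmap2 f (TensorProduct.map (LinearMap.mul' k A) (LinearMap.mul' k A) u) =
      TensorProduct.map (LinearMap.mul' k B) (LinearMap.mul' k B)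
        (TensorProduct.map (tmap2 f) (tmap2 f) u) := by
    induction u with
    | zero => simp
    | add s t hs ht => simp only [map_add, hs, ht]
    | tmul a b => simp [tmap2_mul]
  have h2 (u : A ⊗[k] (A ⊗[k] (A ⊗[k] A))) :
      TensorProduct.map (tmap2 f) (tmap2 f) ((TensorProduct.assoc k A A (A ⊗[k] A)).symm u) =
      (TensorProduct.assoc k B B (B ⊗[k] B)).symm (TensorProduct.map f.toLinearMap (tmap3 f) u) :=
    TensorProduct.map_map_assoc_symm _ _ _ u
  have h3 (u : A ⊗[k] (A ⊗[k] (A ⊗[k] A))) :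
      TensorProduct.map f.toLinearMap (tmap3 f) ((braid12 c).lTensor A u) =
      (braid12 c').lTensor B (TensorProduct.map f.toLinearMap (tmap3 f) u) := by
    induction u with
    | zero => simp
    | add s t hs ht => simp only [map_add, hs, ht]
    | tmul a b =>
      simp only [LinearMap.lTensor_tmul, TensorProduct.map_tmul]
      rw [tmap3_braid12 hc]
  simp only [braidedSquareMul, LinearMap.comp_apply, LinearEquiv.coe_coe]
  rw [h1, h2, h3, TensorProduct.map_map_assoc, TensorProduct.map_tmul]

section Squares

variable {D : A →ₗ[k] A ⊗[k] A} {D' : B →ₗ[k] B ⊗[k] B} {e : A →ₗ[k] k} {e' : B →ₗ[k] k}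
  {S : A →ₗ[k] A} {S' : B →ₗ[k] B}

theorem tmap2_mul_rTensor (t : (A ⊗[k] A) ⊗[k] A) :
    tmap2 f ((LinearMap.mul' k A).rTensor A t) =
      (LinearMap.mul' k B).rTensor B (TensorProduct.map (tmap2 f) f.toLinearMap t) :=
  tmap_rTensor2 (f := f) (h := f.toLinearMap) (tmap2_mul f) _ t

theorem tmap2_mul_lTensor (t : A ⊗[k] (A ⊗[k] A)) :
    tmap2 f ((LinearMap.mul' k A).lTensor A t) = (LinearMap.mul' k B).lTensor B (tmap3 f t) :=
  tmap_lTensor2 (f := f) (h := f.toLinearMap) (tmap2_mul f) _ t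

theorem map_rid_lTensor (he : ∀ a, e a = e' (f a)) (t : A ⊗[k] A) :
    f (TensorProduct.rid k A (e.lTensor A t)) =
      TensorProduct.rid k B (e'.lTensor B (tmap2 f t)) := by
  induction t with
  | zero => simp
  | add s t hs ht => simp only [map_add, hs, ht]
  | tmul a b => simp [he]

theorem map_lid_rTensor (he : ∀ a, e a = e' (f a)) (t : A ⊗[k] A) :
    f (TensorProduct.lid k A (e.rTensor A t)) =
      TensorProduct.lid k B (e'.rTensor B (tmap2 f t)) := by
  induction t with
  | zero => simp
  | add s t hs ht => simp only [map_add, hs, ht]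
  | tmul a b => simp [he]

theorem map_mul_rTensor (hS : ∀ a, f (S a) = S' (f a)) (t : A ⊗[k] A) :
    f (LinearMap.mul' k A (S.rTensor A t)) = LinearMap.mul' k B (S'.rTensor B (tmap2 f t)) := by
  induction t with
  | zero => simp
  | add s t hs ht => simp only [map_add, hs, ht]
  | tmul a b => simp [hS]

theorem map_mul_lTensor (hS : ∀ a, f (S a) = S' (f a)) (t : A ⊗[k] A) :
    f (LinearMap.mul' k A (S.lTensor A t)) = LinearMap.mul' k B (S'.lTensor B (tmap2 f t)) := by
  induction t with
  | zero => simp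
  | add s t hs ht => simp only [map_add, hs, ht]
  | tmul a b => simp [hS]

end Squares

end Transport

namespace BraidedHopf


variable {k A B : Type*} [Field k] [Ring A] [Algebra k A] [Ring B] [Algebra k B]

theorem counit_comul_left' (H : BraidedHopf k A) (a : A) :
    TensorProduct.lid k A (H.counit.rTensor A (H.comul a)) = a := by
  rw [H.counit_comul_left]; simp

theorem counit_comul_right' (H : BraidedHopf k A) (a : A) :
    TensorProduct.rid k A (H.counit.lTensor A (H.comul a)) = a := by
  rw [H.counit_comul_right]; simp

/-- A braided Hopf algebra structure descends along a surjective algebra map to which all structure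
maps descend. -/
theorem exists_of_surjective (H : BraidedHopf k A) (f : A →ₐ[k] B) (hf : Function.Surjective f)
    (hc : ∀ t, tmap2 f t = 0 → tmap2 f (H.c t) = 0)
    (hc' : ∀ t, tmap2 f t = 0 → tmap2 f (H.c.symm t) = 0)
    (hΔ : ∀ a, f a = 0 → tmap2 f (H.comul a) = 0) (hε : ∀ a, f a = 0 → H.counit a = 0)
    (hS : ∀ a, f a = 0 ↔ f (H.antipode a) = 0) : ∃ K : BraidedHopf k B, H.IsHom K f := by
  have hf2 : Function.Surjective (tmap2 f) := TensorProduct.map_surjective hf hf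
  have hf3 : Function.Surjective (tmap3 f) := TensorProduct.map_surjective hf hf2
  obtain ⟨c1, h1⟩ := exists_descend (tmap2 f) hf2 (tmap2 f ∘ₗ H.c.toLinearMap) hc
  obtain ⟨c2, h2⟩ := exists_descend (tmap2 f) hf2 (tmap2 f ∘ₗ H.c.symm.toLinearMap) hc'
  obtain ⟨D, hD⟩ := exists_descend f.toLinearMap hf (tmap2 f ∘ₗ H.comul) hΔ
  obtain ⟨E, hE⟩ := exists_descend f.toLinearMap hf H.counit hε
  obtain ⟨S, hS'⟩ := exists_descend f.toLinearMap hf (f.toLinearMap ∘ₗ H.antipode)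
    fun a ha => (hS a).mp ha
  simp only [LinearMap.comp_apply, LinearEquiv.coe_coe, AlgHom.toLinearMap_apply] at h1 h2 hD hE hS'
  have h12 : c1 ∘ₗ c2 = LinearMap.id := LinearMap.ext fun x => by
    obtain ⟨t, rfl⟩ := hf2 x
    simp [h1, h2]
  have h21 : c2 ∘ₗ c1 = LinearMap.id := LinearMap.ext fun x => by
    obtain ⟨t, rfl⟩ := hf2 x
    simp [h1, h2]
  let c : B ⊗[k] B ≃ₗ[k] B ⊗[k] B := LinearEquiv.ofLinearMap c1 c2 h12 h21
  have hC : ∀ t, tmap2 f (H.c t) = c (tmap2 f t) := fun t => (h1 t).symm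
  have hCl : ∀ t, tmap2 f (H.c.toLinearMap t) = c.toLinearMap (tmap2 f t) := hC
  replace hD := fun a => (hD a).symm
  replace hE := fun a => (hE a).symm
  have hSB : Function.Bijective S := by
    refine ⟨(injective_iff_map_eq_zero S).mpr fun x hx => ?_, fun x => ?_⟩
    · obtain ⟨a, rfl⟩ := hf x
      exact (hS a).mpr ((hS' a).symm.trans hx)
    · obtain ⟨a, rfl⟩ := hf x
      obtain ⟨b, rfl⟩ := H.antipode_bijective.2 a
      exact ⟨f b, hS' b⟩
  replace hS := fun a => (hS' a).symm
  refine ⟨{ c := c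
            comul := D
            counit := E
            antipode := S
            braid_eq := ?_
            c_one_left := ?_
            c_one_right := ?_
            c_mul_left := ?_
            c_mul_right := ?_
            c_counit_left := ?_
            c_counit_right := ?_
            c_comul_left := ?_
            c_comul_right := ?_
            coassoc := ?_
            counit_comul_left := ?_
            counit_comul_right := ?_
            comul_one := ?_
            comul_mul := ?_
            counit_one := ?_
            counit_mul := ?_
            antipode_left := ?_
            antipode_right := ?_
            antipode_bijective := ?_ },
    hC, hD, fun a => (hE a).symm, hS⟩
  · refine LinearMap.ext fun x => ?_
    obtain ⟨t, rfl⟩ := hf3 x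
    have := congrArg (tmap3 f) (LinearMap.congr_fun H.braid_eq t)
    simp only [LinearMap.comp_apply, tmap3_braid12 hCl, tmap3_braid23 hCl] at this
    exact this
  · intro b
    obtain ⟨a, rfl⟩ := hf b
    have := congrArg (tmap2 f) (H.c_one_left a)
    rw [hC] at this
    simpa using this
  · intro b
    obtain ⟨a, rfl⟩ := hf b
    have := congrArg (tmap2 f) (H.c_one_right a)
    rw [hC] at this
    simpa using this
  · refine LinearMap.ext fun x => ?_
    obtain ⟨t, rfl⟩ := hf3 x
    have := congrArg (tmap2 f) (LinearMap.congr_fun H.c_mul_left t)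
    simp only [LinearMap.comp_apply, LinearEquiv.coe_coe, tmap3_braid12 hCl, tmap3_braid23 hCl,
      tmap3_assoc_symm, tmap2_mul_rTensor, tmap2_mul_lTensor, hC] at this
    exact this
  · refine LinearMap.ext fun x => ?_
    obtain ⟨t, rfl⟩ := hf3 x
    have := congrArg (tmap2 f) (LinearMap.congr_fun H.c_mul_right t)
    simp only [LinearMap.comp_apply, LinearEquiv.coe_coe, tmap3_braid12 hCl, tmap3_braid23 hCl,
      tmap3_assoc_symm, tmap2_mul_rTensor, tmap2_mul_lTensor, hC] at this
    exact this
  · refine LinearMap.ext fun x => ?_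
    obtain ⟨t, rfl⟩ := hf2 x
    have := congrArg (f) (LinearMap.congr_fun H.c_counit_left t)
    simp only [LinearMap.comp_apply, LinearEquiv.coe_coe, map_rid_lTensor hE, map_lid_rTensor hE,
      hC] at this
    exact this
  · refine LinearMap.ext fun x => ?_
    obtain ⟨t, rfl⟩ := hf2 x
    have := congrArg (f) (LinearMap.congr_fun H.c_counit_right t)
    simp only [LinearMap.comp_apply, LinearEquiv.coe_coe, map_rid_lTensor hE, map_lid_rTensor hE,
      hC] at this
    exact this
  · refine LinearMap.ext fun x => ?_
    obtain ⟨t, rfl⟩ := hf2 x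
    have := congrArg (tmap3 f) (LinearMap.congr_fun H.c_comul_left t)
    simp only [LinearMap.comp_apply, LinearEquiv.coe_coe, tmap3_braid12 hCl, tmap3_braid23 hCl,
      tmap3_assoc, tmap_lTensor hD, tmap_rTensor hD, hC] at this
    exact this
  · refine LinearMap.ext fun x => ?_
    obtain ⟨t, rfl⟩ := hf2 x
    have := congrArg (tmap3 f) (LinearMap.congr_fun H.c_comul_right t)
    simp only [LinearMap.comp_apply, LinearEquiv.coe_coe, tmap3_braid12 hCl, tmap3_braid23 hCl,
      tmap3_assoc, tmap_lTensor hD, tmap_rTensor hD, hC] at this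
    exact this
  · refine LinearMap.ext fun x => ?_
    obtain ⟨t, rfl⟩ := hf x
    have := congrArg (tmap3 f) (LinearMap.congr_fun H.coassoc t)
    simp only [LinearMap.comp_apply, LinearEquiv.coe_coe, tmap3_assoc, tmap_lTensor hD,
      tmap_rTensor hD, hD] at this
    exact this
  · intro b
    obtain ⟨a, rfl⟩ := hf b
    have := congrArg f (H.counit_comul_left' a)
    rw [map_lid_rTensor hE, hD] at this
    exact (TensorProduct.lid k B).injective (this.trans (by simp))
  · intro b
    obtain ⟨a, rfl⟩ := hf b
    have := congrArg f (H.counit_comul_right' a)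
    rw [map_rid_lTensor hE, hD] at this
    exact (TensorProduct.rid k B).injective (this.trans (by simp))
  · have := congrArg (tmap2 f) H.comul_one
    rw [hD] at this
    simpa using this
  · intro x y
    obtain ⟨a, rfl⟩ := hf x
    obtain ⟨b, rfl⟩ := hf y
    have := congrArg (tmap2 f) (H.comul_mul a b)
    rw [tmap2_braidedSquareMul hCl, hD, hD, hD, map_mul] at this
    exact this
  · rw [← map_one f, ← hE, H.counit_one]
  · intro x y
    obtain ⟨a, rfl⟩ := hf x
    obtain ⟨b, rfl⟩ := hf y
    rw [← map_mul, ← hE, ← hE, ← hE, H.counit_mul]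
  · intro x
    obtain ⟨a, rfl⟩ := hf x
    have := congrArg f (H.antipode_left a)
    rw [map_mul_rTensor hS, hD, hE] at this
    simpa using this
  · intro x
    obtain ⟨a, rfl⟩ := hf x
    have := congrArg f (H.antipode_right a)
    rw [map_mul_lTensor hS, hD, hE] at this
    simpa using this
  · exact hSB

/-- A braided Hopf algebra structure restricts along an injective algebra map whose image is stable
under all structure maps. -/
theorem exists_of_injective (K : BraidedHopf k B) (f : A →ₐ[k] B) (hf : Function.Injective f)
    (hc : ∀ t, K.c (tmap2 f t) ∈ LinearMap.range (tmap2 f))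
    (hc' : ∀ t, K.c.symm (tmap2 f t) ∈ LinearMap.range (tmap2 f))
    (hΔ : ∀ a, K.comul (f a) ∈ LinearMap.range (tmap2 f))
    (hS : ∀ a, K.antipode (f a) ∈ f.range) (hS' : ∀ a, ∃ b, K.antipode (f b) = f a) :
    ∃ H : BraidedHopf k A, H.IsHom K f := by
  have hf2 : Function.Injective (tmap2 f) := TensorProduct.map_injective_of_flat_flat _ _ hf hf
  have hf3 : Function.Injective (tmap3 f) := TensorProduct.map_injective_of_flat_flat _ _ hf hf2
  obtain ⟨c1, h1⟩ := exists_lift (tmap2 f) hf2 (K.c.toLinearMap ∘ₗ tmap2 f) hc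
  obtain ⟨c2, h2⟩ := exists_lift (tmap2 f) hf2 (K.c.symm.toLinearMap ∘ₗ tmap2 f) hc'
  obtain ⟨D, hD⟩ := exists_lift (tmap2 f) hf2 (K.comul ∘ₗ f.toLinearMap) hΔ
  obtain ⟨S, hS1⟩ := exists_lift f.toLinearMap hf (K.antipode ∘ₗ f.toLinearMap) hS
  simp only [LinearMap.comp_apply, LinearEquiv.coe_coe, AlgHom.toLinearMap_apply] at h1 h2 hD hS1
  have h12 : c1 ∘ₗ c2 = LinearMap.id := LinearMap.ext fun x => hf2 (by simp [h1, h2])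
  have h21 : c2 ∘ₗ c1 = LinearMap.id := LinearMap.ext fun x => hf2 (by simp [h1, h2])
  let c : A ⊗[k] A ≃ₗ[k] A ⊗[k] A := LinearEquiv.ofLinearMap c1 c2 h12 h21
  have hC : ∀ t, tmap2 f (c t) = K.c (tmap2 f t) := h1
  have hCl : ∀ t, tmap2 f (c.toLinearMap t) = K.c.toLinearMap (tmap2 f t) := h1
  let E := K.counit ∘ₗ f.toLinearMap
  have hE : ∀ a, E a = K.counit (f a) := fun _ => rfl
  have hSB : Function.Bijective S := by
    refine ⟨fun x y hxy => hf (K.antipode_bijective.1 ?_), fun x => ?_⟩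
    · rw [← hS1, ← hS1, hxy]
    · obtain ⟨b, hb⟩ := hS' x
      exact ⟨b, hf ((hS1 b).trans hb)⟩
  replace hS := hS1
  refine ⟨{ c := c
            comul := D
            counit := E
            antipode := S
            braid_eq := ?_
            c_one_left := ?_
            c_one_right := ?_
            c_mul_left := ?_
            c_mul_right := ?_
            c_counit_left := ?_
            c_counit_right := ?_
            c_comul_left := ?_
            c_comul_right := ?_
            coassoc := ?_
            counit_comul_left := ?_
            counit_comul_right := ?_
            comul_one := ?_
            comul_mul := ?_
            counit_one := ?_
            counit_mul := ?_
            antipode_left := ?_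
            antipode_right := ?_
            antipode_bijective := ?_ },
    hC, hD, fun a => (hE a).symm, hS⟩
  · refine LinearMap.ext fun x => hf3 ?_
    have := LinearMap.congr_fun K.braid_eq (tmap3 f x)
    simp only [LinearMap.comp_apply, tmap3_braid12 hCl, tmap3_braid23 hCl] at this ⊢
    exact this
  · intro a
    refine hf2 ?_
    have := K.c_one_left (f a)
    rw [hC]
    simpa using this
  · intro a
    refine hf2 ?_
    have := K.c_one_right (f a)
    rw [hC]
    simpa using this
  · refine LinearMap.ext fun x => hf2 ?_
    have := LinearMap.congr_fun K.c_mul_left (tmap3 f x)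
    simp only [LinearMap.comp_apply, LinearEquiv.coe_coe, tmap3_braid12 hCl, tmap3_braid23 hCl,
      tmap3_assoc_symm, tmap2_mul_rTensor, tmap2_mul_lTensor, hC] at this ⊢
    exact this
  · refine LinearMap.ext fun x => hf2 ?_
    have := LinearMap.congr_fun K.c_mul_right (tmap3 f x)
    simp only [LinearMap.comp_apply, LinearEquiv.coe_coe, tmap3_braid12 hCl, tmap3_braid23 hCl,
      tmap3_assoc_symm, tmap2_mul_rTensor, tmap2_mul_lTensor, hC] at this ⊢
    exact this
  · refine LinearMap.ext fun x => hf ?_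
    have := LinearMap.congr_fun K.c_counit_left (tmap2 f x)
    simp only [LinearMap.comp_apply, LinearEquiv.coe_coe, map_rid_lTensor hE, map_lid_rTensor hE,
      hC] at this ⊢
    exact this
  · refine LinearMap.ext fun x => hf ?_
    have := LinearMap.congr_fun K.c_counit_right (tmap2 f x)
    simp only [LinearMap.comp_apply, LinearEquiv.coe_coe, map_rid_lTensor hE, map_lid_rTensor hE,
      hC] at this ⊢
    exact this
  · refine LinearMap.ext fun x => hf3 ?_
    have := LinearMap.congr_fun K.c_comul_left (tmap2 f x)
    simp only [LinearMap.comp_apply, LinearEquiv.coe_coe, tmap3_braid12 hCl, tmap3_braid23 hCl,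
      tmap3_assoc, tmap_lTensor hD, tmap_rTensor hD, hC] at this ⊢
    exact this
  · refine LinearMap.ext fun x => hf3 ?_
    have := LinearMap.congr_fun K.c_comul_right (tmap2 f x)
    simp only [LinearMap.comp_apply, LinearEquiv.coe_coe, tmap3_braid12 hCl, tmap3_braid23 hCl,
      tmap3_assoc, tmap_lTensor hD, tmap_rTensor hD, hC] at this ⊢
    exact this
  · refine LinearMap.ext fun x => hf3 ?_
    have := LinearMap.congr_fun K.coassoc (f x)
    simp only [LinearMap.comp_apply, LinearEquiv.coe_coe, tmap3_assoc, tmap_lTensor hD,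
      tmap_rTensor hD, hD] at this ⊢
    exact this
  · intro a
    refine (TensorProduct.lid k A).injective (hf ?_)
    rw [map_lid_rTensor hE, hD, K.counit_comul_left']
    simp
  · intro a
    refine (TensorProduct.rid k A).injective (hf ?_)
    rw [map_rid_lTensor hE, hD, K.counit_comul_right']
    simp
  · refine hf2 ?_
    rw [hD, map_one, K.comul_one]
    simp
  · intro x y
    refine hf2 ?_
    rw [tmap2_braidedSquareMul hCl, hD, hD, hD, map_mul, K.comul_mul]
  · rw [hE, map_one, K.counit_one]
  · intro x y
    rw [hE, hE, hE, map_mul, K.counit_mul]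
  · intro x
    refine hf ?_
    rw [map_mul_rTensor hS, hD, K.antipode_left, hE]
    simp
  · intro x
    refine hf ?_
    rw [map_mul_lTensor hS, hD, K.antipode_right, hE]
    simp
  · exact hSB

theorem tmul_mem_tensorSub {P Q : Submodule k A} {a b : A} (ha : a ∈ P) (hb : b ∈ Q) :
    a ⊗ₜ[k] b ∈ tensorSub P Q :=
  ⟨(⟨a, ha⟩ : P) ⊗ₜ (⟨b, hb⟩ : Q), rfl⟩

theorem tensorSub_le {P Q : Submodule k A} {M : Submodule k (A ⊗[k] A)} :
    tensorSub P Q ≤ M ↔ ∀ a ∈ P, ∀ b ∈ Q, a ⊗ₜ[k] b ∈ M := by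
  refine ⟨fun h a ha b hb => h (tmul_mem_tensorSub ha hb), fun h => ?_⟩
  rw [tensorSub, TensorProduct.range_mapIncl, Submodule.map₂_le]
  exact h

theorem tensorSub_mono {P Q P' Q' : Submodule k A} (hP : P ≤ P') (hQ : Q ≤ Q') :
    tensorSub P Q ≤ tensorSub P' Q' :=
  tensorSub_le.mpr fun _ ha _ hb => tmul_mem_tensorSub (hP ha) (hQ hb)

theorem ker_tmap2 (f : A →ₐ[k] B) (hf : Function.Surjective f) {P : Submodule k A}
    (hP : ∀ a, f a = 0 ↔ a ∈ P) :
    LinearMap.ker (tmap2 f) = tensorSub P ⊤ ⊔ tensorSub ⊤ P := by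
  have hex : Function.Exact P.subtype f.toLinearMap := fun a => by
    simp [hP]
  refine le_antisymm ?_ (sup_le ?_ ?_)
  · rw [TensorProduct.map_ker hex hf hex hf]
    refine sup_le ?_ ?_
    · rintro _ ⟨t, rfl⟩
      induction t with
      | zero => simp
      | add s t hs ht => rw [map_add]; exact add_mem hs ht
      | tmul a b => exact Submodule.mem_sup_right (tmul_mem_tensorSub trivial b.2)
    · rintro _ ⟨t, rfl⟩
      induction t with
      | zero => simp
      | add s t hs ht => rw [map_add]; exact add_mem hs ht
      | tmul a b => exact Submodule.mem_sup_left (tmul_mem_tensorSub a.2 trivial)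
  · refine tensorSub_le.mpr fun a ha b _ => ?_
    simp [(hP a).mpr ha]
  · refine tensorSub_le.mpr fun a _ b hb => ?_
    simp [(hP b).mpr hb]

theorem mem_idealSub {I : TwoSidedIdeal A} {x : A} : x ∈ idealSub k I ↔ x ∈ I := by
  rw [idealSub, Submodule.restrictScalars_mem, TwoSidedIdeal.mem_asIdeal]

theorem mk_eq_zero_iff (I : TwoSidedIdeal A) (x : A) :
    Ideal.Quotient.mkₐ k I.asIdeal x = 0 ↔ x ∈ I := by
  rw [Ideal.Quotient.mkₐ_eq_mk, Ideal.Quotient.eq_zero_iff_mem, TwoSidedIdeal.mem_asIdeal]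

/-- The quotient of a braided Hopf algebra by a Hopf ideal is a braided Hopf algebra. -/
theorem IsHopfIdeal.exists_quotient {H : BraidedHopf k A} {I : TwoSidedIdeal A}
    (hI : H.IsHopfIdeal I) :
    ∃ K : BraidedHopf k (A ⧸ I.asIdeal), H.IsHom K (Ideal.Quotient.mkₐ k I.asIdeal) := by
  have hker := ker_tmap2 (Ideal.Quotient.mkₐ k I.asIdeal) (Ideal.Quotient.mkₐ_surjective k _)
    (P := idealSub k I) (fun a => by rw [mk_eq_zero_iff, mem_idealSub])
  refine H.exists_of_surjective _ (Ideal.Quotient.mkₐ_surjective k _) ?_ ?_ ?_ ?_ ?_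
  · intro t ht
    rw [← LinearMap.mem_ker, hker] at ht ⊢
    rw [← hI.map_c]
    exact Submodule.mem_map_of_mem ht
  · intro t ht
    rw [← LinearMap.mem_ker, hker] at ht ⊢
    rw [← hI.map_c] at ht
    obtain ⟨s, hs, rfl⟩ := ht
    simpa using hs
  · intro a ha
    rw [← LinearMap.mem_ker, hker]
    exact hI.comul_mem a ((mk_eq_zero_iff I a).mp ha)
  · exact fun a ha => hI.counit_eq a ((mk_eq_zero_iff I a).mp ha)
  · intro a
    rw [mk_eq_zero_iff, mk_eq_zero_iff, ← mem_idealSub (k := k), ← mem_idealSub (k := k)]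
    refine ⟨fun h => ?_, fun h => ?_⟩
    · rw [← hI.map_antipode]
      exact Submodule.mem_map_of_mem h
    · rw [← hI.map_antipode] at h
      obtain ⟨b, hb, hab⟩ := h
      rwa [← H.antipode_bijective.1 hab]

theorem tensorSub_inf (P : Submodule k A) : tensorSub P ⊤ ⊓ tensorSub ⊤ P = tensorSub P P := by
  refine le_antisymm ?_ (le_inf (tensorSub_mono le_rfl le_top) (tensorSub_mono le_top le_rfl))
  obtain ⟨p, hp⟩ := P.subtype.exists_leftInverse_of_injective (by simp)
  -- the projection of `A` to `P` shows that `t = (p ⊗ p) t` for `t` in the intersection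
  let e : A →ₗ[k] A := P.subtype ∘ₗ p
  have he : ∀ a ∈ P, e a = a := fun a ha =>
    congrArg Subtype.val (LinearMap.congr_fun hp ⟨a, ha⟩)
  have h1 : tensorSub P ⊤ ≤ LinearMap.eqLocus (TensorProduct.map e LinearMap.id) LinearMap.id :=
    tensorSub_le.mpr fun a ha b _ => by simp [LinearMap.mem_eqLocus, he a ha]
  have h2 : tensorSub ⊤ P ≤ LinearMap.eqLocus (TensorProduct.map LinearMap.id e) LinearMap.id :=
    tensorSub_le.mpr fun a _ b hb => by simp [LinearMap.mem_eqLocus, he b hb]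
  have h3 (t : A ⊗[k] A) : TensorProduct.map e LinearMap.id (TensorProduct.map LinearMap.id e t) ∈
      tensorSub P P := by
    induction t with
    | zero => simp
    | add s t hs ht => rw [map_add, map_add]; exact add_mem hs ht
    | tmul a b => exact tmul_mem_tensorSub (p a).2 (p b).2
  rintro t ⟨ht1, ht2⟩
  have e1 := h1 ht1
  have e2 := h2 ht2
  rw [LinearMap.mem_eqLocus, LinearMap.id_apply] at e1 e2
  have := h3 t
  rwa [e2, e1] at this

/-- A braided Hopf subalgebra is a braided Hopf algebra. -/
theorem IsHopfSubalgebra.exists_sub {K : BraidedHopf k A} {Z : Subalgebra k A}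
    (hZ : K.IsHopfSubalgebra Z) : ∃ H : BraidedHopf k Z, H.IsHom K Z.val := by
  have hr : LinearMap.range (tmap2 Z.val) =
      tensorSub (Subalgebra.toSubmodule Z) (Subalgebra.toSubmodule Z) := rfl
  refine K.exists_of_injective Z.val Subtype.val_injective ?_ ?_ ?_ ?_ ?_
  · intro t
    have ht : tmap2 Z.val t ∈ tensorSub (Subalgebra.toSubmodule Z) (Subalgebra.toSubmodule Z) :=
      ⟨t, rfl⟩
    rw [hr, ← tensorSub_inf]
    rw [← tensorSub_inf] at ht
    refine ⟨?_, ?_⟩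
    · rw [SetLike.mem_coe, ← hZ.map_c_right]
      exact Submodule.mem_map_of_mem ht.2
    · rw [SetLike.mem_coe, ← hZ.map_c_left]
      exact Submodule.mem_map_of_mem ht.1
  · intro t
    have ht : tmap2 Z.val t ∈ tensorSub (Subalgebra.toSubmodule Z) (Subalgebra.toSubmodule Z) :=
      ⟨t, rfl⟩
    rw [hr, ← tensorSub_inf]
    rw [← tensorSub_inf] at ht
    obtain ⟨h1, h2⟩ := ht
    rw [SetLike.mem_coe, ← hZ.map_c_right] at h1
    rw [SetLike.mem_coe, ← hZ.map_c_left] at h2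
    obtain ⟨s1, hs1, e1⟩ := h1
    obtain ⟨s2, hs2, e2⟩ := h2
    refine ⟨?_, ?_⟩
    · rw [← e2]; simpa using hs2
    · rw [← e1]; simpa using hs1
  · exact fun a => hZ.comul_mem a a.2
  · intro a
    have : K.antipode a ∈ Subalgebra.toSubmodule Z := by
      rw [← hZ.map_antipode]
      exact Submodule.mem_map_of_mem a.2
    exact ⟨⟨_, this⟩, rfl⟩
  · intro a
    have : (a : A) ∈ Subalgebra.toSubmodule Z := a.2
    rw [← hZ.map_antipode] at this
    obtain ⟨b, hb, hab⟩ := this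
    exact ⟨⟨b, hb⟩, hab⟩

end BraidedHopf

/-! ### Ideals of the tensor algebra of a diagonal braiding -/

namespace BraidedHopf

variable {k A : Type*} [Field k] [Ring A] [Algebra k A]

/-- The subspace `I ⊗ A + A ⊗ I` of `A ⊗ A`. -/
def coidealSub (k : Type*) [Field k] {A : Type*} [Ring A] [Algebra k A] (I : TwoSidedIdeal A) :
    Submodule k (A ⊗[k] A) :=
  tensorSub (idealSub k I) ⊤ ⊔ tensorSub ⊤ (idealSub k I)

theorem tmul_mem_coidealSub_left {I : TwoSidedIdeal A} {a : A} (ha : a ∈ I) (b : A) :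
    a ⊗ₜ[k] b ∈ coidealSub k I :=
  Submodule.mem_sup_left (tmul_mem_tensorSub (mem_idealSub.mpr ha) trivial)

theorem tmul_mem_coidealSub_right {I : TwoSidedIdeal A} (a : A) {b : A} (hb : b ∈ I) :
    a ⊗ₜ[k] b ∈ coidealSub k I :=
  Submodule.mem_sup_right (tmul_mem_tensorSub trivial (mem_idealSub.mpr hb))

theorem coidealSub_le {I : TwoSidedIdeal A} {M : Submodule k (A ⊗[k] A)} :
    coidealSub k I ≤ M ↔ ∀ a ∈ I, ∀ b, a ⊗ₜ[k] b ∈ M ∧ b ⊗ₜ[k] a ∈ M := by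
  rw [coidealSub, sup_le_iff, tensorSub_le, tensorSub_le]
  exact ⟨fun h a ha b => ⟨h.1 a (mem_idealSub.mpr ha) b trivial,
    h.2 b trivial a (mem_idealSub.mpr ha)⟩, fun h => ⟨fun a ha b _ =>
    (h a (mem_idealSub.mp ha) b).1,
    fun b _ a ha => (h a (mem_idealSub.mp ha) b).2⟩⟩

theorem coidealSub_mono {I J : TwoSidedIdeal A} (h : I ≤ J) : coidealSub k I ≤ coidealSub k J :=
  coidealSub_le.mpr fun _ ha b =>
    ⟨tmul_mem_coidealSub_left (h ha) b, tmul_mem_coidealSub_right b (h ha)⟩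

theorem map_mem_coidealSub {I : TwoSidedIdeal A} {g h : A →ₗ[k] A} (hg : ∀ a ∈ I, g a ∈ I)
    (hh : ∀ a ∈ I, h a ∈ I) {t : A ⊗[k] A} (ht : t ∈ coidealSub k I) :
    TensorProduct.map g h t ∈ coidealSub k I := by
  have : coidealSub k I ≤ (coidealSub k I).comap (TensorProduct.map g h) :=
    coidealSub_le.mpr fun a ha b =>
      ⟨tmul_mem_coidealSub_left (hg a ha) _, tmul_mem_coidealSub_right _ (hh a ha)⟩
  exact this ht

end BraidedHopf

namespace DiagTensor

open BraidedHopf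

variable {k : Type*} [Field k] {ι : Type*} (q : ι → ι → kˣ)

/-- A subspace stable under left and right multiplication by the generators contains the two-sided
ideal generated by any of its subsets. -/
theorem mem_of_mem_span {G : Set (FreeAlgebra k ι)} (M : Submodule k (FreeAlgebra k ι))
    (hG : ∀ g ∈ G, g ∈ M) (hl : ∀ i, ∀ y ∈ M, FreeAlgebra.ι k i * y ∈ M)
    (hr : ∀ i, ∀ y ∈ M, y * FreeAlgebra.ι k i ∈ M) {x : FreeAlgebra k ι}
    (hx : x ∈ TwoSidedIdeal.span G) : x ∈ M := by
  have hl' (a : FreeAlgebra k ι) : ∀ y ∈ M, a * y ∈ M := by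
    induction a using FreeAlgebra.induction with
    | grade0 r => intro y hy; rw [← Algebra.smul_def]; exact M.smul_mem r hy
    | grade1 i => exact hl i
    | mul a b ha hb => intro y hy; rw [mul_assoc]; exact ha _ (hb _ hy)
    | add a b ha hb => intro y hy; rw [add_mul]; exact add_mem (ha _ hy) (hb _ hy)
  have hr' (a : FreeAlgebra k ι) : ∀ y ∈ M, y * a ∈ M := by
    induction a using FreeAlgebra.induction with
    | grade0 r =>
      intro y hy; rw [← Algebra.commutes, ← Algebra.smul_def]; exact M.smul_mem r hy
    | grade1 i => exact hr i
    | mul a b ha hb => intro y hy; rw [← mul_assoc]; exact hb _ (ha _ hy)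
    | add a b ha hb => intro y hy; rw [mul_add]; exact add_mem (ha _ hy) (hb _ hy)
  induction hx using TwoSidedIdeal.span_induction with
  | mem x h => exact hG x h
  | zero => exact M.zero_mem
  | add x y _ _ hx hy => exact add_mem hx hy
  | neg x _ hx => exact neg_mem hx
  | left_absorb a x _ hx => exact hl' a x hx
  | right_absorb a x _ hx => exact hr' a x hx

/-- The algebra map `x i ↦ t i • x i`. -/
def torus (t : ι → kˣ) : FreeAlgebra k ι →ₐ[k] FreeAlgebra k ι :=
  FreeAlgebra.lift k fun j => (t j : k) • FreeAlgebra.ι k j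

theorem act_eq_torus (u : FreeMonoid ι) : act q u = torus fun j => chi q u (FreeMonoid.of j) := rfl

theorem actR_eq_torus (u : FreeMonoid ι) : actR q u = torus fun j => chi q (FreeMonoid.of j) u :=
  rfl

@[simp]
theorem torus_ι (t : ι → kˣ) (j : ι) :
    torus t (FreeAlgebra.ι k j) = (t j : k) • FreeAlgebra.ι k j := by
  rw [torus, FreeAlgebra.lift_ι_apply]

theorem torus_word (t : ι → kˣ) (w : FreeMonoid ι) :
    torus t (word k ι w) = (FreeMonoid.lift t w : k) • word k ι w := by
  induction w using FreeMonoid.inductionOn' with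
  | one => simp [word_one]
  | of_mul i v ih => rw [word_mul, map_mul, ih, word_of, torus_ι, map_mul, Units.val_mul,
      FreeMonoid.lift_eval_of, smul_mul_smul_comm]

theorem torus_torus_inv (t : ι → kˣ) (x : FreeAlgebra k ι) : torus t (torus t⁻¹ x) = x := by
  have : (torus t).comp (torus t⁻¹) = AlgHom.id k _ := by
    ext i
    simp [smul_smul]
  exact DFunLike.congr_fun this x

theorem torus_mem_span {G : Set (FreeAlgebra k ι)} (hG : ∀ g ∈ G, ∀ t, ∃ c : k, torus t g = c • g)
    (t : ι → kˣ) : ∀ x ∈ TwoSidedIdeal.span G, torus t x ∈ TwoSidedIdeal.span G := by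
  intro x hx
  have hsmul (c : k) {y : FreeAlgebra k ι} (hy : y ∈ TwoSidedIdeal.span G) :
      c • y ∈ TwoSidedIdeal.span G := by
    rw [Algebra.smul_def]; exact TwoSidedIdeal.mul_mem_left _ _ _ hy
  refine (mem_idealSub (k := k)).mp (mem_of_mem_span
    ((idealSub k (TwoSidedIdeal.span G)).comap (torus t).toLinearMap) ?_ ?_ ?_ hx)
  · intro g hg
    obtain ⟨c, hc⟩ := hG g hg t
    rw [Submodule.mem_comap, mem_idealSub, AlgHom.toLinearMap_apply, hc]
    exact hsmul c (TwoSidedIdeal.subset_span hg)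
  · intro i y hy
    rw [Submodule.mem_comap, mem_idealSub, AlgHom.toLinearMap_apply] at hy ⊢
    rw [map_mul]
    exact TwoSidedIdeal.mul_mem_left _ _ _ hy
  · intro i y hy
    rw [Submodule.mem_comap, mem_idealSub, AlgHom.toLinearMap_apply] at hy ⊢
    rw [map_mul]
    exact TwoSidedIdeal.mul_mem_right _ _ _ hy

/-- Right multiplication by `Δ(x i)` in the braided tensor square. -/
def primMulR (i : ι) : Module.End k (FreeAlgebra k ι ⊗[k] FreeAlgebra k ι) :=
  TensorProduct.map (LinearMap.mulRight k (FreeAlgebra.ι k i))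
    (actR q (FreeMonoid.of i)).toLinearMap
    + (LinearMap.mulRight k (FreeAlgebra.ι k i)).lTensor _

theorem comul_ι (i : ι) : comul q (FreeAlgebra.ι k i) =
    FreeAlgebra.ι k i ⊗ₜ 1 + 1 ⊗ₜ FreeAlgebra.ι k i := by
  have := comul_ι_mul q i 1
  rw [mul_one, comul_one] at this
  rw [this]
  simp [primMul]

theorem comul_mul_ι (i : ι) (y : FreeAlgebra k ι) :
    comul q (y * FreeAlgebra.ι k i) = primMulR q i (comul q y) := by
  rw [comul_mul, comul_ι]
  have : braidedSquareMul (braid q) ∘ₗ (TensorProduct.mk k (FreeAlgebra k ι ⊗[k] FreeAlgebra k ι)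
      (FreeAlgebra k ι ⊗[k] FreeAlgebra k ι)).flip
        (FreeAlgebra.ι k i ⊗ₜ 1 + 1 ⊗ₜ FreeAlgebra.ι k i) = primMulR q i := by
    refine hom_ext2 fun a b => ?_
    have h1 := squareMul_word q a b (FreeMonoid.of i) 1
    have h2 := squareMul_word q a b 1 (FreeMonoid.of i)
    rw [word_of, word_one] at h1 h2
    simp [h1, h2, primMulR, actR_word, word_mul, word_of]
  exact LinearMap.congr_fun this _

/-- The matrix of the inverse braiding. -/
def qinv : ι → ι → kˣ := fun i j => (q j i)⁻¹

theorem chi_of_of (i j : ι) : chi q (FreeMonoid.of i) (FreeMonoid.of j) = q i j := by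
  simp [chi]

theorem chi_qinv (u v : FreeMonoid ι) : chi (qinv q) u v = (chi q v u)⁻¹ := by
  have h (i : ι) (v : FreeMonoid ι) :
      chi (qinv q) (FreeMonoid.of i) v = (chi q v (FreeMonoid.of i))⁻¹ := by
    induction v using FreeMonoid.inductionOn' with
    | one => simp
    | of_mul j v ih =>
      rw [map_mul, ih, map_mul, MonoidHom.mul_apply, mul_inv, chi_of_of, chi_of_of, qinv]
  induction u using FreeMonoid.inductionOn' with
  | one => simp
  | of_mul i u ih => rw [map_mul, MonoidHom.mul_apply, ih, map_mul, mul_inv, h]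

theorem lift_eq_of_perm {M : Type*} [CommMonoid M] (f : ι → M) {u v : FreeMonoid ι}
    (h : u.toList.Perm v.toList) : FreeMonoid.lift f u = FreeMonoid.lift f v := by
  rw [FreeMonoid.lift_apply, FreeMonoid.lift_apply]
  exact (h.map f).prod_eq

theorem chi_perm_left {u v : FreeMonoid ι} (h : u.toList.Perm v.toList) : chi q u = chi q v :=
  lift_eq_of_perm _ h

theorem chi_perm_right (w : FreeMonoid ι) {u v : FreeMonoid ι} (h : u.toList.Perm v.toList) :
    chi q w u = chi q w v := by
  induction w using FreeMonoid.inductionOn' with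
  | one => simp
  | of_mul i w ih =>
    rw [map_mul, MonoidHom.mul_apply, ih, MonoidHom.mul_apply]
    congr 1
    rw [chi, FreeMonoid.lift_eval_of]
    exact lift_eq_of_perm _ h

theorem braidInv_eq : braidInv q = braid (qinv q) := by
  refine hom_ext2 fun u v => ?_
  rw [braid_word, braidInv_word, chi_qinv]

theorem antipodeCoeff_append (u v : List ι) : antipodeCoeff q (u ++ v) =
    antipodeCoeff q u * antipodeCoeff q v * chi q (FreeMonoid.ofList u) (FreeMonoid.ofList v) := by
  induction u with
  | nil => simp [antipodeCoeff]
  | cons i u ih =>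
    rw [List.cons_append, antipodeCoeff, ih, antipodeCoeff, FreeMonoid.ofList_append, map_mul,
      FreeMonoid.ofList_cons, map_mul, MonoidHom.mul_apply]
    exact Units.ext (by push_cast; ring)

theorem antipodeCoeff_qinv_reverse (w : List ι) :
    antipodeCoeff (qinv q) w.reverse * antipodeCoeff q w = 1 := by
  induction w with
  | nil => simp [antipodeCoeff]
  | cons i w ih =>
    have hr : chi q (FreeMonoid.of i) (FreeMonoid.ofList w.reverse) =
        chi q (FreeMonoid.of i) (FreeMonoid.ofList w) :=
      chi_perm_right q _ (List.reverse_perm w)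
    rw [List.reverse_cons, antipodeCoeff_append, chi_qinv, antipodeCoeff,
      FreeMonoid.ofList_singleton, hr, antipodeCoeff]
    calc _ = antipodeCoeff (qinv q) w.reverse * antipodeCoeff q w *
          ((chi q (FreeMonoid.of i) (FreeMonoid.ofList w))⁻¹ *
            chi q (FreeMonoid.of i) (FreeMonoid.ofList w)) :=
        Units.ext (by simp [antipodeCoeff])
      _ = 1 := by rw [ih, inv_mul_cancel, one_mul]

theorem antipode_qinv_antipode (x : FreeAlgebra k ι) : antipode (qinv q) (antipode q x) = x := by
  have : antipode (qinv q) ∘ₗ antipode q = LinearMap.id := (word k ι).ext fun w => by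
    have := antipodeCoeff_qinv_reverse q w.toList
    rw [LinearMap.comp_apply, antipode_word, map_smul, antipode_word, smul_smul,
      FreeMonoid.reverse_reverse, LinearMap.id_apply, ← Units.val_mul, mul_comm]
    change ((antipodeCoeff (qinv q) w.toList.reverse * antipodeCoeff q w.toList : kˣ) : k) • _ = _
    rw [this, Units.val_one, one_smul]
  exact LinearMap.congr_fun this x

theorem antipode_one : antipode q 1 = (1 : FreeAlgebra k ι) := by
  rw [← word_one, antipode_word]
  change ((1 : kˣ) : k) • word k ι 1 = _
  simp

theorem antipode_mul_word (v : FreeMonoid ι) (y : FreeAlgebra k ι) :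
    antipode q (word k ι v * y) = act q v (antipode q y) * antipode q (word k ι v) := by
  have : antipode q ∘ₗ LinearMap.mulLeft k (word k ι v) =
      LinearMap.mulRight k (antipode q (word k ι v)) ∘ₗ (act q v).toLinearMap ∘ₗ antipode q :=
    (word k ι).ext fun w => by
      have h := antipodeCoeff_append q v.toList w.toList
      have hr : chi q v w.reverse = chi q v w := chi_perm_right q v (List.reverse_perm w.toList)
      simp only [LinearMap.comp_apply, LinearMap.mulLeft_apply, LinearMap.mulRight_apply,
        AlgHom.toLinearMap_apply, ← word_mul, antipode_word, map_smul, act_word, hr,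
        FreeMonoid.reverse_mul, FreeMonoid.toList_mul, h, FreeMonoid.ofList_toList]
      rw [word_mul, smul_smul, mul_smul_comm, smul_smul]
      congr 1
      push_cast
      ring
  exact LinearMap.congr_fun this y

theorem antipode_mul_ι (i : ι) (y : FreeAlgebra k ι) : antipode q (y * FreeAlgebra.ι k i) =
    -(FreeAlgebra.ι k i * actR q (FreeMonoid.of i) (antipode q y)) := by
  have : antipode q ∘ₗ LinearMap.mulRight k (FreeAlgebra.ι k i) =
      -(LinearMap.mulLeft k (FreeAlgebra.ι k i) ∘ₗ
        (actR q (FreeMonoid.of i)).toLinearMap ∘ₗ antipode q) :=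
    (word k ι).ext fun w => by
      have h := antipodeCoeff_append q w.toList [i]
      have hr : chi q w.reverse = chi q w := chi_perm_left q (List.reverse_perm w.toList)
      have hi : antipodeCoeff q [i] = -1 := by simp [antipodeCoeff]
      simp only [LinearMap.comp_apply, LinearMap.mulLeft_apply, LinearMap.mulRight_apply,
        LinearMap.neg_apply, ← word_of, AlgHom.toLinearMap_apply, ← word_mul, antipode_word,
        map_smul, actR_word, hr, FreeMonoid.reverse_mul, FreeMonoid.toList_mul,
        FreeMonoid.reverse_of, FreeMonoid.toList_of, h, hi, FreeMonoid.ofList_toList]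
      rw [word_mul, smul_smul, ← neg_smul]
      congr 1
      simp
  exact LinearMap.congr_fun this y

theorem torus_antipode (t : ι → kˣ) (y : FreeAlgebra k ι) :
    torus t (antipode q y) = antipode q (torus t y) := by
  have : (torus t).toLinearMap ∘ₗ antipode q = antipode q ∘ₗ (torus t).toLinearMap :=
    (word k ι).ext fun w => by
      have hr : FreeMonoid.lift t w.reverse = FreeMonoid.lift t w :=
        lift_eq_of_perm t (List.reverse_perm w.toList)
      simp only [LinearMap.comp_apply, AlgHom.toLinearMap_apply, antipode_word, map_smul,
        torus_word, hr]
      exact smul_comm _ _ _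
  exact LinearMap.congr_fun this y

theorem antipode_mem_span {G : Set (FreeAlgebra k ι)}
    (hG : ∀ g ∈ G, ∀ t, ∃ c : k, torus t g = c • g)
    (hS : ∀ g ∈ G, antipode q g ∈ TwoSidedIdeal.span G) :
    ∀ x ∈ TwoSidedIdeal.span G, antipode q x ∈ TwoSidedIdeal.span G := by
  intro x hx
  refine (mem_idealSub (k := k)).mp (mem_of_mem_span
    ((idealSub k (TwoSidedIdeal.span G)).comap (antipode q)) ?_ ?_ ?_ hx)
  · exact fun g hg => (mem_idealSub (k := k)).mpr (hS g hg)
  · intro i y hy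
    rw [Submodule.mem_comap, mem_idealSub] at hy ⊢
    rw [antipode_ι_mul, antipode_act]
    exact neg_mem (TwoSidedIdeal.mul_mem_right _ _ _ (torus_mem_span hG _ _ hy))
  · intro i y hy
    rw [Submodule.mem_comap, mem_idealSub] at hy ⊢
    rw [antipode_mul_ι]
    exact neg_mem (TwoSidedIdeal.mul_mem_left _ _ _ (torus_mem_span hG _ _ hy))

theorem braid_mem_coidealSub {I : TwoSidedIdeal (FreeAlgebra k ι)}
    (hI : ∀ t, ∀ x ∈ I, torus t x ∈ I) {s : FreeAlgebra k ι ⊗[k] FreeAlgebra k ι}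
    (hs : s ∈ coidealSub k I) : braid q s ∈ coidealSub k I := by
  have : coidealSub k I ≤ (coidealSub k I).comap (braid q) := by
    refine coidealSub_le.mpr fun a ha b => ?_
    simp only [Submodule.mem_comap]
    have hb := (word k ι).mem_span b
    induction hb using Submodule.span_induction with
    | zero => simp
    | add b b' _ _ h h' =>
      simp only [TensorProduct.tmul_add, TensorProduct.add_tmul, map_add]
      exact ⟨add_mem h.1 h'.1, add_mem h.2 h'.2⟩
    | smul c b _ h =>
      rw [TensorProduct.tmul_smul, ← TensorProduct.smul_tmul', map_smul, map_smul]
      exact ⟨Submodule.smul_mem _ _ h.1, Submodule.smul_mem _ _ h.2⟩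
    | mem b hb =>
      obtain ⟨w, rfl⟩ := hb
      rw [braid_word_left, braid_word_right]
      exact ⟨tmul_mem_coidealSub_right _ (hI _ _ ha), tmul_mem_coidealSub_left (hI _ _ ha) _⟩
  exact this hs

/-- A two-sided ideal of the tensor algebra generated by eigenvectors of the torus is a Hopf ideal
as soon as the generators satisfy the conditions on the comultiplication, the counit, and the
antipode with its inverse. -/
theorem isHopfIdeal_span {G : Set (FreeAlgebra k ι)}
    (hG : ∀ g ∈ G, ∀ t, ∃ c : k, torus t g = c • g)
    (hΔ : ∀ g ∈ G, comul q g ∈ coidealSub k (TwoSidedIdeal.span G))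
    (hε : ∀ g ∈ G, counit k ι g = 0)
    (hS : ∀ g ∈ G, antipode q g ∈ TwoSidedIdeal.span G)
    (hS' : ∀ g ∈ G, antipode (qinv q) g ∈ TwoSidedIdeal.span G) :
    (hopf q).IsHopfIdeal (TwoSidedIdeal.span G) := by
  have hT := torus_mem_span hG
  refine ⟨?_, ?_, ?_, ?_⟩
  · change (coidealSub k _).map (braid q) = coidealSub k _
    refine le_antisymm ?_ fun s hs => ?_
    · rintro _ ⟨s, hs, rfl⟩
      exact braid_mem_coidealSub q hT hs
    · refine ⟨braid (qinv q) s, braid_mem_coidealSub (qinv q) hT hs, ?_⟩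
      rw [← braidInv_eq]
      exact (braidEquiv q).apply_symm_apply s
  · intro x hx
    refine mem_of_mem_span ((coidealSub k (TwoSidedIdeal.span G)).comap (comul q)) hΔ ?_ ?_ hx
    · intro i y hy
      rw [Submodule.mem_comap] at hy ⊢
      rw [comul_ι_mul, primMul, LinearMap.add_apply]
      exact add_mem
        (map_mem_coidealSub (fun a ha => TwoSidedIdeal.mul_mem_left _ _ _ ha) (fun a ha => ha) hy)
        (map_mem_coidealSub (hT _) (fun a ha => TwoSidedIdeal.mul_mem_left _ _ _ ha) hy)
    · intro i y hy
      rw [Submodule.mem_comap] at hy ⊢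
      rw [comul_mul_ι, primMulR, LinearMap.add_apply]
      exact add_mem
        (map_mem_coidealSub (fun a ha => TwoSidedIdeal.mul_mem_right _ _ _ ha) (hT _) hy)
        (map_mem_coidealSub (fun a ha => ha) (fun a ha => TwoSidedIdeal.mul_mem_right _ _ _ ha) hy)
  · intro x hx
    refine mem_of_mem_span (LinearMap.ker (counit k ι).toLinearMap) hε ?_ ?_ hx
    · intro i y hy
      rw [LinearMap.mem_ker, AlgHom.toLinearMap_apply] at hy ⊢
      rw [map_mul, hy, mul_zero]
    · intro i y hy
      rw [LinearMap.mem_ker, AlgHom.toLinearMap_apply] at hy ⊢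
      rw [map_mul, hy, zero_mul]
  · change (idealSub k _).map (antipode q) = _
    refine le_antisymm ?_ fun x hx => ?_
    · rintro _ ⟨x, hx, rfl⟩
      exact mem_idealSub.mpr (antipode_mem_span q hG hS x (mem_idealSub.mp hx))
    · refine ⟨antipode (qinv q) x, mem_idealSub.mpr
        (antipode_mem_span _ hG hS' x (mem_idealSub.mp hx)), ?_⟩
      have := antipode_qinv_antipode (qinv q) x
      rwa [show qinv (qinv q) = q by funext i j; simp [qinv]] at this

/-- The antipode and its inverse map a primitive element to its negative. -/
theorem antipode_of_primitive {g : FreeAlgebra k ι} (hg : comul q g = g ⊗ₜ 1 + 1 ⊗ₜ g) :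
    counit k ι g = 0 ∧ antipode q g = -g ∧ antipode (qinv q) g = -g := by
  have h1 := antipode_left q g
  have hε : counit k ι g = 0 := by
    have h0 := counit_left q g
    rw [hg] at h0
    have := congrArg (counit k ι) (congrArg (TensorProduct.lid k _) h0)
    simpa using this
  rw [hg, hε] at h1
  simp [antipode_one] at h1
  have hS : antipode q g = -g := eq_neg_of_add_eq_zero_left h1
  refine ⟨hε, hS, ?_⟩
  have := antipode_qinv_antipode q g
  rw [hS, map_neg] at this
  exact neg_eq_iff_eq_neg.mp this
end DiagTensor

/-! ### Homogeneous elements and word coefficients -/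

namespace DiagTensor

open BraidedHopf

variable {k : Type*} [Field k] {ι : Type*} (q : ι → ι → kˣ)

/-- The homogeneous elements of the multidegree of the word `w`: the span of the rearrangements
of `w`. -/
def homog (k : Type*) [Field k] {ι : Type*} (w : FreeMonoid ι) : Submodule k (FreeAlgebra k ι) :=
  Submodule.span k (word k ι '' {v | v.toList.Perm w.toList})

theorem ι_mem_homog (i : ι) : FreeAlgebra.ι k i ∈ homog k (FreeMonoid.of i) :=
  Submodule.subset_span ⟨FreeMonoid.of i, List.Perm.refl _, word_of i⟩

theorem mul_mem_homog {u v : FreeMonoid ι} {x y : FreeAlgebra k ι} (hx : x ∈ homog k u)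
    (hy : y ∈ homog k v) : x * y ∈ homog k (u * v) := by
  have := Submodule.mul_mem_mul hx hy
  rw [homog, homog, Submodule.span_mul_span] at this
  refine Submodule.span_mono ?_ this
  rintro _ ⟨_, ⟨a, ha, rfl⟩, _, ⟨b, hb, rfl⟩, rfl⟩
  exact ⟨a * b, List.Perm.append ha hb, word_mul a b⟩

theorem homog_eq_of_perm {u v : FreeMonoid ι} (h : u.toList.Perm v.toList) :
    homog k u = homog k v := by
  unfold homog
  congr 2
  ext w
  exact ⟨fun hw => hw.trans h, fun hw => hw.trans h.symm⟩

/-- Linear maps which agree on the rearrangements of `w` agree on `homog k w`. -/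
theorem eqOn_homog {M : Type*} [AddCommGroup M] [Module k M] {f g : FreeAlgebra k ι →ₗ[k] M}
    {w : FreeMonoid ι} (h : ∀ v, v.toList.Perm w.toList → f (word k ι v) = g (word k ι v))
    {x : FreeAlgebra k ι} (hx : x ∈ homog k w) : f x = g x := by
  refine LinearMap.eqOn_span ?_ hx
  rintro _ ⟨v, hv, rfl⟩
  exact h v hv

theorem torus_of_mem_homog (t : ι → kˣ) {w : FreeMonoid ι} {x : FreeAlgebra k ι}
    (hx : x ∈ homog k w) : torus t x = (FreeMonoid.lift t w : k) • x := by
  simpa using eqOn_homog (f := (torus t).toLinearMap)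
    (g := LinearMap.lsmul k (FreeAlgebra k ι) (FreeMonoid.lift t w : k))
    (fun v hv => by simp [torus_word, lift_eq_of_perm t hv]) hx

theorem act_of_mem_homog (u : FreeMonoid ι) {w : FreeMonoid ι} {x : FreeAlgebra k ι}
    (hx : x ∈ homog k w) : act q u x = (chi q u w : k) • x := by
  simpa using eqOn_homog (f := (act q u).toLinearMap)
    (g := LinearMap.lsmul k (FreeAlgebra k ι) (chi q u w : k))
    (fun v hv => by simp [act_word, chi_perm_right q u hv]) hx

theorem actR_of_mem_homog (u : FreeMonoid ι) {w : FreeMonoid ι} {x : FreeAlgebra k ι}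
    (hx : x ∈ homog k w) : actR q u x = (chi q w u : k) • x := by
  simpa using eqOn_homog (f := (actR q u).toLinearMap)
    (g := LinearMap.lsmul k (FreeAlgebra k ι) (chi q w u : k))
    (fun v hv => by simp [actR_word, chi_perm_left q hv]) hx

theorem act_eq_of_perm {u v : FreeMonoid ι} (h : u.toList.Perm v.toList) : act q u = act q v := by
  rw [act, act, chi_perm_left q h]

theorem braid_of_mem_homog_left {w : FreeMonoid ι} {x : FreeAlgebra k ι} (hx : x ∈ homog k w)
    (y : FreeAlgebra k ι) : braid q (x ⊗ₜ y) = act q w y ⊗ₜ x :=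
  eqOn_homog (f := braid q ∘ₗ (TensorProduct.mk k _ _).flip y)
    (g := TensorProduct.mk k _ _ (act q w y))
    (fun v hv => by simp [braid_word_left, act_eq_of_perm q hv]) hx

theorem braid_of_mem_homog_right {w : FreeMonoid ι} {x : FreeAlgebra k ι} (hx : x ∈ homog k w)
    (y : FreeAlgebra k ι) : braid q (y ⊗ₜ x) = x ⊗ₜ actR q w y :=
  eqOn_homog (f := braid q ∘ₗ TensorProduct.mk k _ _ y)
    (g := (TensorProduct.mk k _ _).flip (actR q w y))
    (fun v hv => by
      have : actR q v = actR q w := by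
        rw [actR_eq_torus, actR_eq_torus]
        congr 1
        funext j
        exact chi_perm_right q _ hv
      simp [braid_word_right, this]) hx

theorem antipode_mul_of_mem_homog {w : FreeMonoid ι} {x : FreeAlgebra k ι} (hx : x ∈ homog k w)
    (y : FreeAlgebra k ι) : antipode q (x * y) = act q w (antipode q y) * antipode q x :=
  eqOn_homog (f := antipode q ∘ₗ LinearMap.mulRight k y)
    (g := LinearMap.mulLeft k (act q w (antipode q y)) ∘ₗ antipode q)
    (fun v hv => by simp [antipode_mul_word, act_eq_of_perm q hv]) hx

/-- Generators which are homogeneous are eigenvectors of the torus. -/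
theorem exists_torus_eq_smul {w : FreeMonoid ι} {x : FreeAlgebra k ι} (hx : x ∈ homog k w)
    (t : ι → kˣ) : ∃ c : k, torus t x = c • x :=
  ⟨_, torus_of_mem_homog t hx⟩

theorem degreeProj_word (n : ℕ) (w : FreeMonoid ι) :
    degreeProj k ι n (word k ι w) = if w.length = n then word k ι w else 0 := by
  rw [degreeProj, Module.Basis.constr_basis]

theorem degreeProj_of_mem_homog {w : FreeMonoid ι} {x : FreeAlgebra k ι} (hx : x ∈ homog k w)
    (n : ℕ) : degreeProj k ι n x = if w.length = n then x else 0 := by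
  have : degreeProj k ι n x = (if w.length = n then LinearMap.id else 0 :
      FreeAlgebra k ι →ₗ[k] FreeAlgebra k ι) x :=
    eqOn_homog (fun v hv => by
      rw [degreeProj_word, show v.length = w.length from hv.length_eq]
      split <;> rfl) hx
  rw [this]
  split <;> rfl

/-- An ideal generated by homogeneous elements is graded. -/
theorem isGraded_span {G : Set (FreeAlgebra k ι)} (hG : ∀ g ∈ G, ∃ w, g ∈ homog k w) :
    IsGraded (TwoSidedIdeal.span G) := by
  intro x hx
  let M : Submodule k (FreeAlgebra k ι) :=
    ⨅ n, (idealSub k (TwoSidedIdeal.span G)).comap (degreeProj k ι n)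
  have hM (y : FreeAlgebra k ι) : y ∈ M ↔ ∀ n, degreeProj k ι n y ∈ TwoSidedIdeal.span G := by
    simp only [M, Submodule.mem_iInf, Submodule.mem_comap, mem_idealSub]
  have hl (i : ι) (y : FreeAlgebra k ι) (n : ℕ) : degreeProj k ι (n + 1) (FreeAlgebra.ι k i * y) =
      FreeAlgebra.ι k i * degreeProj k ι n y := by
    have : degreeProj k ι (n + 1) ∘ₗ LinearMap.mulLeft k (FreeAlgebra.ι k i) =
        LinearMap.mulLeft k (FreeAlgebra.ι k i) ∘ₗ degreeProj k ι n := (word k ι).ext fun w => by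
      simp only [LinearMap.comp_apply, LinearMap.mulLeft_apply, ← word_of, ← word_mul,
        degreeProj_word, FreeMonoid.length_mul, FreeMonoid.length_of, add_comm 1,
        Nat.add_right_cancel_iff]
      split <;> simp [word_mul]
    exact LinearMap.congr_fun this y
  have hr (i : ι) (y : FreeAlgebra k ι) (n : ℕ) : degreeProj k ι (n + 1) (y * FreeAlgebra.ι k i) =
      degreeProj k ι n y * FreeAlgebra.ι k i := by
    have : degreeProj k ι (n + 1) ∘ₗ LinearMap.mulRight k (FreeAlgebra.ι k i) =
        LinearMap.mulRight k (FreeAlgebra.ι k i) ∘ₗ degreeProj k ι n := (word k ι).ext fun w => by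
      simp only [LinearMap.comp_apply, LinearMap.mulRight_apply, ← word_of, ← word_mul,
        degreeProj_word, FreeMonoid.length_mul, FreeMonoid.length_of,
        Nat.add_right_cancel_iff]
      split <;> simp [word_mul]
    exact LinearMap.congr_fun this y
  have hl0 (i : ι) (y : FreeAlgebra k ι) : degreeProj k ι 0 (FreeAlgebra.ι k i * y) = 0 := by
    have : degreeProj k ι 0 ∘ₗ LinearMap.mulLeft k (FreeAlgebra.ι k i) = 0 :=
      (word k ι).ext fun w => by
        simp only [LinearMap.comp_apply, LinearMap.mulLeft_apply, ← word_of, ← word_mul,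
          degreeProj_word, FreeMonoid.length_mul, FreeMonoid.length_of]
        simp
    exact LinearMap.congr_fun this y
  have hr0 (i : ι) (y : FreeAlgebra k ι) : degreeProj k ι 0 (y * FreeAlgebra.ι k i) = 0 := by
    have : degreeProj k ι 0 ∘ₗ LinearMap.mulRight k (FreeAlgebra.ι k i) = 0 :=
      (word k ι).ext fun w => by
        simp only [LinearMap.comp_apply, LinearMap.mulRight_apply, ← word_of, ← word_mul,
          degreeProj_word, FreeMonoid.length_mul, FreeMonoid.length_of]
        simp
    exact LinearMap.congr_fun this y
  refine (hM x).mp (mem_of_mem_span M ?_ ?_ ?_ hx)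
  · intro g hg
    obtain ⟨w, hw⟩ := hG g hg
    refine (hM g).mpr fun n => ?_
    rw [degreeProj_of_mem_homog hw]
    split
    · exact TwoSidedIdeal.subset_span hg
    · exact zero_mem _
  · intro i y hy
    refine (hM _).mpr fun n => ?_
    cases n with
    | zero => rw [hl0]; exact zero_mem _
    | succ n => rw [hl]; exact TwoSidedIdeal.mul_mem_left _ _ _ ((hM y).mp hy n)
  · intro i y hy
    refine (hM _).mpr fun n => ?_
    cases n with
    | zero => rw [hr0]; exact zero_mem _
    | succ n => rw [hr]; exact TwoSidedIdeal.mul_mem_right _ _ _ ((hM y).mp hy n)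

/-- The coefficient of the word `w`. -/
def coeff (k : Type*) [Field k] {ι : Type*} (w : FreeMonoid ι) : FreeAlgebra k ι →ₗ[k] k :=
  (word k ι).coord w

theorem coeff_word (v w : FreeMonoid ι) [Decidable (w = v)] :
    coeff k v (word k ι w) = if w = v then 1 else 0 := by
  classical
  rw [coeff, Module.Basis.coord_apply, Module.Basis.repr_self, Finsupp.single_apply]

theorem coeff_one_eq_counit (x : FreeAlgebra k ι) : coeff k 1 x = counit k ι x := by
  classical
  have : coeff k 1 = (counit k ι).toLinearMap := (word k ι).ext fun w => by
    rw [coeff_word]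
    induction w using FreeMonoid.inductionOn' with
    | one => simp [word_one]
    | of_mul i w =>
      rw [AlgHom.toLinearMap_apply, counit_word_of_mul, if_neg]
      intro h
      have := congrArg FreeMonoid.length h
      simp at this
  exact LinearMap.congr_fun this x

theorem coeff_ι_mul [DecidableEq ι] (i j : ι) (w : FreeMonoid ι) (y : FreeAlgebra k ι) :
    coeff k (FreeMonoid.of i * w) (FreeAlgebra.ι k j * y) = if j = i then coeff k w y else 0 := by
  have : coeff k (FreeMonoid.of i * w) ∘ₗ LinearMap.mulLeft k (FreeAlgebra.ι k j) =
      if j = i then coeff k w else 0 := (word k ι).ext fun v => by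
    classical
    have h : FreeMonoid.of j * v = FreeMonoid.of i * w ↔ j = i ∧ v = w := List.cons_eq_cons
    rw [LinearMap.comp_apply, LinearMap.mulLeft_apply, ← word_of, ← word_mul, coeff_word]
    simp only [h]
    split_ifs <;> simp_all [coeff_word]
  have := LinearMap.congr_fun this y
  rw [LinearMap.comp_apply, LinearMap.mulLeft_apply] at this
  rw [this]
  split <;> rfl

theorem coeff_act (u w : FreeMonoid ι) (y : FreeAlgebra k ι) :
    coeff k w (act q u y) = (chi q u w : k) * coeff k w y := by
  classical
  have : coeff k w ∘ₗ (act q u).toLinearMap = (chi q u w : k) • coeff k w :=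
    (word k ι).ext fun v => by
      simp only [LinearMap.comp_apply, AlgHom.toLinearMap_apply, act_word, map_smul, coeff_word,
        LinearMap.smul_apply]
      split_ifs with h
      · rw [h]
      · simp
  exact LinearMap.congr_fun this y

/-- All coefficients at words shorter than the generators vanish on an ideal generated by
homogeneous elements. -/
theorem coeff_eq_zero_of_mem_span {G : Set (FreeAlgebra k ι)} {n : ℕ}
    (hG : ∀ g ∈ G, ∃ w, n ≤ w.length ∧ g ∈ homog k w) {w : FreeMonoid ι} (hw : w.length < n)
    {x : FreeAlgebra k ι} (hx : x ∈ TwoSidedIdeal.span G) : coeff k w x = 0 := by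
  classical
  let M : Submodule k (FreeAlgebra k ι) := Submodule.span k (word k ι '' {v | n ≤ v.length})
  have hM : x ∈ M := by
    refine mem_of_mem_span M ?_ ?_ ?_ hx
    · intro g hg
      obtain ⟨w, hw, hgw⟩ := hG g hg
      refine Submodule.span_mono (Set.image_mono fun v hv => ?_) hgw
      exact hw.trans hv.length_eq.ge
    · intro i y hy
      refine (Submodule.span_le (p := M.comap (LinearMap.mulLeft k (FreeAlgebra.ι k i)))).mpr ?_ hy
      rintro _ ⟨v, hv, rfl⟩
      refine Submodule.subset_span ⟨FreeMonoid.of i * v, ?_, by simp [word_mul, word_of]⟩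
      simp only [Set.mem_ofPred_eq, FreeMonoid.length_mul] at hv ⊢
      lia
    · intro i y hy
      refine (Submodule.span_le (p := M.comap (LinearMap.mulRight k (FreeAlgebra.ι k i)))).mpr ?_ hy
      rintro _ ⟨v, hv, rfl⟩
      refine Submodule.subset_span ⟨v * FreeMonoid.of i, ?_, by simp [word_mul, word_of]⟩
      simp only [Set.mem_ofPred_eq, FreeMonoid.length_mul] at hv ⊢
      lia
  refine (Submodule.span_le (p := LinearMap.ker (coeff k w))).mpr ?_ hM
  rintro _ ⟨v, hv, rfl⟩
  rw [SetLike.mem_coe, LinearMap.mem_ker, coeff_word, if_neg]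
  rintro rfl
  exact absurd hv (not_le.mpr hw)

theorem adWord_cons (i : ι) (l : List ι) (j : ι) : adWord q (i :: l) j =
    FreeAlgebra.ι k i * adWord q l j -
      act q (FreeMonoid.of i) (adWord q l j) * FreeAlgebra.ι k i := by
  have h (y : FreeAlgebra k ι) : (hopf q).ad (FreeAlgebra.ι k i) y =
      FreeAlgebra.ι k i * y - act q (FreeMonoid.of i) y * FreeAlgebra.ι k i := by
    have hS : (hopf q).antipode (FreeAlgebra.ι k i) = -FreeAlgebra.ι k i :=
      (antipode_of_primitive q (comul_ι q i)).2.1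
    have hS1 : (hopf q).antipode 1 = (1 : FreeAlgebra k ι) := antipode_one q
    have hc1 : (hopf q).c (1 ⊗ₜ y) = y ⊗ₜ 1 := (hopf q).c_one_left y
    have hci : (hopf q).c (FreeAlgebra.ι k i ⊗ₜ y) =
        act q (FreeMonoid.of i) y ⊗ₜ FreeAlgebra.ι k i :=
      braid_of_mem_homog_left q (ι_mem_homog i) y
    have hΔ : (hopf q).comul (FreeAlgebra.ι k i) = _ := comul_ι q i
    simp [BraidedHopf.ad, hΔ, TensorProduct.add_tmul, braid23, hc1, hci, hS, hS1, sub_eq_add_neg]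
  exact h _

theorem adWord_nil (j : ι) : adWord q [] j = FreeAlgebra.ι k j := rfl

end DiagTensor

/-! ### The Hopf ideal defining `B̂` -/

namespace RankTwo

open DiagTensor BraidedHopf

variable {k : Type*} [Field k] {q : Fin 2 → Fin 2 → kˣ}

/-- The matrix `q` is of Cartan type `A₂` at a primitive cube root of unity. -/
structure IsCubicA2 (q : Fin 2 → Fin 2 → kˣ) : Prop where
  root : (q 0 0 : k) ^ 2 + q 0 0 + 1 = 0
  diag : (q 1 1 : k) = q 0 0
  mono : (q 0 1 : k) * q 1 0 * q 0 0 = 1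

/-- The generator `x i` of the tensor algebra. -/
abbrev X (k : Type*) [Field k] (i : Fin 2) : FreeAlgebra k (Fin 2) := FreeAlgebra.ι k i

theorem adWord_mem_homog (q : Fin 2 → Fin 2 → kˣ) (l : List (Fin 2)) (j : Fin 2) :
    adWord q l j ∈ homog k (FreeMonoid.ofList (l ++ [j])) := by
  induction l with
  | nil => exact ι_mem_homog j
  | cons i l ih =>
    rw [adWord_cons]
    have hi := mul_mem_homog (ι_mem_homog (k := k) i) ih
    refine sub_mem hi ?_
    rw [act_of_mem_homog q _ ih, smul_mul_assoc]
    refine Submodule.smul_mem _ _ ?_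
    have := mul_mem_homog ih (ι_mem_homog (k := k) i)
    rwa [homog_eq_of_perm (v := FreeMonoid.ofList (i :: l ++ [j]))] at this
    exact List.perm_append_comm (l₂ := [i])

/-- The words giving the multidegrees of `z₁, …, z₅`. -/
def zWord : Fin 5 → FreeMonoid (Fin 2) :=
  ![FreeMonoid.ofList [1, 1, 1], FreeMonoid.ofList [1, 1, 0], FreeMonoid.ofList [0, 0, 1],
    FreeMonoid.ofList [0, 0, 0], FreeMonoid.ofList [0, 1, 0, 1, 0, 1]]

/-- The lifts of `z₁, …, z₅` to the tensor algebra. -/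
def zLift (q : Fin 2 → Fin 2 → kˣ) : Fin 5 → FreeAlgebra k (Fin 2) :=
  ![X k 1 ^ 3, adWord q [1, 1] 0, adWord q [0, 0] 1, X k 0 ^ 3, adWord q [0] 1 ^ 3]

theorem toHat_zLift (j : Fin 5) : toHat q (zLift q j) = z q j := by
  fin_cases j <;> rfl

theorem zLift_mem_homog (j : Fin 5) : zLift q j ∈ homog k (zWord j) := by
  have h3 {w : FreeMonoid (Fin 2)} {x : FreeAlgebra k (Fin 2)} (hx : x ∈ homog k w) :
      x ^ 3 ∈ homog k (w * (w * w)) := by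
    rw [pow_succ', pow_two]
    exact mul_mem_homog hx (mul_mem_homog hx hx)
  have e0 : (zWord 0 : FreeMonoid (Fin 2)) =
      FreeMonoid.of 1 * (FreeMonoid.of 1 * FreeMonoid.of 1) := rfl
  have e3 : (zWord 3 : FreeMonoid (Fin 2)) =
      FreeMonoid.of 0 * (FreeMonoid.of 0 * FreeMonoid.of 0) := rfl
  have e4 : (zWord 4 : FreeMonoid (Fin 2)) = FreeMonoid.ofList [0, 1] *
      (FreeMonoid.ofList [0, 1] * FreeMonoid.ofList [0, 1]) := rfl
  match j with
  | 0 => rw [e0, zLift]; exact h3 (ι_mem_homog 1)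
  | 1 => exact adWord_mem_homog q [1, 1] 0
  | 2 => exact adWord_mem_homog q [0, 0] 1
  | 3 => rw [e3, zLift]; exact h3 (ι_mem_homog 0)
  | 4 => rw [e4, zLift]; exact h3 (adWord_mem_homog q [0] 1)

theorem IsCubicA2.monodromy (h : IsCubicA2 q) (u : FreeMonoid (Fin 2)) (j : Fin 5) :
    chi q u (zWord j) * chi q (zWord j) u = 1 := by
  obtain ⟨h1, h2, h3⟩ := h
  induction u using FreeMonoid.inductionOn' with
  | one => simp
  | of_mul i u ih =>
    rw [map_mul, map_mul, MonoidHom.mul_apply, mul_mul_mul_comm, ih, mul_one]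
    apply Units.ext
    fin_cases i <;> fin_cases j <;>
    · simp [zWord, chi, FreeMonoid.lift_apply, h2]
      grind

theorem comul_mul_X (i j : Fin 2) : comul q (X k i * X k j) =
    (X k i * X k j) ⊗ₜ 1 + X k i ⊗ₜ X k j + (q i j : k) • X k j ⊗ₜ X k i +
      1 ⊗ₜ (X k i * X k j) := by
  rw [comul_ι_mul, comul_ι]
  simp [primMul, act_eq_torus, chi_of_of, TensorProduct.smul_tmul']
  abel

theorem comul_mul_X3 (i j l : Fin 2) : comul q (X k i * (X k j * X k l)) =
    (X k i * (X k j * X k l)) ⊗ₜ 1 + (X k i * X k j) ⊗ₜ X k l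
     + (q j l : k) • (X k i * X k l) ⊗ₜ X k j + X k i ⊗ₜ (X k j * X k l)
     + ((q i j * q i l : kˣ) : k) • (X k j * X k l) ⊗ₜ X k i
     + (q i j : k) • X k j ⊗ₜ (X k i * X k l)
     + ((q j l * q i l : kˣ) : k) • X k l ⊗ₜ (X k i * X k j)
     + 1 ⊗ₜ (X k i * (X k j * X k l)) := by
  rw [comul_ι_mul, comul_mul_X]
  simp only [primMul, act_eq_torus, chi_of_of, map_add, map_smul, LinearMap.add_apply,
    LinearMap.rTensor_tmul,
    TensorProduct.map_tmul, LinearMap.mulLeft_apply, AlgHom.toLinearMap_apply, map_mul, torus_ι,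
     map_one, mul_one, ← TensorProduct.smul_tmul', Units.val_mul, smul_mul_smul_comm]
  module

/-- The four elements `x₂³, x₂₂₁, x₁₁₂, x₁³` are primitive in the tensor algebra. -/
theorem IsCubicA2.comul_zLift (h : IsCubicA2 q) {j : Fin 5} (hj : j ≠ 4) :
    comul q (zLift q j) = zLift q j ⊗ₜ 1 + 1 ⊗ₜ zLift q j := by
  obtain ⟨h1, h2, h3⟩ := h
  fin_cases j
  · simp only [zLift, pow_succ', pow_zero, mul_one]
    simp [comul_mul_X3, h2]
    match_scalars <;> grind
  · simp [zLift, adWord_cons, adWord_nil, mul_sub, sub_mul, comul_mul_X3, h2, act_eq_torus,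
      chi_of_of, mul_assoc, TensorProduct.tmul_sub, TensorProduct.sub_tmul,
      ← TensorProduct.smul_tmul']
    match_scalars <;> grind
  · simp [zLift, adWord_cons, adWord_nil, mul_sub, sub_mul, comul_mul_X3, h2, act_eq_torus,
      chi_of_of, mul_assoc, TensorProduct.tmul_sub, TensorProduct.sub_tmul,
      ← TensorProduct.smul_tmul']
    match_scalars <;> grind
  · simp only [zLift, pow_succ', pow_zero, mul_one]
    simp [comul_mul_X3]
    match_scalars <;> grind
  · exact absurd rfl hj

/-- A `q`-commutator of a generator with a primitive homogeneous element is primitive when the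
monodromy of the degrees is trivial. -/
theorem comul_bracket {i : Fin 2} {w : FreeMonoid (Fin 2)} {y : FreeAlgebra k (Fin 2)}
    (hy : y ∈ homog k w) (hΔ : comul q y = y ⊗ₜ 1 + 1 ⊗ₜ y)
    (hm : chi q (FreeMonoid.of i) w * chi q w (FreeMonoid.of i) = 1) :
    comul q (X k i * y - (chi q (FreeMonoid.of i) w : k) • (y * X k i)) =
      (X k i * y - (chi q (FreeMonoid.of i) w : k) • (y * X k i)) ⊗ₜ 1 +
        1 ⊗ₜ (X k i * y - (chi q (FreeMonoid.of i) w : k) • (y * X k i)) := by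
  have hm' := congrArg Units.val hm
  rw [Units.val_mul, Units.val_one] at hm'
  rw [map_sub, map_smul, comul_ι_mul, comul_mul_ι, hΔ]
  simp [primMul, primMulR, act_of_mem_homog q _ hy, actR_of_mem_homog q _ hy,
    TensorProduct.tmul_sub, TensorProduct.sub_tmul, smul_smul, hm', TensorProduct.smul_tmul']
  abel

theorem IsCubicA2.isHopfIdeal_hatIdeal (h : IsCubicA2 q) : (hopf q).IsHopfIdeal (hatIdeal q) := by
  have key (i : Fin 2) (l : List (Fin 2)) (j : Fin 2) (m : Fin 5) (hm : m ≠ 4)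
      (hl : zLift q m = adWord q l j) : comul q (adWord q (i :: l) j) =
        adWord q (i :: l) j ⊗ₜ 1 + 1 ⊗ₜ adWord q (i :: l) j := by
    have := comul_bracket (zLift_mem_homog m) (h.comul_zLift hm)
      (h.monodromy (FreeMonoid.of i) m)
    rw [adWord_cons, ← hl, act_of_mem_homog q _ (zLift_mem_homog m), smul_mul_assoc]
    exact this
  have hprim : ∀ g ∈ ({adWord q [0, 0, 0] 1, adWord q [1, 1, 1] 0, adWord q [1, 0, 0] 1,
    adWord q [0, 1, 1] 0} : Set (FreeAlgebra k (Fin 2))), comul q g = g ⊗ₜ 1 + 1 ⊗ₜ g := by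
    rintro g (rfl | rfl | rfl | rfl)
    · exact key 0 [0, 0] 1 2 (by decide) rfl
    · exact key 1 [1, 1] 0 1 (by decide) rfl
    · exact key 1 [0, 0] 1 2 (by decide) rfl
    · exact key 0 [1, 1] 0 1 (by decide) rfl
  refine isHopfIdeal_span q ?_ ?_ ?_ ?_ ?_
  · rintro g (rfl | rfl | rfl | rfl) t <;>
    exact exists_torus_eq_smul (adWord_mem_homog q _ _) t
  · intro g hg
    rw [hprim g hg]
    exact add_mem (tmul_mem_coidealSub_left (TwoSidedIdeal.subset_span hg) _)
      (tmul_mem_coidealSub_right _ (TwoSidedIdeal.subset_span hg))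
  · exact fun g hg => (antipode_of_primitive q (hprim g hg)).1
  · intro g hg
    rw [(antipode_of_primitive q (hprim g hg)).2.1]
    exact neg_mem (TwoSidedIdeal.subset_span hg)
  · intro g hg
    rw [(antipode_of_primitive q (hprim g hg)).2.2]
    exact neg_mem (TwoSidedIdeal.subset_span hg)

end RankTwo

/-! ### Commutation relations in `B̂` -/

/-- The commutation relations between `x = x₁`, `y = x₂`, `u = x₁₂`, `v = x₂₂₁`, `w = x₁₁₂` in `B̂`,
with `p = q₁₂`, `r = q₂₁`. -/
structure PBWRelations {k A : Type*} [Field k] [Ring A] [Algebra k A] (ζ p r : k)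
    (x y u v w : A) : Prop where
  root : ζ ^ 2 + ζ + 1 = 0
  mono : p * r * ζ = 1
  xy : x * y = p • (y * x) + u
  xu : x * u = (ζ * p) • (u * x) + w
  uy : u * y = (p * ζ) • (y * u) + (p ^ 2 * ζ) • v
  xv : x * v = (p ^ 2 * ζ) • (v * x)
  yv : y * v = (ζ ^ 2 * r) • (v * y)
  xw : x * w = (ζ ^ 2 * p) • (w * x)
  yw : y * w = (r ^ 2 * ζ) • (w * y)

namespace PBWRelations

variable {k A : Type*} [Field k] [Ring A] [Algebra k A] {ζ p r : k} {x y u v w : A}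

theorem assoc_left {a b c d : A} (h : a * b = c) : a * (b * d) = c * d := by
  rw [← mul_assoc, h]

theorem uv (h : PBWRelations ζ p r x y u v w) : u * v = (ζ ^ 2 * p) • (v * u) := by
  obtain ⟨h1, h2, xy, xu, uy, xv, yv, xw, yw⟩ := h
  have e : u = x * y - p • (y * x) := by rw [xy]; abel
  simp only [e, sub_mul, mul_sub, smul_mul_assoc, mul_smul_comm, mul_assoc, yv, xv, smul_sub,
    smul_smul, assoc_left yv, assoc_left xv]
  match_scalars <;> grind

theorem uw (h : PBWRelations ζ p r x y u v w) : u * w = (ζ ^ 2 * r) • (w * u) := by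
  obtain ⟨h1, h2, xy, xu, uy, xv, yv, xw, yw⟩ := h
  have e : u = x * y - p • (y * x) := by rw [xy]; abel
  simp only [e, sub_mul, mul_sub, smul_mul_assoc, mul_smul_comm, mul_assoc, yw, xw, smul_sub,
    smul_smul, assoc_left yw, assoc_left xw]
  match_scalars <;> grind

theorem x_mul_y3 (h : PBWRelations ζ p r x y u v w) : x * y ^ 3 = p ^ 3 • (y ^ 3 * x) := by
  obtain ⟨h1, h2, xy, xu, uy, xv, yv, xw, yw⟩ := h
  simp only [pow_succ', pow_zero, mul_one, mul_assoc, xy, assoc_left xy, uy, assoc_left uy, yv,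
    mul_add, add_mul, mul_smul_comm, smul_mul_assoc, smul_add, smul_smul]
  match_scalars <;> grind

theorem x3_mul_y (h : PBWRelations ζ p r x y u v w) : x ^ 3 * y = p ^ 3 • (y * x ^ 3) := by
  obtain ⟨h1, h2, xy, xu, uy, xv, yv, xw, yw⟩ := h
  simp only [pow_succ', pow_zero, mul_one, mul_assoc, xy, assoc_left xy, xu, assoc_left xu, xw,
    mul_add, add_mul, mul_smul_comm, smul_mul_assoc, smul_add, smul_smul]
  match_scalars <;> grind

theorem x_mul_u3 (h : PBWRelations ζ p r x y u v w) : x * u ^ 3 = p ^ 3 • (u ^ 3 * x) := by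
  have uw := h.uw
  obtain ⟨h1, h2, xy, xu, uy, xv, yv, xw, yw⟩ := h
  simp only [pow_succ', pow_zero, mul_one, mul_assoc, xu, assoc_left xu, uw,
    assoc_left uw, mul_add, add_mul, mul_smul_comm, smul_mul_assoc, smul_add, smul_smul]
  match_scalars <;> grind

theorem u3_mul_y (h : PBWRelations ζ p r x y u v w) : u ^ 3 * y = p ^ 3 • (y * u ^ 3) := by
  have uv := h.uv
  obtain ⟨h1, h2, xy, xu, uy, xv, yv, xw, yw⟩ := h
  simp only [pow_succ', pow_zero, mul_one, mul_assoc, uy, assoc_left uy, uv,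
    assoc_left uv, mul_add, add_mul, mul_smul_comm, smul_mul_assoc, smul_add, smul_smul]
  match_scalars <;> grind

open scoped TensorProduct in
/-- The comultiplication of `x₁₂³`: with `D` the left multiplication by `Δ(x₁₂)`, all terms of
`D³(1 ⊗ 1)` other than the four shown cancel by `1 + ζ + ζ² = 0`. -/
theorem cube_comul (h : PBWRelations ζ p r x y u v w) (g₁ g₂ : A →ₐ[k] A)
    (h1x : g₁ x = r • x) (h1u : g₁ u = (r * ζ) • u) (h2x : g₂ x = (ζ * r) • x) (h2u : g₂ u = ζ • u)
    (D : A ⊗[k] A →ₗ[k] A ⊗[k] A) (hD : ∀ a b, D (a ⊗ₜ b) = (u * a) ⊗ₜ b +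
      (1 - p * r) • ((x * g₁ a) ⊗ₜ[k] (y * b)) + g₂ a ⊗ₜ (u * b)) :
    D (D (u ⊗ₜ 1 + (1 - p * r) • (x ⊗ₜ[k] y) + 1 ⊗ₜ u)) = (u ^ 3) ⊗ₜ 1 +
      ((1 - p * r) ^ 3 * r ^ 3) • ((x ^ 3) ⊗ₜ[k] (y ^ 3)) +
      ((1 - p * r) * ζ ^ 2) • (w ⊗ₜ[k] v) + 1 ⊗ₜ (u ^ 3) := by
  have huv := h.uv
  have huw := h.uw
  obtain ⟨h1, h2, xy, xu, uy, xv, yv, xw, yw⟩ := h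
  simp only [map_add, map_smul, hD, map_mul, map_one, h1x, h1u, h2x, h2u, mul_one,
      ← TensorProduct.smul_tmul', smul_add, smul_smul, pow_succ', pow_zero, mul_assoc,
      mul_smul_comm, smul_mul_assoc]
  simp only [xu, assoc_left xu, uy, assoc_left uy, xw, huw, huv, yv,
      mul_add, add_mul, TensorProduct.tmul_add, TensorProduct.add_tmul, TensorProduct.tmul_smul,
      ← TensorProduct.smul_tmul', smul_add, smul_smul, mul_assoc, mul_smul_comm, smul_mul_assoc]
  clear xu uy xv yv xw yw xy huv huw hD h1x h1u h2x h2u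
  match_scalars <;> grind
end PBWRelations

namespace RankTwo

open DiagTensor BraidedHopf

variable {k : Type*} [Field k] {q : Fin 2 → Fin 2 → kˣ}

theorem toHat_surjective : Function.Surjective (toHat q) := Ideal.Quotient.mkₐ_surjective k _

theorem toHat_eq_zero_iff {x : FreeAlgebra k (Fin 2)} : toHat q x = 0 ↔ x ∈ hatIdeal q :=
  mk_eq_zero_iff _ _

theorem torus_mem_hatIdeal (t : Fin 2 → kˣ) :
    ∀ x ∈ hatIdeal q, torus t x ∈ hatIdeal q := by
  refine torus_mem_span ?_ t
  rintro g (rfl | rfl | rfl | rfl) t <;>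
  exact exists_torus_eq_smul (adWord_mem_homog q _ _) t

/-- The generator `x i` of `B̂`. -/
def x (q : Fin 2 → Fin 2 → kˣ) (i : Fin 2) : Hat q := toHat q (X k i)

/-- The element `x₁₂` of `B̂`. -/
def x12 (q : Fin 2 → Fin 2 → kˣ) : Hat q := toHat q (adWord q [0] 1)

theorem z_zero : z q 0 = x q 1 ^ 3 := map_pow _ _ _
theorem z_three : z q 3 = x q 0 ^ 3 := map_pow _ _ _
theorem z_four : z q 4 = x12 q ^ 3 := map_pow _ _ _

/-- The commutation relations of `B̂`. -/
theorem IsCubicA2.pbw (h : IsCubicA2 q) : PBWRelations (q 0 0 : k) (q 0 1) (q 1 0) (x q 0) (x q 1)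
    (x12 q) (z q 1) (z q 2) where
  root := h.root
  mono := h.mono
  xy := by
    have : adWord q [0] 1 = X k 0 * X k 1 - (q 0 1 : k) • (X k 1 * X k 0) := by
      simp [adWord_cons, adWord_nil, act_eq_torus, chi_of_of]
    rw [x12, this, map_sub, map_smul, map_mul, map_mul]
    simp [x]
  xu := by
    have : adWord q [0, 0] 1 = X k 0 * adWord q [0] 1
        - (q 0 0 * q 0 1 : k) • (adWord q [0] 1 * X k 0) := by
      rw [adWord_cons, act_of_mem_homog q _ (adWord_mem_homog q [0] 1)]
      simp [chi, FreeMonoid.lift_apply]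
    have e : z q 2 = toHat q (adWord q [0, 0] 1) := rfl
    rw [e, this, map_sub, map_smul, map_mul, map_mul]
    simp [x, x12]
  uy := by
    have : adWord q [0] 1 * X k 1 = (q 0 1 * q 0 0 : k) • (X k 1 * adWord q [0] 1) +
        (q 0 1 ^ 2 * q 0 0 : k) • adWord q [1, 1] 0 := by
      obtain ⟨h1, h2, h3⟩ := h
      simp [adWord_cons, adWord_nil, act_eq_torus, chi_of_of, mul_sub, sub_mul, mul_assoc,
        smul_sub, smul_smul, h2]
      match_scalars <;> grind
    have := congrArg (toHat q) this
    simpa using! this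
  xv := by
    have : toHat q (adWord q [0, 1, 1] 0) = 0 :=
      toHat_eq_zero_iff.mpr (TwoSidedIdeal.subset_span (by simp))
    rw [adWord_cons, act_of_mem_homog q _ (adWord_mem_homog q [1, 1] 0), map_sub,
      sub_eq_zero] at this
    have e : (chi q (FreeMonoid.of 0) (FreeMonoid.ofList ([1, 1] ++ [0])) : k) =
        q 0 1 ^ 2 * q 0 0 := by
      simp [chi, FreeMonoid.lift_apply]; ring
    rw [e] at this
    simpa using! this
  yv := by
    have : toHat q (adWord q [1, 1, 1] 0) = 0 :=
      toHat_eq_zero_iff.mpr (TwoSidedIdeal.subset_span (by simp))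
    rw [adWord_cons, act_of_mem_homog q _ (adWord_mem_homog q [1, 1] 0), map_sub,
      sub_eq_zero] at this
    have e : (chi q (FreeMonoid.of 1) (FreeMonoid.ofList ([1, 1] ++ [0])) : k) =
        q 0 0 ^ 2 * q 1 0 := by
      simp [chi, FreeMonoid.lift_apply, h.diag]; ring
    rw [e] at this
    simpa using! this
  xw := by
    have : toHat q (adWord q [0, 0, 0] 1) = 0 :=
      toHat_eq_zero_iff.mpr (TwoSidedIdeal.subset_span (by simp))
    rw [adWord_cons, act_of_mem_homog q _ (adWord_mem_homog q [0, 0] 1), map_sub,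
      sub_eq_zero] at this
    have e : (chi q (FreeMonoid.of 0) (FreeMonoid.ofList ([0, 0] ++ [1])) : k) =
        q 0 0 ^ 2 * q 0 1 := by
      simp [chi, FreeMonoid.lift_apply]; ring
    rw [e] at this
    simpa using! this
  yw := by
    have : toHat q (adWord q [1, 0, 0] 1) = 0 :=
      toHat_eq_zero_iff.mpr (TwoSidedIdeal.subset_span (by simp))
    rw [adWord_cons, act_of_mem_homog q _ (adWord_mem_homog q [0, 0] 1), map_sub,
      sub_eq_zero] at this
    have e : (chi q (FreeMonoid.of 1) (FreeMonoid.ofList ([0, 0] ++ [1])) : k) =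
        q 1 0 ^ 2 * q 0 0 := by
      simp [chi, FreeMonoid.lift_apply, h.diag]; ring
    rw [e] at this
    simpa using! this

theorem IsCubicA2.cube (h : IsCubicA2 q) : (q 0 0 : k) ^ 3 = 1 := by
  linear_combination ((q 0 0 : k) - 1) * h.root

/-- The `z j` are central up to the bicharacter. -/
theorem IsCubicA2.x_mul_z (h : IsCubicA2 q) (i : Fin 2) (j : Fin 5) :
    x q i * z q j = (chi q (FreeMonoid.of i) (zWord j) : k) • (z q j * x q i) := by
  have H := h.pbw
  have hd := h.diag
  have h3 := h.cube
  have hm : (q 1 0 : k) ^ 3 * (q 0 1 : k) ^ 3 = 1 := by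
    have := h.mono
    grind
  have hchi (i : Fin 2) (l : List (Fin 2)) : (chi q (FreeMonoid.of i) (FreeMonoid.ofList l) : k) =
      (l.map fun j => (q i j : k)).prod := by
    induction l with
    | nil => simp
    | cons j l ih =>
      rw [FreeMonoid.ofList_cons, map_mul, Units.val_mul, ih, chi_of_of]
      simp
  match j with
  | 0 =>
    have e : (chi q (FreeMonoid.of i) (zWord 0) : k) = q i 1 ^ 3 := by
      refine (hchi i [1, 1, 1]).trans ?_
      simp; ring
    rw [e, z_zero]
    match i with
    | 0 => exact H.x_mul_y3
    | 1 => rw [hd, h3, one_smul, ← pow_succ, ← pow_succ']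
  | 1 =>
    have e : (chi q (FreeMonoid.of i) (zWord 1) : k) = q i 1 ^ 2 * q i 0 := by
      refine (hchi i [1, 1, 0]).trans ?_
      simp; ring
    rw [e]
    match i with
    | 0 => exact H.xv
    | 1 => rw [hd]; exact H.yv
  | 2 =>
    have e : (chi q (FreeMonoid.of i) (zWord 2) : k) = q i 0 ^ 2 * q i 1 := by
      refine (hchi i [0, 0, 1]).trans ?_
      simp; ring
    rw [e]
    match i with
    | 0 => exact H.xw
    | 1 => rw [hd]; exact H.yw
  | 3 =>
    have e : (chi q (FreeMonoid.of i) (zWord 3) : k) = q i 0 ^ 3 := by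
      refine (hchi i [0, 0, 0]).trans ?_
      simp; ring
    rw [e, z_three]
    match i with
    | 0 => rw [h3, one_smul, ← pow_succ, ← pow_succ']
    | 1 => rw [H.x3_mul_y, smul_smul, hm, one_smul]
  | 4 =>
    have e : (chi q (FreeMonoid.of i) (zWord 4) : k) = q i 0 ^ 3 * q i 1 ^ 3 := by
      refine (hchi i [0, 1, 0, 1, 0, 1]).trans ?_
      simp; ring
    rw [e, z_four]
    match i with
    | 0 => rw [h3, one_mul]; exact H.x_mul_u3
    | 1 => rw [hd, h3, mul_one, H.u3_mul_y, smul_smul, hm, one_smul]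

/-- The diagonal automorphisms of `B̂`. -/
def hatTorus (q : Fin 2 → Fin 2 → kˣ) (t : Fin 2 → kˣ) : Hat q →ₐ[k] Hat q :=
  Ideal.Quotient.liftₐ (hatIdeal q).asIdeal ((toHat q).comp (torus t)) fun a ha => by
    rw [AlgHom.comp_apply, toHat_eq_zero_iff]
    exact torus_mem_hatIdeal t a ha

theorem hatTorus_toHat (t : Fin 2 → kˣ) (a : FreeAlgebra k (Fin 2)) :
    hatTorus q t (toHat q a) = toHat q (torus t a) := rfl

/-- The action on `B̂` of the degree of the word `w`. -/
def hatAct (q : Fin 2 → Fin 2 → kˣ) (w : FreeMonoid (Fin 2)) : Hat q →ₐ[k] Hat q :=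
  hatTorus q fun j => chi q w (FreeMonoid.of j)

theorem hatAct_toHat (w : FreeMonoid (Fin 2)) (a : FreeAlgebra k (Fin 2)) :
    hatAct q w (toHat q a) = toHat q (act q w a) := rfl

/-- The action on `B̂`, from the right, of the degree of the word `w`. -/
def hatActR (q : Fin 2 → Fin 2 → kˣ) (w : FreeMonoid (Fin 2)) : Hat q →ₐ[k] Hat q :=
  hatTorus q fun j => chi q (FreeMonoid.of j) w

theorem hatTorus_hatTorus_inv (t : Fin 2 → kˣ) (b : Hat q) :
    hatTorus q t (hatTorus q t⁻¹ b) = b := by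
  obtain ⟨a, rfl⟩ := toHat_surjective b
  rw [hatTorus_toHat, hatTorus_toHat, torus_torus_inv]

/-- The images in `B̂` of the homogeneous elements of multidegree `w`. -/
def hatHomog (q : Fin 2 → Fin 2 → kˣ) (w : FreeMonoid (Fin 2)) : Submodule k (Hat q) :=
  (homog k w).map (toHat q).toLinearMap

theorem toHat_mem_hatHomog {w : FreeMonoid (Fin 2)} {a : FreeAlgebra k (Fin 2)}
    (ha : a ∈ homog k w) : toHat q a ∈ hatHomog q w :=
  Submodule.mem_map_of_mem ha

theorem x_mem_hatHomog (i : Fin 2) : x q i ∈ hatHomog q (FreeMonoid.of i) :=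
  toHat_mem_hatHomog (ι_mem_homog i)

theorem x12_mem_hatHomog : x12 q ∈ hatHomog q (FreeMonoid.ofList [0, 1]) :=
  toHat_mem_hatHomog (adWord_mem_homog q [0] 1)

theorem z_mem_hatHomog (j : Fin 5) : z q j ∈ hatHomog q (zWord j) := by
  rw [← toHat_zLift]
  exact toHat_mem_hatHomog (zLift_mem_homog j)

theorem mul_mem_hatHomog {u v : FreeMonoid (Fin 2)} {a b : Hat q} (ha : a ∈ hatHomog q u)
    (hb : b ∈ hatHomog q v) : a * b ∈ hatHomog q (u * v) := by
  obtain ⟨a, ha, rfl⟩ := ha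
  obtain ⟨b, hb, rfl⟩ := hb
  exact ⟨a * b, mul_mem_homog ha hb, map_mul (toHat q) _ _⟩

theorem one_mem_hatHomog : (1 : Hat q) ∈ hatHomog q 1 :=
  ⟨1, Submodule.subset_span ⟨1, List.Perm.refl _, word_one⟩, map_one (toHat q)⟩

theorem hatTorus_of_mem_hatHomog (t : Fin 2 → kˣ) {w : FreeMonoid (Fin 2)} {b : Hat q}
    (hb : b ∈ hatHomog q w) : hatTorus q t b = (FreeMonoid.lift t w : k) • b := by
  obtain ⟨a, ha, rfl⟩ := hb
  rw [AlgHom.toLinearMap_apply, hatTorus_toHat, torus_of_mem_homog t ha, map_smul]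

theorem hatAct_of_mem_hatHomog (u : FreeMonoid (Fin 2)) {w : FreeMonoid (Fin 2)} {b : Hat q}
    (hb : b ∈ hatHomog q w) : hatAct q u b = (chi q u w : k) • b := by
  obtain ⟨a, ha, rfl⟩ := hb
  rw [AlgHom.toLinearMap_apply, hatAct_toHat, act_of_mem_homog q u ha, map_smul]

theorem hatActR_of_mem_hatHomog (u : FreeMonoid (Fin 2)) {w : FreeMonoid (Fin 2)} {b : Hat q}
    (hb : b ∈ hatHomog q w) : hatActR q u b = (chi q w u : k) • b := by
  obtain ⟨a, ha, rfl⟩ := hb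
  rw [AlgHom.toLinearMap_apply, ← map_smul, ← actR_of_mem_homog q u ha]
  rfl

/-- A subspace of `B̂` which contains `1` and is stable under left multiplication by the generators
is everything. -/
theorem hat_induction {M : Submodule k (Hat q)} (h1 : (1 : Hat q) ∈ M)
    (hM : ∀ i, ∀ b ∈ M, x q i * b ∈ M) (b : Hat q) : b ∈ M := by
  obtain ⟨a, rfl⟩ := toHat_surjective b
  have ha := (word k (Fin 2)).mem_span a
  induction ha using Submodule.span_induction with
  | zero => rw [map_zero]; exact zero_mem _
  | add a b _ _ ha hb => rw [map_add]; exact add_mem ha hb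
  | smul c a _ ha => rw [map_smul]; exact M.smul_mem c ha
  | mem a ha =>
    obtain ⟨w, rfl⟩ := ha
    induction w using FreeMonoid.inductionOn' with
    | one => rw [word_one, map_one]; exact h1
    | of_mul i w ih => rw [word_mul, word_of, map_mul]; exact hM i _ ih

theorem IsCubicA2.z_mul (h : IsCubicA2 q) (j : Fin 5) (b : Hat q) :
    z q j * b = hatAct q (zWord j) b * z q j := by
  refine hat_induction (M := LinearMap.eqLocus (LinearMap.mulLeft k (z q j))
    (LinearMap.mulRight k (z q j) ∘ₗ (hatAct q (zWord j)).toLinearMap)) ?_ ?_ b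
  · simp [LinearMap.mem_eqLocus]
  · intro i b hb
    simp only [LinearMap.mem_eqLocus, LinearMap.mulLeft_apply, LinearMap.comp_apply,
      LinearMap.mulRight_apply, AlgHom.toLinearMap_apply] at hb ⊢
    have hm := congrArg Units.val (h.monodromy (FreeMonoid.of i) j)
    rw [Units.val_mul, Units.val_one, mul_comm] at hm
    have hzx : z q j * x q i = (chi q (zWord j) (FreeMonoid.of i) : k) • (x q i * z q j) := by
      rw [h.x_mul_z, smul_smul, hm, one_smul]
    rw [← mul_assoc, hzx, smul_mul_assoc, mul_assoc, hb, map_mul,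
      hatAct_of_mem_hatHomog _ (x_mem_hatHomog i), smul_mul_assoc, smul_mul_assoc, mul_assoc]

theorem IsCubicA2.mul_z (h : IsCubicA2 q) (j : Fin 5) (b : Hat q) :
    b * z q j = z q j * hatActR q (zWord j) b := by
  refine hat_induction (M := LinearMap.eqLocus (LinearMap.mulRight k (z q j))
    (LinearMap.mulLeft k (z q j) ∘ₗ (hatActR q (zWord j)).toLinearMap)) ?_ ?_ b
  · simp [LinearMap.mem_eqLocus]
  · intro i b hb
    simp only [LinearMap.mem_eqLocus, LinearMap.mulLeft_apply, LinearMap.comp_apply,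
      LinearMap.mulRight_apply, AlgHom.toLinearMap_apply] at hb ⊢
    rw [mul_assoc, hb, ← mul_assoc, h.x_mul_z, map_mul,
      hatActR_of_mem_hatHomog _ (x_mem_hatHomog i), smul_mul_assoc, smul_mul_assoc, mul_smul_comm,
      mul_assoc]

end RankTwo

/-! ### The braided Hopf algebra `B̂` -/

namespace RankTwo

open DiagTensor BraidedHopf

variable {k : Type*} [Field k] {q : Fin 2 → Fin 2 → kˣ}

theorem hatAct_one (b : Hat q) : hatAct q 1 b = b := by
  obtain ⟨a, rfl⟩ := toHat_surjective b
  rw [hatAct_toHat]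
  have : act q (1 : FreeMonoid (Fin 2)) = AlgHom.id k _ := by ext; simp [act]
  rw [this]; rfl

variable {HB : BraidedHopf k (Hat q)} (hB : (hopf q).IsHom HB (toHat q))

include hB

theorem c_of_mem_left {w : FreeMonoid (Fin 2)} {a : Hat q} (ha : a ∈ hatHomog q w) (b : Hat q) :
    HB.c (a ⊗ₜ b) = hatAct q w b ⊗ₜ a := by
  obtain ⟨a, ha, rfl⟩ := ha
  obtain ⟨b, rfl⟩ := toHat_surjective b
  have := hB.map_c (a ⊗ₜ b)
  rw [show (hopf q).c (a ⊗ₜ b) = _ from braid_of_mem_homog_left q ha b] at this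
  exact this.symm

theorem c_of_mem_right {w : FreeMonoid (Fin 2)} {a : Hat q} (ha : a ∈ hatHomog q w) (b : Hat q) :
    HB.c (b ⊗ₜ a) = a ⊗ₜ hatActR q w b := by
  obtain ⟨a, ha, rfl⟩ := ha
  obtain ⟨b, rfl⟩ := toHat_surjective b
  have := hB.map_c (b ⊗ₜ a)
  rw [show (hopf q).c (b ⊗ₜ a) = _ from braid_of_mem_homog_right q ha b] at this
  exact this.symm

theorem antipode_mul_of_mem {w : FreeMonoid (Fin 2)} {a : Hat q} (ha : a ∈ hatHomog q w)
    (b : Hat q) : HB.antipode (a * b) = hatAct q w (HB.antipode b) * HB.antipode a := by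
  obtain ⟨a, ha, rfl⟩ := ha
  obtain ⟨b, rfl⟩ := toHat_surjective b
  rw [AlgHom.toLinearMap_apply, ← map_mul, ← hB.map_antipode, ← hB.map_antipode, ← hB.map_antipode,
    hatAct_toHat, ← map_mul]
  exact congrArg (toHat q) (antipode_mul_of_mem_homog q ha b)

theorem hatTorus_antipode (t : Fin 2 → kˣ) (b : Hat q) :
    hatTorus q t (HB.antipode b) = HB.antipode (hatTorus q t b) := by
  obtain ⟨b, rfl⟩ := toHat_surjective b
  rw [hatTorus_toHat, ← hB.map_antipode, ← hB.map_antipode, hatTorus_toHat]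
  exact congrArg (toHat q) (torus_antipode q t b)

theorem counit_toHat (a : FreeAlgebra k (Fin 2)) : HB.counit (toHat q a) = counit k (Fin 2) a :=
  hB.map_counit a

omit hB in
/-- Left multiplication by `a ⊗ b` in the braided tensor square of `B̂`, for `b` of multidegree
`w`. -/
def sqMul (q : Fin 2 → Fin 2 → kˣ) (a : Hat q) (w : FreeMonoid (Fin 2)) (b : Hat q) :
    Module.End k (Hat q ⊗[k] Hat q) :=
  TensorProduct.map (LinearMap.mulLeft k a ∘ₗ (hatAct q w).toLinearMap) (LinearMap.mulLeft k b)

omit hB in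
theorem sqMul_tmul (a : Hat q) (w : FreeMonoid (Fin 2)) (b c d : Hat q) :
    sqMul q a w b (c ⊗ₜ d) = (a * hatAct q w c) ⊗ₜ (b * d) := rfl

theorem braidedSquareMul_of_mem {w : FreeMonoid (Fin 2)} {b : Hat q} (hb : b ∈ hatHomog q w)
    (a : Hat q) (t : Hat q ⊗[k] Hat q) :
    braidedSquareMul HB.c.toLinearMap ((a ⊗ₜ b) ⊗ₜ t) = sqMul q a w b t := by
  induction t with
  | zero => simp
  | add s t hs ht => rw [TensorProduct.tmul_add, map_add, hs, ht, map_add]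
  | tmul c d =>
    simp [braidedSquareMul, braid12, c_of_mem_left hB hb, sqMul]

theorem comul_toHat (a : FreeAlgebra k (Fin 2)) :
    HB.comul (toHat q a) = tmap2 (toHat q) (comul q a) :=
  (hB.map_comul a).symm

theorem comul_x (i : Fin 2) : HB.comul (x q i) = x q i ⊗ₜ 1 + 1 ⊗ₜ x q i := by
  rw [x, comul_toHat hB, comul_ι, map_add, TensorProduct.map_tmul, TensorProduct.map_tmul]
  simp

theorem comul_x12 : HB.comul (x12 q) = x12 q ⊗ₜ 1 +
    (1 - q 0 1 * q 1 0 : k) • (x q 0 ⊗ₜ[k] x q 1) + 1 ⊗ₜ x12 q := by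
  have : adWord q [0] 1 = X k 0 * X k 1 - (q 0 1 : k) • (X k 1 * X k 0) := by
    simp [adWord_cons, adWord_nil, act_eq_torus, chi_of_of]
  have : comul q (adWord q [0] 1) = adWord q [0] 1 ⊗ₜ 1 +
      (1 - q 0 1 * q 1 0 : k) • (X k 0 ⊗ₜ[k] X k 1) + 1 ⊗ₜ adWord q [0] 1 := by
    rw [this, map_sub, map_smul, comul_mul_X, comul_mul_X, TensorProduct.tmul_sub,
      TensorProduct.sub_tmul, TensorProduct.tmul_smul, ← TensorProduct.smul_tmul']
    module
  rw [x12, comul_toHat hB, this]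
  simp [x]

theorem comul_z (h : IsCubicA2 q) {j : Fin 5} (hj : j ≠ 4) :
    HB.comul (z q j) = z q j ⊗ₜ 1 + 1 ⊗ₜ z q j := by
  rw [← toHat_zLift, comul_toHat hB, h.comul_zLift hj, map_add, TensorProduct.map_tmul,
    TensorProduct.map_tmul]
  simp

theorem comul_primitive_mul {w : FreeMonoid (Fin 2)} {a : Hat q} (ha : a ∈ hatHomog q w)
    (hΔ : HB.comul a = a ⊗ₜ 1 + 1 ⊗ₜ a) (b : Hat q) :
    HB.comul (a * b) = sqMul q a 1 1 (HB.comul b) + sqMul q 1 w a (HB.comul b) := by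
  rw [HB.comul_mul, hΔ, TensorProduct.add_tmul, map_add,
    braidedSquareMul_of_mem hB one_mem_hatHomog, braidedSquareMul_of_mem hB ha]

theorem comul_x12_mul (b : Hat q) : HB.comul (x12 q * b) =
    sqMul q (x12 q) 1 1 (HB.comul b) + (1 - q 0 1 * q 1 0 : k) •
      sqMul q (x q 0) (FreeMonoid.of 1) (x q 1) (HB.comul b) +
    sqMul q 1 (FreeMonoid.ofList [0, 1]) (x12 q) (HB.comul b) := by
  rw [HB.comul_mul, comul_x12 hB, TensorProduct.add_tmul, TensorProduct.add_tmul, map_add,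
    map_add, ← TensorProduct.smul_tmul', map_smul, braidedSquareMul_of_mem hB one_mem_hatHomog,
    braidedSquareMul_of_mem hB (x_mem_hatHomog 1), braidedSquareMul_of_mem hB x12_mem_hatHomog]

theorem comul_z_four [CharZero k] (h : IsCubicA2 q) : ∃ a c : k, a ≠ 0 ∧
    HB.comul (z q 4) = z q 4 ⊗ₜ 1 + a • (z q 3 ⊗ₜ[k] z q 0) + c • (z q 2 ⊗ₜ[k] z q 1) + 1 ⊗ₜ z q 4
      := by
  have e1 : hatAct q (FreeMonoid.of 1) (x q 0) = (q 1 0 : k) • x q 0 := by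
    rw [hatAct_of_mem_hatHomog _ (x_mem_hatHomog 0), chi_of_of]
  have e2 : hatAct q (FreeMonoid.of 1) (x12 q) = (q 1 0 * q 0 0 : k) • x12 q := by
    rw [hatAct_of_mem_hatHomog _ x12_mem_hatHomog]
    simp [chi, FreeMonoid.lift_apply, h.diag]
  have e3 : hatAct q (FreeMonoid.ofList [0, 1]) (x q 0) = (q 0 0 * q 1 0 : k) • x q 0 := by
    rw [hatAct_of_mem_hatHomog _ (x_mem_hatHomog 0)]
    simp [chi, FreeMonoid.lift_apply]
  have e4 : hatAct q (FreeMonoid.ofList [0, 1]) (x12 q) = (q 0 0 : k) • x12 q := by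
    rw [hatAct_of_mem_hatHomog _ x12_mem_hatHomog]
    have := h.mono
    simp [chi, FreeMonoid.lift_apply, h.diag]
    congr 1
    grind
  refine ⟨(1 - q 0 1 * q 1 0) ^ 3 * (q 1 0) ^ 3, (1 - q 0 1 * q 1 0) * q 0 0 ^ 2, ?_, ?_⟩
  · refine mul_ne_zero (pow_ne_zero 3 ?_) (pow_ne_zero 3 (Units.ne_zero _))
    intro h0
    have h1 := h.root
    have h2 := h.mono
    have : (3 : k) = 0 := by grind
    norm_num at this
  · rw [z_four, z_three, z_zero]
    rw [show x12 q ^ 3 = x12 q * (x12 q * x12 q) by noncomm_ring, comul_x12_mul hB,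
      comul_x12_mul hB, comul_x12 hB]
    have key := h.pbw.cube_comul _ _ e1 e2 e3 e4 (sqMul q (x12 q) 1 1 + (1 - q 0 1 * q 1 0 : k) •
      sqMul q (x q 0) (FreeMonoid.of 1) (x q 1) + sqMul q 1 (FreeMonoid.ofList [0, 1]) (x12 q))
      (fun a b => by simp [sqMul_tmul, hatAct_one])
    rw [show x12 q ^ 3 = x12 q * (x12 q * x12 q) by noncomm_ring] at key
    exact key

end RankTwo

/-! ### The subalgebra `Z` -/

namespace RankTwo

open DiagTensor BraidedHopf

variable {k : Type*} [Field k] {q : Fin 2 → Fin 2 → kˣ}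

theorem z_mem_Z (j : Fin 5) : z q j ∈ Z q := Algebra.subset_adjoin ⟨j, rfl⟩

/-- `Z` is the smallest subspace which contains `1` and is stable under left multiplication by the
`z j`. -/
theorem Z_induction {M : Submodule k (Hat q)} (h1 : (1 : Hat q) ∈ M)
    (hM : ∀ j, ∀ b ∈ Z q, b ∈ M → z q j * b ∈ M) {b : Hat q} (hb : b ∈ Z q) : b ∈ M := by
  rw [Z, ← Subalgebra.mem_toSubmodule, Algebra.adjoin_eq_span] at hb
  refine Submodule.span_le.mpr (fun y hy => ?_) hb
  suffices y ∈ Z q ∧ y ∈ M from this.2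
  induction hy using Submonoid.closure_induction_left with
  | one => exact ⟨one_mem _, h1⟩
  | mul_left a ha b hb ih =>
    obtain ⟨j, rfl⟩ := ha
    exact ⟨mul_mem (z_mem_Z j) ih.1, hM j _ ih.1 ih.2⟩

theorem hatAct_mul (u v : FreeMonoid (Fin 2)) (b : Hat q) :
    hatAct q (u * v) b = hatAct q u (hatAct q v b) := by
  have : hatAct q (u * v) = (hatAct q u).comp (hatAct q v) := by
    refine Ideal.Quotient.algHom_ext k (FreeAlgebra.hom_ext (funext fun i => ?_))
    have e (w : FreeMonoid (Fin 2)) : hatAct q w (x q i) =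
        (chi q w (FreeMonoid.of i) : k) • x q i :=
      hatAct_of_mem_hatHomog w (x_mem_hatHomog i)
    change hatAct q (u * v) (x q i) = hatAct q u (hatAct q v (x q i))
    rw [e, e, map_smul, e, smul_smul, map_mul, MonoidHom.mul_apply, Units.val_mul, mul_comm]
  rw [this]; rfl

theorem hatActR_mul (u v : FreeMonoid (Fin 2)) (b : Hat q) :
    hatActR q (u * v) b = hatActR q v (hatActR q u b) := by
  have : hatActR q (u * v) = (hatActR q v).comp (hatActR q u) := by
    refine Ideal.Quotient.algHom_ext k (FreeAlgebra.hom_ext (funext fun i => ?_))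
    have e (w : FreeMonoid (Fin 2)) : hatActR q w (x q i) =
        (chi q (FreeMonoid.of i) w : k) • x q i :=
      hatActR_of_mem_hatHomog w (x_mem_hatHomog i)
    change hatActR q (u * v) (x q i) = hatActR q v (hatActR q u (x q i))
    rw [e, e, map_smul, e, smul_smul, map_mul, Units.val_mul]
  rw [this]; rfl

/-- The element `b` of `Z` is homogeneous of multidegree `w`, and its commutation with every
element of `B̂` is given by the braiding. -/
structure IsQCentral (w : FreeMonoid (Fin 2)) (b : Hat q) : Prop where
  mem_Z : b ∈ Z q
  mem_homog : b ∈ hatHomog q w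
  mul_eq : ∀ a, b * a = hatAct q w a * b
  mul_eq' : ∀ a, a * b = b * hatActR q w a

theorem IsQCentral.one : IsQCentral 1 (1 : Hat q) where
  mem_Z := one_mem _
  mem_homog := one_mem_hatHomog
  mul_eq a := by rw [hatAct_one, one_mul, mul_one]
  mul_eq' a := by
    have : hatActR q 1 = AlgHom.id k _ := by
      refine Ideal.Quotient.algHom_ext k (FreeAlgebra.hom_ext (funext fun i => ?_))
      change hatActR q 1 (x q i) = x q i
      rw [hatActR_of_mem_hatHomog 1 (x_mem_hatHomog i)]
      simp
    rw [this, one_mul, mul_one]; rfl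

theorem IsCubicA2.isQCentral_z (h : IsCubicA2 q) (j : Fin 5) : IsQCentral (zWord j) (z q j) :=
  ⟨z_mem_Z j, z_mem_hatHomog j, h.z_mul j, h.mul_z j⟩

theorem IsQCentral.mul {u v : FreeMonoid (Fin 2)} {a b : Hat q} (ha : IsQCentral u a)
    (hb : IsQCentral v b) : IsQCentral (u * v) (a * b) where
  mem_Z := mul_mem ha.mem_Z hb.mem_Z
  mem_homog := mul_mem_hatHomog ha.mem_homog hb.mem_homog
  mul_eq c := by
    rw [mul_assoc, hb.mul_eq, ← mul_assoc, ha.mul_eq, hatAct_mul, mul_assoc]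
  mul_eq' c := by
    rw [← mul_assoc, ha.mul_eq', mul_assoc, hb.mul_eq', hatActR_mul, mul_assoc]

/-- `Z` is spanned by homogeneous elements which commute with everything up to the braiding. -/
theorem IsCubicA2.Z_le (h : IsCubicA2 q) {M : Submodule k (Hat q)}
    (hM : ∀ w b, IsQCentral w b → b ∈ M) {b : Hat q} (hb : b ∈ Z q) : b ∈ M := by
  have : b ∈ Submodule.span k {b : Hat q | ∃ w, IsQCentral w b} := by
    refine Z_induction (Submodule.subset_span (s := {b : Hat q | ∃ w, IsQCentral w b})
      ⟨1, IsQCentral.one⟩) (fun j b _ hb => ?_) hb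
    clear * - h hb
    induction hb using Submodule.span_induction with
    | zero => rw [mul_zero]; exact zero_mem _
    | add a b _ _ ha hb => rw [mul_add]; exact add_mem ha hb
    | smul c a _ ha => rw [mul_smul_comm]; exact Submodule.smul_mem _ c ha
    | mem a ha =>
      obtain ⟨w, hw⟩ := ha
      exact Submodule.subset_span (s := {b : Hat q | ∃ w, IsQCentral w b})
        ⟨_, (h.isQCentral_z j).mul hw⟩
  refine Submodule.span_le.mpr ?_ this
  rintro b ⟨w, hw⟩
  exact hM w b hw

theorem IsCubicA2.hatTorus_mem_Z (h : IsCubicA2 q) (t : Fin 2 → kˣ) {b : Hat q} (hb : b ∈ Z q) :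
    hatTorus q t b ∈ Z q := by
  refine h.Z_le (M := (Subalgebra.toSubmodule (Z q)).comap (hatTorus q t).toLinearMap)
    (fun w b hw => ?_) hb
  change hatTorus q t b ∈ Z q
  rw [hatTorus_of_mem_hatHomog t hw.mem_homog]
  exact Subalgebra.smul_mem _ hw.mem_Z _

theorem IsCubicA2.z_comm (h : IsCubicA2 q) (i j : Fin 5) :
    z q i * z q j = (chi q (zWord i) (zWord j) : k) • (z q j * z q i) := by
  rw [h.z_mul, hatAct_of_mem_hatHomog _ (z_mem_hatHomog j), smul_mul_assoc]

/-- Multiplying an ordered product of powers of `q`-commuting elements by one of them on the left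
raises one exponent, up to a scalar. -/
theorem exists_mul_ordered_prod {k A ι : Type*} [Field k] [Ring A] [Algebra k A] (f : ι → A)
    (hf : ∀ i j, ∃ c : k, f i * f j = c • (f j * f i)) (n : ι → ℕ) (j : ι) (l : List ι)
    (hl : l.Nodup) (hj : j ∈ l) : ∃ c : k, ∃ m : ι → ℕ,
      f j * (l.map fun i => f i ^ n i).prod = c • (l.map fun i => f i ^ m i).prod := by
  classical
  have hpow (i : ι) (m : ℕ) : ∃ c : k, f j * f i ^ m = c • (f i ^ m * f j) := by
    obtain ⟨c, hc⟩ := hf j i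
    induction m with
    | zero => exact ⟨1, by simp⟩
    | succ m ih =>
      obtain ⟨d, hd⟩ := ih
      refine ⟨d * c, ?_⟩
      rw [pow_succ, ← mul_assoc, hd, smul_mul_assoc, mul_assoc, hc, mul_smul_comm, smul_smul,
        mul_assoc]
  suffices ∃ c : k, f j * (l.map fun i => f i ^ n i).prod =
      c • (l.map fun i => f i ^ (Function.update n j (n j + 1)) i).prod by
    obtain ⟨c, hc⟩ := this
    exact ⟨c, _, hc⟩
  induction l with
  | nil => simp at hj
  | cons i l ih =>
    rw [List.nodup_cons] at hl
    simp only [List.map_cons, List.prod_cons]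
    by_cases hij : j = i
    · subst hij
      refine ⟨1, ?_⟩
      have : l.map (fun i => f i ^ Function.update n j (n j + 1) i) = l.map fun i => f i ^ n i :=
        List.map_congr_left fun a ha => by
          rw [Function.update_of_ne (fun e => hl.1 (by rwa [← e]))]
      rw [this, Function.update_self, one_smul, pow_succ', mul_assoc]
    · obtain ⟨c, hc⟩ := hpow i (n i)
      obtain ⟨d, hd⟩ := ih hl.2 ((List.mem_cons.mp hj).resolve_left hij)
      refine ⟨c * d, ?_⟩
      rw [← mul_assoc, hc, smul_mul_assoc, mul_assoc, hd, mul_smul_comm, smul_smul,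
        Function.update_of_ne (Ne.symm hij)]

theorem zMonomial_eq_prod (n : Fin 5 → ℕ) :
    zMonomial q n = ((List.finRange 5).map fun i => z q i ^ n i).prod := by
  simp [zMonomial, List.finRange_succ, mul_assoc]

theorem zMonomial_mem_Z (n : Fin 5 → ℕ) : zMonomial q n ∈ Z q :=
  mul_mem (mul_mem (mul_mem (mul_mem (pow_mem (z_mem_Z _) _) (pow_mem (z_mem_Z _) _))
    (pow_mem (z_mem_Z _) _)) (pow_mem (z_mem_Z _) _)) (pow_mem (z_mem_Z _) _)

theorem IsCubicA2.span_zMonomial (h : IsCubicA2 q) :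
    Submodule.span k (Set.range (zMonomial q)) = Subalgebra.toSubmodule (Z q) := by
  refine le_antisymm (Submodule.span_le.mpr ?_) fun b hb => ?_
  · rintro _ ⟨n, rfl⟩
    exact zMonomial_mem_Z n
  · refine Z_induction (Submodule.subset_span (s := Set.range (zMonomial q))
      ⟨0, by simp [zMonomial]⟩) (fun j b _ hb => ?_) hb
    clear * - h hb
    induction hb using Submodule.span_induction with
    | zero => rw [mul_zero]; exact zero_mem _
    | add a b _ _ ha hb => rw [mul_add]; exact add_mem ha hb
    | smul c a _ ha => rw [mul_smul_comm]; exact Submodule.smul_mem _ c ha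
    | mem a ha =>
      obtain ⟨n, rfl⟩ := ha
      obtain ⟨c, m, hm⟩ := exists_mul_ordered_prod (z q) (fun i j => ⟨_, h.z_comm i j⟩) n j
        (List.finRange 5) (List.nodup_finRange 5) (List.mem_finRange j)
      rw [zMonomial_eq_prod, hm, ← zMonomial_eq_prod]
      exact Submodule.smul_mem _ c (Submodule.subset_span (s := Set.range (zMonomial q)) ⟨m, rfl⟩)

variable {HB : BraidedHopf k (Hat q)} (hB : (hopf q).IsHom HB (toHat q))

include hB

theorem counit_z (j : Fin 5) : HB.counit (z q j) = 0 := by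
  rw [← toHat_zLift, counit_toHat hB, ← coeff_one_eq_counit]
  refine coeff_eq_zero_of_mem_span (G := {zLift q j}) (n := 1) (w := 1) ?_ Nat.zero_lt_one
    (TwoSidedIdeal.subset_span rfl)
  rintro _ rfl
  refine ⟨_, ?_, zLift_mem_homog j⟩
  revert j
  decide

/-- The braided commutator with an element of `Z` vanishes, so the adjoint action on `Z` is
trivial. -/
theorem ad_of_isQCentral {w : FreeMonoid (Fin 2)} {b : Hat q} (hb : IsQCentral w b) (a : Hat q) :
    HB.ad a b = HB.counit a • b := by
  have hR (t : Hat q ⊗[k] Hat q) :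
      (LinearMap.mul' k (Hat q) ∘ₗ TensorProduct.map (LinearMap.mul' k (Hat q)) HB.antipode ∘ₗ
        (TensorProduct.assoc k _ _ _).symm.toLinearMap ∘ₗ braid23 HB.c.toLinearMap ∘ₗ
        (TensorProduct.assoc k _ _ _).toLinearMap) (t ⊗ₜ b) =
      LinearMap.mul' k _ (HB.antipode.lTensor _ t) * b := by
    induction t with
    | zero => simp only [TensorProduct.zero_tmul, map_zero, zero_mul]
    | add s t hs ht => rw [TensorProduct.add_tmul, map_add, hs, ht, map_add, map_add, add_mul]
    | tmul c d =>
      have e : hatActR q w (HB.antipode d) = HB.antipode (hatActR q w d) :=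
        hatTorus_antipode hB _ d
      simp [braid23, c_of_mem_right hB hb.mem_homog, mul_assoc, hb.mul_eq' (HB.antipode d), e]
  have := hR (HB.comul a)
  rw [HB.antipode_right, ← Algebra.smul_def] at this
  exact this

theorem IsCubicA2.isNormal (h : IsCubicA2 q) : HB.IsNormal (Z q) := by
  intro a b hb
  refine h.Z_le (M := (Subalgebra.toSubmodule (Z q)).comap
    ((LinearMap.mul' k _ ∘ₗ TensorProduct.map (LinearMap.mul' k _) HB.antipode ∘ₗ
    (TensorProduct.assoc k _ _ _).symm.toLinearMap ∘ₗ braid23 HB.c.toLinearMap ∘ₗ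
    (TensorProduct.assoc k _ _ _).toLinearMap ∘ₗ HB.comul.rTensor _) ∘ₗ
    TensorProduct.mk k _ _ a)) (fun w b hw => ?_) hb
  change HB.ad a b ∈ Z q
  rw [ad_of_isQCentral hB hw]
  exact Subalgebra.smul_mem _ hw.mem_Z _

theorem IsCubicA2.map_c_left (h : IsCubicA2 q) :
    (tensorSub (Subalgebra.toSubmodule (Z q)) ⊤).map HB.c.toLinearMap =
    tensorSub ⊤ (Subalgebra.toSubmodule (Z q)) := by
  refine le_antisymm (Submodule.map_le_iff_le_comap.mpr (tensorSub_le.mpr fun b hb a _ => ?_))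
    (tensorSub_le.mpr fun a _ b hb => ?_)
  · refine h.Z_le (M := ((tensorSub ⊤ (Subalgebra.toSubmodule (Z q))).comap
      (HB.c.toLinearMap ∘ₗ (TensorProduct.mk k _ _).flip a))) (fun w b hw => ?_) hb
    change HB.c (b ⊗ₜ a) ∈ tensorSub ⊤ (Subalgebra.toSubmodule (Z q))
    rw [c_of_mem_left hB hw.mem_homog]
    exact tmul_mem_tensorSub trivial hw.mem_Z
  · refine h.Z_le (M := (((tensorSub (Subalgebra.toSubmodule (Z q)) ⊤).map
      HB.c.toLinearMap).comap (TensorProduct.mk k _ _ a))) (fun w b hw => ?_) hb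
    refine ⟨b ⊗ₜ hatTorus q (fun j => chi q w (FreeMonoid.of j))⁻¹ a,
      tmul_mem_tensorSub hw.mem_Z trivial, ?_⟩
    refine (c_of_mem_left hB hw.mem_homog _).trans ?_
    rw [hatAct, hatTorus_hatTorus_inv]; rfl

theorem IsCubicA2.map_c_right (h : IsCubicA2 q) :
    (tensorSub ⊤ (Subalgebra.toSubmodule (Z q))).map HB.c.toLinearMap =
    tensorSub (Subalgebra.toSubmodule (Z q)) ⊤ := by
  refine le_antisymm (Submodule.map_le_iff_le_comap.mpr (tensorSub_le.mpr fun a _ b hb => ?_))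
    (tensorSub_le.mpr fun b hb a _ => ?_)
  · refine h.Z_le (M := ((tensorSub (Subalgebra.toSubmodule (Z q)) ⊤).comap
      (HB.c.toLinearMap ∘ₗ (TensorProduct.mk k _ _) a))) (fun w b hw => ?_) hb
    change HB.c (a ⊗ₜ b) ∈ tensorSub (Subalgebra.toSubmodule (Z q)) ⊤
    rw [c_of_mem_right hB hw.mem_homog]
    exact tmul_mem_tensorSub hw.mem_Z trivial
  · refine h.Z_le (M := (((tensorSub ⊤ (Subalgebra.toSubmodule (Z q))).map
      HB.c.toLinearMap).comap ((TensorProduct.mk k _ _).flip a))) (fun w b hw => ?_) hb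
    refine ⟨hatTorus q (fun j => chi q (FreeMonoid.of j) w)⁻¹ a ⊗ₜ b,
      tmul_mem_tensorSub trivial hw.mem_Z, ?_⟩
    refine (c_of_mem_right hB hw.mem_homog _).trans ?_
    rw [hatActR, hatTorus_hatTorus_inv]; rfl

omit hB in
theorem IsCubicA2.sqMul_mem (h : IsCubicA2 q) {a b : Hat q} (ha : a ∈ Z q) (hb : b ∈ Z q)
    (w : FreeMonoid (Fin 2)) {t : Hat q ⊗[k] Hat q}
    (ht : t ∈ tensorSub (Subalgebra.toSubmodule (Z q)) (Subalgebra.toSubmodule (Z q))) :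
    sqMul q a w b t ∈ tensorSub (Subalgebra.toSubmodule (Z q)) (Subalgebra.toSubmodule (Z q)) := by
  refine (tensorSub_le (M := Submodule.comap (sqMul q a w b) (tensorSub
    (Subalgebra.toSubmodule (Z q)) (Subalgebra.toSubmodule (Z q))))).mpr (fun c hc d hd => ?_) ht
  rw [Submodule.mem_comap, sqMul_tmul]
  exact tmul_mem_tensorSub ((Z q).mul_mem ha (h.hatTorus_mem_Z _ hc)) ((Z q).mul_mem hb hd)

theorem comul_z_four_mul {a c : k} (hz : HB.comul (z q 4) = z q 4 ⊗ₜ 1 +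
    a • (z q 3 ⊗ₜ[k] z q 0) + c • (z q 2 ⊗ₜ[k] z q 1) + 1 ⊗ₜ z q 4) (b : Hat q) :
    HB.comul (z q 4 * b) = sqMul q (z q 4) 1 1 (HB.comul b) +
      a • sqMul q (z q 3) (zWord 0) (z q 0) (HB.comul b) +
      c • sqMul q (z q 2) (zWord 1) (z q 1) (HB.comul b) +
      sqMul q 1 (zWord 4) (z q 4) (HB.comul b) := by
  simp only [HB.comul_mul, hz, TensorProduct.add_tmul, map_add, ← TensorProduct.smul_tmul',
    map_smul, braidedSquareMul_of_mem hB one_mem_hatHomog,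
    braidedSquareMul_of_mem hB (z_mem_hatHomog _)]

theorem IsCubicA2.comul_mem_Z [CharZero k] (h : IsCubicA2 q) {b : Hat q} (hb : b ∈ Z q) :
    HB.comul b ∈ tensorSub (Subalgebra.toSubmodule (Z q)) (Subalgebra.toSubmodule (Z q)) := by
  refine Z_induction (M := Submodule.comap HB.comul (tensorSub (Subalgebra.toSubmodule (Z q))
    (Subalgebra.toSubmodule (Z q)))) ?_ (fun j b _ hb => ?_) hb
  · rw [Submodule.mem_comap, HB.comul_one]
    exact tmul_mem_tensorSub (Z q).one_mem (Z q).one_mem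
  · rw [Submodule.mem_comap] at hb ⊢
    by_cases hj : j = 4
    · subst hj
      obtain ⟨a, c, -, hz⟩ := comul_z_four hB h
      rw [comul_z_four_mul hB hz]
      exact add_mem (add_mem (add_mem
        (h.sqMul_mem (z_mem_Z 4) (Z q).one_mem _ hb)
        (Submodule.smul_mem _ _ (h.sqMul_mem (z_mem_Z 3) (z_mem_Z 0) _ hb)))
        (Submodule.smul_mem _ _ (h.sqMul_mem (z_mem_Z 2) (z_mem_Z 1) _ hb)))
        (h.sqMul_mem (Z q).one_mem (z_mem_Z 4) _ hb)
    · rw [comul_primitive_mul hB (z_mem_hatHomog j) (comul_z hB h hj)]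
      exact add_mem (h.sqMul_mem (z_mem_Z j) (Z q).one_mem _ hb)
        (h.sqMul_mem (Z q).one_mem (z_mem_Z j) _ hb)

omit hB in
theorem _root_.BraidedHopf.antipode_one (H : BraidedHopf k (Hat q)) : H.antipode 1 = 1 := by
  have := H.antipode_right 1
  rwa [H.comul_one, LinearMap.lTensor_tmul, LinearMap.mul'_apply, one_mul, H.counit_one,
    (algebraMap k (Hat q)).map_one] at this

theorem antipode_z (h : IsCubicA2 q) {j : Fin 5} (hj : j ≠ 4) :
    HB.antipode (z q j) = -z q j := by
  have := HB.antipode_right (z q j)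
  rw [comul_z hB h hj, counit_z hB] at this
  simp only [map_add, LinearMap.lTensor_tmul, LinearMap.mul'_apply, HB.antipode_one, mul_one,
    one_mul, map_zero] at this
  rw [add_comm] at this
  exact eq_neg_of_add_eq_zero_left this

theorem antipode_z_four (h : IsCubicA2 q) {a c : k} (hz : HB.comul (z q 4) = z q 4 ⊗ₜ 1 +
    a • (z q 3 ⊗ₜ[k] z q 0) + c • (z q 2 ⊗ₜ[k] z q 1) + 1 ⊗ₜ z q 4) :
    HB.antipode (z q 4) = -z q 4 + (a • (z q 3 * z q 0) + c • (z q 2 * z q 1)) := by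
  have := HB.antipode_right (z q 4)
  rw [hz, counit_z hB] at this
  simp only [map_add, map_smul, LinearMap.lTensor_tmul, LinearMap.mul'_apply, HB.antipode_one,
    mul_one, one_mul, map_zero, antipode_z hB h (show (0 : Fin 5) ≠ 4 by decide),
    antipode_z hB h (show (1 : Fin 5) ≠ 4 by decide)] at this
  simp only [mul_neg, smul_neg] at this
  rw [← sub_eq_zero, ← this]
  abel

theorem IsCubicA2.map_antipode_Z [CharZero k] (h : IsCubicA2 q) :
    (Subalgebra.toSubmodule (Z q)).map HB.antipode = Subalgebra.toSubmodule (Z q) := by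
  obtain ⟨a, c, -, hz⟩ := comul_z_four hB h
  have hSz (j : Fin 5) : HB.antipode (z q j) ∈ Z q := by
    by_cases hj : j = 4
    · rw [hj, antipode_z_four hB h hz]
      exact add_mem (neg_mem (z_mem_Z _)) (add_mem
        (Subalgebra.smul_mem _ (mul_mem (z_mem_Z _) (z_mem_Z _)) _)
        (Subalgebra.smul_mem _ (mul_mem (z_mem_Z _) (z_mem_Z _)) _))
    · rw [antipode_z hB h hj]
      exact neg_mem (z_mem_Z j)
  set N := (Subalgebra.toSubmodule (Z q)).map HB.antipode with hN
  have hl (j : Fin 5) (hj : j ≠ 4) (b : Hat q) (hb : b ∈ N) : z q j * b ∈ N := by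
    obtain ⟨y, hy, rfl⟩ := hb
    refine ⟨-(z q j * y), neg_mem ((Z q).mul_mem (z_mem_Z j) hy), ?_⟩
    rw [map_neg, antipode_mul_of_mem hB (z_mem_hatHomog j), antipode_z hB h hj, h.z_mul, mul_neg,
      neg_neg]
  have ht (t : Fin 2 → kˣ) (b : Hat q) (hb : b ∈ N) : hatTorus q t b ∈ N := by
    obtain ⟨y, hy, rfl⟩ := hb
    exact ⟨hatTorus q t y, h.hatTorus_mem_Z t hy, (hatTorus_antipode hB t y).symm⟩
  have hr (j : Fin 5) (hj : j ≠ 4) (b : Hat q) (hb : b ∈ N) : b * z q j ∈ N := by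
    rw [h.mul_z]
    exact hl j hj _ (ht _ _ hb)
  refine le_antisymm (Submodule.map_le_iff_le_comap.mpr fun b hb => ?_) fun b hb => ?_
  · refine Z_induction (M := (Subalgebra.toSubmodule (Z q)).comap HB.antipode) ?_
      (fun j b _ hb => ?_) hb
    · rw [Submodule.mem_comap, HB.antipode_one]
      exact one_mem (Z q)
    · rw [Submodule.mem_comap, antipode_mul_of_mem hB (z_mem_hatHomog j)]
      exact (Z q).mul_mem (h.hatTorus_mem_Z _ hb) (hSz j)
  · refine Z_induction (M := N) ⟨1, one_mem (Z q), HB.antipode_one⟩ (fun j b _ hb => ?_) hb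
    by_cases hj : j = 4
    · subst hj
      -- Solve the formula for `S(z₅)` for `z₅`; the quadratic terms are products of primitives.
      have e : z q 4 = -HB.antipode (z q 4) + (a • (z q 3 * z q 0) + c • (z q 2 * z q 1)) := by
        rw [antipode_z_four hB h hz]; abel
      have hb' := ht (fun j => chi q (zWord 4) (FreeMonoid.of j)) b hb
      rw [h.z_mul]
      obtain ⟨y, hy, hyb⟩ := id hb
      have hS : hatAct q (zWord 4) b * HB.antipode (z q 4) ∈ N :=
        ⟨z q 4 * y, (Z q).mul_mem (z_mem_Z 4) hy, by
          rw [antipode_mul_of_mem hB (z_mem_hatHomog 4), hyb]⟩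
      rw [e, mul_add, mul_neg, mul_add, mul_smul_comm, mul_smul_comm, ← mul_assoc, ← mul_assoc]
      exact add_mem (neg_mem hS) (add_mem
        (N.smul_mem _ (hr 0 (by decide) _ (hr 3 (by decide) _ hb')))
        (N.smul_mem _ (hr 1 (by decide) _ (hr 2 (by decide) _ hb'))))
    · exact hl j hj b hb

theorem IsCubicA2.isHopfSubalgebra_Z [CharZero k] (h : IsCubicA2 q) :
    HB.IsHopfSubalgebra (Z q) where
  map_c_left := h.map_c_left hB
  map_c_right := h.map_c_right hB
  comul_mem _ hb := h.comul_mem_Z hB hb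
  map_antipode := h.map_antipode_Z hB

end RankTwo

/-! ### Skew derivations -/

namespace DiagTensor

variable {k : Type*} [Field k] {ι : Type*}

theorem coeff_eq_zero_of_not_perm {u w : FreeMonoid ι} {a : FreeAlgebra k ι} (ha : a ∈ homog k u)
    (hw : ¬ w.toList.Perm u.toList) : coeff k w a = 0 := by
  classical
  refine eqOn_homog (f := coeff k w) (g := 0) (fun v hv => ?_) ha
  rw [coeff_word, if_neg, LinearMap.zero_apply]
  rintro rfl
  exact hw hv

/-- Coefficients at words not longer than the degree of the left factor. -/
theorem coeff_mul_of_mem_homog {u w : FreeMonoid ι} {a : FreeAlgebra k ι} (ha : a ∈ homog k u)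
    (hw : w.length ≤ u.length) (b : FreeAlgebra k ι) :
    coeff k w (a * b) = coeff k w a * counit k ι b := by
  classical
  refine eqOn_homog (f := coeff k w ∘ₗ LinearMap.mulRight k b)
    (g := (counit k ι b) • coeff k w) (fun v hv => ?_) ha |>.trans (mul_comm _ _)
  have : coeff k w ∘ₗ LinearMap.mulLeft k (word k ι v) =
      coeff k w (word k ι v) • (counit k ι).toLinearMap := (word k ι).ext fun v' => by
    rw [LinearMap.comp_apply, LinearMap.mulLeft_apply, ← word_mul, LinearMap.smul_apply,
      AlgHom.toLinearMap_apply, ← coeff_one_eq_counit, coeff_word, coeff_word, coeff_word]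
    by_cases h : v' = 1
    · subst h; simp
    · rw [if_neg h, if_neg, smul_zero]
      rintro rfl
      have h1 : v.length = u.length := List.Perm.length_eq hv
      rw [FreeMonoid.length_mul, h1] at hw
      exact h (FreeMonoid.length_eq_zero.mp (by lia))
  exact (LinearMap.congr_fun this b).trans (mul_comm _ _)

end DiagTensor

namespace RankTwo

open DiagTensor BraidedHopf

variable {k : Type*} [Field k] {q : Fin 2 → Fin 2 → kˣ}

theorem coeff_zLift {i j : Fin 5} (hi : i ≠ 4) :
    coeff k (zWord i) (zLift q j) = if i = j then 1 else 0 := by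
  split_ifs with hij
  · subst hij
    have h1 (i j : Fin 2) : coeff k (FreeMonoid.of i) (FreeAlgebra.ι k j) =
        if j = i then 1 else 0 := by
      classical
      rw [← word_of, coeff_word]
      simp only [FreeMonoid.of_injective.eq_iff]
    have h2 (i j l : Fin 2) : (FreeMonoid.ofList [i, j, l] : FreeMonoid (Fin 2)) =
      FreeMonoid.of i * (FreeMonoid.of j * FreeMonoid.of l) := rfl
    fin_cases i
    · simp [zWord, zLift, h2, pow_succ', coeff_ι_mul, h1]
    · simp [zWord, zLift, h2, coeff_ι_mul, h1, adWord_cons, adWord_nil, act_eq_torus, mul_sub,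
        sub_mul, mul_assoc]
    · simp [zWord, zLift, h2, coeff_ι_mul, h1, adWord_cons, adWord_nil, act_eq_torus, mul_sub,
        sub_mul, mul_assoc]
    · simp [zWord, zLift, h2, pow_succ', coeff_ι_mul, h1]
    · exact absurd rfl hi
  · refine coeff_eq_zero_of_not_perm (zLift_mem_homog j) ?_
    revert i j
    decide

variable (q) in
theorem exists_section : ∃ s : Hat q →ₗ[k] FreeAlgebra k (Fin 2),
    (toHat q).toLinearMap ∘ₗ s = LinearMap.id :=
  LinearMap.exists_rightInverse_of_surjective _ (LinearMap.range_eq_top.mpr toHat_surjective)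

/-- The coefficient of the word `w` as a functional on `B̂`. It does not depend on the choice of
representatives for words of length at most three, as the relations of `B̂` have degree four. -/
def hatCoeff (q : Fin 2 → Fin 2 → kˣ) (w : FreeMonoid (Fin 2)) : Hat q →ₗ[k] k :=
  coeff k w ∘ₗ (exists_section q).choose

theorem hatCoeff_toHat {w : FreeMonoid (Fin 2)} (hw : w.length < 4) (a : FreeAlgebra k (Fin 2)) :
    hatCoeff q w (toHat q a) = coeff k w a := by
  have h0 := LinearMap.congr_fun (exists_section q).choose_spec (toHat q a)
  have h1 : (exists_section q).choose (toHat q a) - a ∈ hatIdeal q := by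
    rw [← toHat_eq_zero_iff, map_sub, sub_eq_zero]
    exact h0
  have := coeff_eq_zero_of_mem_span (n := 4) ?_ hw h1
  · rwa [map_sub, sub_eq_zero] at this
  · rintro g (rfl | rfl | rfl | rfl)
    exacts [⟨_, le_rfl, adWord_mem_homog q [0, 0, 0] 1⟩, ⟨_, le_rfl, adWord_mem_homog q [1, 1,
      1] 0⟩,
      ⟨_, le_rfl, adWord_mem_homog q [1, 0, 0] 1⟩, ⟨_, le_rfl, adWord_mem_homog q [0, 1, 1] 0⟩]

theorem hatCoeff_z {i j : Fin 5} (hi : i ≠ 4) :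
    hatCoeff q (zWord i) (z q j) = if i = j then 1 else 0 := by
  rw [← toHat_zLift, hatCoeff_toHat, coeff_zLift hi]
  revert i
  decide

theorem hatCoeff_of_eq_zero {i : Fin 2} {u : FreeMonoid (Fin 2)} {a : Hat q} (ha : a ∈ hatHomog q u)
    (hu : 2 ≤ u.length) : hatCoeff q (FreeMonoid.of i) a = 0 := by
  obtain ⟨a, ha, rfl⟩ := ha
  rw [AlgHom.toLinearMap_apply, hatCoeff_toHat (by simp)]
  refine coeff_eq_zero_of_not_perm ha fun h => ?_
  have h1 : 1 = u.length := List.Perm.length_eq h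
  lia

theorem hatCoeff_of_x (i j : Fin 2) :
    hatCoeff q (FreeMonoid.of i) (x q j) = if i = j then 1 else 0 := by
  classical
  rw [x, hatCoeff_toHat (by simp), X, ← word_of, coeff_word]
  simp only [FreeMonoid.of_injective.eq_iff, eq_comm]

/-- The map `φ ⊗ id : A ⊗ A → A` for a functional `φ`. -/
def contractLeft {A : Type*} [AddCommGroup A] [Module k A] (φ : A →ₗ[k] k) : A ⊗[k] A →ₗ[k] A :=
  (TensorProduct.lid k A).toLinearMap ∘ₗ φ.rTensor A

theorem contractLeft_tmul {A : Type*} [AddCommGroup A] [Module k A] (φ : A →ₗ[k] k) (a b : A) :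
    contractLeft φ (a ⊗ₜ b) = φ a • b := rfl

/-- The skew derivation `(φ ⊗ id) Δ`, where `φ` is the coefficient of the word `w`. -/
def skewDeriv (HB : BraidedHopf k (Hat q)) (w : FreeMonoid (Fin 2)) : Hat q →ₗ[k] Hat q :=
  contractLeft (hatCoeff q w) ∘ₗ HB.comul

variable {HB : BraidedHopf k (Hat q)} (hB : (hopf q).IsHom HB (toHat q))

include hB

theorem hatCoeff_mul {u v w : FreeMonoid (Fin 2)} {a : Hat q} (ha : a ∈ hatHomog q u)
    (hw : w.length ≤ u.length) (hw' : w.length < 4) (b : Hat q) :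
    hatCoeff q w (a * hatAct q v b) = hatCoeff q w a * HB.counit b := by
  obtain ⟨a, ha, rfl⟩ := ha
  obtain ⟨b, rfl⟩ := toHat_surjective b
  rw [AlgHom.toLinearMap_apply, hatAct_toHat, ← map_mul, hatCoeff_toHat hw', hatCoeff_toHat hw',
    coeff_mul_of_mem_homog ha hw, counit_toHat hB, counit_act]

theorem hatCoeff_sqMul {u v w : FreeMonoid (Fin 2)} {a b : Hat q} (ha : a ∈ hatHomog q u)
    (hw : w.length ≤ u.length) (hw' : w.length < 4) (y : Hat q) :
    contractLeft (hatCoeff q w) (sqMul q a v b (HB.comul y)) =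
      hatCoeff q w a • (b * y) := by
  have (t : Hat q ⊗[k] Hat q) :
      contractLeft (hatCoeff q w) (sqMul q a v b t) =
      hatCoeff q w a • (b * contractLeft HB.counit t) := by
    induction t with
    | zero => simp only [map_zero, mul_zero, smul_zero]
    | add s t hs ht => simp only [map_add, hs, ht, mul_add, smul_add]
    | tmul c d =>
      simp only [sqMul_tmul, contractLeft_tmul,
        hatCoeff_mul hB ha hw hw', mul_smul_comm, smul_smul]
  have e : contractLeft HB.counit (HB.comul y) = y := HB.counit_comul_left' y
  rw [this, e]

omit hB in
theorem hatCoeff_sqMul_one {v w : FreeMonoid (Fin 2)} {b : Hat q} (hw' : w.length < 4)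
    (y : Hat q) :
    contractLeft (hatCoeff q w) (sqMul q 1 v b (HB.comul y)) =
      (chi q v w : k) • (b * skewDeriv HB w y) := by
  have (t : Hat q ⊗[k] Hat q) :
      contractLeft (hatCoeff q w) (sqMul q 1 v b t) =
      (chi q v w : k) • (b * contractLeft (hatCoeff q w) t) := by
    induction t with
    | zero => simp only [map_zero, mul_zero, smul_zero]
    | add s t hs ht => simp only [map_add, hs, ht, mul_add, smul_add]
    | tmul c d =>
      obtain ⟨c, rfl⟩ := toHat_surjective c
      simp only [sqMul_tmul, contractLeft_tmul, one_mul,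
        hatAct_toHat, hatCoeff_toHat hw', coeff_act, mul_smul_comm, smul_smul]
  exact this _

/-- The skew derivations on a product with a primitive left factor. -/
theorem skewDeriv_primitive_mul {u w : FreeMonoid (Fin 2)} {a : Hat q} (ha : a ∈ hatHomog q u)
    (hΔ : HB.comul a = a ⊗ₜ 1 + 1 ⊗ₜ a) (hw : w.length ≤ u.length) (hw' : w.length < 4)
    (y : Hat q) : skewDeriv HB w (a * y) =
      hatCoeff q w a • y + (chi q u w : k) • (a * skewDeriv HB w y) := by
  rw [skewDeriv, LinearMap.comp_apply, comul_primitive_mul hB ha hΔ, map_add,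
    hatCoeff_sqMul hB ha hw hw', hatCoeff_sqMul_one hw', one_mul]
  rfl

theorem skewDeriv_x_mul (i j : Fin 2) (y : Hat q) : skewDeriv HB (FreeMonoid.of i) (x q j * y) =
    (if i = j then y else 0) + (q j i : k) • (x q j * skewDeriv HB (FreeMonoid.of i) y) := by
  rw [skewDeriv_primitive_mul hB (x_mem_hatHomog j) (comul_x hB j) (by simp) (by simp),
    hatCoeff_of_x, chi_of_of]
  split_ifs <;> simp

omit hB in
theorem skewDeriv_one (i : Fin 2) : skewDeriv HB (FreeMonoid.of i) 1 = 0 := by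
  have : hatCoeff q (FreeMonoid.of i) 1 = 0 := by
    classical
    rw [← map_one (toHat q), hatCoeff_toHat (by simp), ← word_one, coeff_word, if_neg]
    exact fun h => by simpa using congrArg FreeMonoid.length h
  simp [skewDeriv, HB.comul_one, contractLeft_tmul, this]

theorem skewDeriv_x12_mul (i : Fin 2) (y : Hat q) :
    skewDeriv HB (FreeMonoid.of i) (x12 q * y) =
      (if i = 0 then (1 - q 0 1 * q 1 0 : k) • (x q 1 * y) else 0) +
      (q 0 i * q 1 i : k) • (x12 q * skewDeriv HB (FreeMonoid.of i) y) := by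
  have hl : (FreeMonoid.of i).length ≤ (FreeMonoid.ofList [(0 : Fin 2), 1]).length :=
    Nat.le_succ 1
  have hl1 (j : Fin 2) : (FreeMonoid.of i).length ≤ (FreeMonoid.of j).length := le_rfl
  have hl' : (FreeMonoid.of i).length < 4 := by simp
  rw [skewDeriv, LinearMap.comp_apply, comul_x12_mul hB]
  simp only [map_add, map_smul]
  rw [hatCoeff_sqMul hB x12_mem_hatHomog hl hl', hatCoeff_sqMul_one hl',
    hatCoeff_sqMul hB (x_mem_hatHomog 0) (hl1 0) hl', hatCoeff_of_x,
    hatCoeff_of_eq_zero x12_mem_hatHomog le_rfl]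
  have e : (chi q (FreeMonoid.ofList [0, 1]) (FreeMonoid.of i) : k) = q 0 i * q 1 i := by
    simp [chi, FreeMonoid.lift_apply]
  rw [e]
  split_ifs <;> simp [skewDeriv]

theorem skewDeriv_z_mul (h : IsCubicA2 q) {w : FreeMonoid (Fin 2)} (hw : w.length ≤ 3) {j : Fin 5}
    (hj : j ≠ 4) (y : Hat q) : skewDeriv HB w (z q j * y) =
      hatCoeff q w (z q j) • y + (chi q (zWord j) w : k) • (z q j * skewDeriv HB w y) := by
  refine skewDeriv_primitive_mul hB (z_mem_hatHomog j) (comul_z hB h hj) (hw.trans ?_) (by lia) y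
  revert j
  decide

theorem skewDeriv_z_four_mul {a c : k} (hz : HB.comul (z q 4) = z q 4 ⊗ₜ 1 +
    a • (z q 3 ⊗ₜ[k] z q 0) + c • (z q 2 ⊗ₜ[k] z q 1) + 1 ⊗ₜ z q 4)
    {w : FreeMonoid (Fin 2)} (hw : w.length ≤ 3) (y : Hat q) :
    skewDeriv HB w (z q 4 * y) = (a * hatCoeff q w (z q 3)) • (z q 0 * y) +
      (c * hatCoeff q w (z q 2)) • (z q 1 * y) +
      (chi q (zWord 4) w : k) • (z q 4 * skewDeriv HB w y) := by
  have hw' : w.length < 4 := by lia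
  have h0 : hatCoeff q w (z q 4) = 0 := by
    rw [← toHat_zLift, hatCoeff_toHat hw']
    refine coeff_eq_zero_of_not_perm (zLift_mem_homog 4) fun h => ?_
    have h1 : w.length = 6 := List.Perm.length_eq h
    lia
  rw [skewDeriv, LinearMap.comp_apply, comul_z_four_mul hB hz]
  simp only [map_add, map_smul]
  rw [hatCoeff_sqMul hB (z_mem_hatHomog 4) (hw.trans (show 3 ≤ 6 by decide)) hw',
    hatCoeff_sqMul hB (z_mem_hatHomog 3) hw hw', hatCoeff_sqMul hB (z_mem_hatHomog 2) hw hw',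
    hatCoeff_sqMul_one hw', h0, zero_smul, zero_add, smul_smul, smul_smul]
  rfl

theorem skewDeriv_Z [CharZero k] (h : IsCubicA2 q) (i : Fin 2) {b : Hat q} (hb : b ∈ Z q) :
    skewDeriv HB (FreeMonoid.of i) b = 0 := by
  have h0 (j : Fin 5) : hatCoeff q (FreeMonoid.of i) (z q j) = 0 :=
    hatCoeff_of_eq_zero (z_mem_hatHomog j) (by revert j; decide)
  have hl : (FreeMonoid.of i).length ≤ 3 := by simp
  refine Z_induction (M := LinearMap.ker (skewDeriv HB (FreeMonoid.of i))) ?_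
    (fun j b _ hb => ?_) hb
  · exact skewDeriv_one i
  · rw [LinearMap.mem_ker] at hb ⊢
    by_cases hj : j = 4
    · obtain ⟨a, c, -, hz⟩ := comul_z_four hB h
      rw [hj, skewDeriv_z_four_mul hB hz hl, h0, h0, hb]
      simp
    · rw [skewDeriv_z_mul hB h hl hj, h0, hb]
      simp

end RankTwo

/-! ### Spanning `B̂` over `Z`, and elements with derivatives in a given subspace -/

section CubicSpan

variable {k A : Type*} [Field k] [Ring A] [Algebra k A]

/-- The subspace `N + a N + a² N`. -/
def cubicSpan (a : A) (N : Submodule k A) : Submodule k A :=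
  N ⊔ N.map (LinearMap.mulLeft k a) ⊔ N.map (LinearMap.mulLeft k (a ^ 2))

theorem mem_cubicSpan {a : A} {N : Submodule k A} {y : A} :
    y ∈ cubicSpan a N ↔ ∃ e₀ ∈ N, ∃ e₁ ∈ N, ∃ e₂ ∈ N, y = e₀ + a * e₁ + a * (a * e₂) := by
  simp only [cubicSpan, Submodule.mem_sup, Submodule.mem_map, LinearMap.mulLeft_apply]
  constructor
  · rintro ⟨_, ⟨e₀, h₀, _, ⟨e₁, h₁, rfl⟩, rfl⟩, _, ⟨e₂, h₂, rfl⟩, rfl⟩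
    exact ⟨e₀, h₀, e₁, h₁, e₂, h₂, by rw [pow_two, mul_assoc]⟩
  · rintro ⟨e₀, h₀, e₁, h₁, e₂, h₂, rfl⟩
    exact ⟨_, ⟨e₀, h₀, _, ⟨e₁, h₁, rfl⟩, rfl⟩, _, ⟨e₂, h₂, rfl⟩, by rw [pow_two, mul_assoc]⟩

theorem le_cubicSpan (a : A) (N : Submodule k A) : N ≤ cubicSpan a N :=
  le_sup_left.trans le_sup_left

theorem mul_mem_cubicSpan {a : A} {N : Submodule k A} {e : A} (he : e ∈ N) :
    a * e ∈ cubicSpan a N :=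
  mem_cubicSpan.mpr ⟨0, zero_mem _, e, he, 0, zero_mem _, by simp⟩

theorem mul_mul_mem_cubicSpan {a : A} {N : Submodule k A} {e : A} (he : e ∈ N) :
    a * (a * e) ∈ cubicSpan a N :=
  mem_cubicSpan.mpr ⟨0, zero_mem _, 0, zero_mem _, e, he, by simp⟩

theorem cubicSpan_mono (a : A) {N N' : Submodule k A} (h : N ≤ N') :
    cubicSpan a N ≤ cubicSpan a N' :=
  sup_le_sup (sup_le_sup h (Submodule.map_mono h)) (Submodule.map_mono h)

theorem cubicSpan_le {a : A} {N M : Submodule k A} (hN : N ≤ M) (hM : ∀ e ∈ M, a * e ∈ M) :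
    cubicSpan a N ≤ M := by
  intro y hy
  obtain ⟨e₀, h₀, e₁, h₁, e₂, h₂, rfl⟩ := mem_cubicSpan.mp hy
  exact add_mem (add_mem (hN h₀) (hM _ (hN h₁))) (hM _ (hM _ (hN h₂)))

theorem cubicSpan_sup (a : A) (N N' : Submodule k A) :
    cubicSpan a (N ⊔ N') = cubicSpan a N ⊔ cubicSpan a N' := by
  simp only [cubicSpan, Submodule.map_sup]
  ac_rfl

/-- `N + a N + a² N` is stable under left multiplication by `a` if `a³ N ⊆ N`. -/
theorem mul_mem_cubicSpan_of_cube {a : A} {N : Submodule k A} (h3 : ∀ e ∈ N, a ^ 3 * e ∈ N)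
    {y : A} (hy : y ∈ cubicSpan a N) : a * y ∈ cubicSpan a N := by
  obtain ⟨e₀, h₀, e₁, h₁, e₂, h₂, rfl⟩ := mem_cubicSpan.mp hy
  refine mem_cubicSpan.mpr ⟨_, h3 e₂ h₂, e₀, h₀, e₁, h₁, ?_⟩
  noncomm_ring

/-- `N + a N + a² N` is stable under left multiplication by `z` if `N` is so and `z` commutes
with `a` up to a scalar. -/
theorem mul_mem_cubicSpan_of_comm {a z : A} {c : k} (hz : z * a = c • (a * z)) {N : Submodule k A}
    (hN : ∀ e ∈ N, z * e ∈ N) {y : A} (hy : y ∈ cubicSpan a N) : z * y ∈ cubicSpan a N := by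
  obtain ⟨e₀, h₀, e₁, h₁, e₂, h₂, rfl⟩ := mem_cubicSpan.mp hy
  have h (e : A) : z * (a * e) = c • (a * (z * e)) := by
    rw [← mul_assoc, hz, smul_mul_assoc, mul_assoc]
  rw [mul_add, mul_add, h, h, h, mul_smul_comm]
  exact add_mem (add_mem (le_cubicSpan a N (hN _ h₀))
    (Submodule.smul_mem _ _ (mul_mem_cubicSpan (hN _ h₁))))
    (Submodule.smul_mem _ _ (Submodule.smul_mem _ _ (mul_mul_mem_cubicSpan (hN _ h₂))))

/-- An operator `E` which acts on `N + a N + a² N` like a (skew) derivative with respect to `a`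
detects `N` modulo any `E`-stable subspace meeting `N` trivially. -/
theorem mem_of_mem_cubicSpan {a : A} {N K : Submodule k A} {E : A →ₗ[k] A} {c₀ c₁ : k}
    (hc₀ : c₀ ≠ 0) (hc₁ : c₁ ≠ 0) (hE : ∀ e ∈ N, E e = 0) (hE₁ : ∀ e ∈ N, E (a * e) = c₀ • e)
    (hE₂ : ∀ e ∈ N, E (a * (a * e)) = c₁ • (a * e)) (hK : ∀ e ∈ K, E e ∈ K) (hNK : Disjoint N K)
    {y : A} (hy : y ∈ cubicSpan a N) (hEy : E y ∈ K) : y ∈ N := by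
  obtain ⟨e₀, h₀, e₁, h₁, e₂, h₂, rfl⟩ := mem_cubicSpan.mp hy
  rw [map_add, map_add, hE _ h₀, hE₁ _ h₁, hE₂ _ h₂, zero_add] at hEy
  have e₂0 : e₂ = 0 := by
    have := hK _ hEy
    rw [map_add, map_smul, map_smul, hE _ h₁, smul_zero, zero_add, hE₁ _ h₂,
      Submodule.smul_mem_iff _ hc₁, Submodule.smul_mem_iff _ hc₀] at this
    exact Submodule.disjoint_def.mp hNK _ h₂ this
  rw [e₂0, mul_zero, smul_zero, add_zero, Submodule.smul_mem_iff _ hc₀] at hEy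
  rw [e₂0, Submodule.disjoint_def.mp hNK _ h₁ hEy]
  simpa using h₀

theorem disjoint_cubicSpan {a : A} {N K : Submodule k A} {E : A →ₗ[k] A} {c₀ c₁ : k}
    (hc₀ : c₀ ≠ 0) (hc₁ : c₁ ≠ 0) (hE : ∀ e ∈ N, E e = 0) (hE₁ : ∀ e ∈ N, E (a * e) = c₀ • e)
    (hE₂ : ∀ e ∈ N, E (a * (a * e)) = c₁ • (a * e)) (hK : ∀ e ∈ K, E e ∈ K)
    (hNK : Disjoint N K) : Disjoint (cubicSpan a N) K :=
  Submodule.disjoint_def.mpr fun y hy hyK => Submodule.disjoint_def.mp hNK y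
    (mem_of_mem_cubicSpan hc₀ hc₁ hE hE₁ hE₂ hK hNK hy (hK y hyK)) hyK

end CubicSpan

namespace RankTwo

open DiagTensor BraidedHopf

variable {k : Type*} [Field k] {q : Fin 2 → Fin 2 → kˣ}

theorem IsCubicA2.z_mul_x (h : IsCubicA2 q) (i : Fin 2) (j : Fin 5) :
    z q j * x q i = (chi q (zWord j) (FreeMonoid.of i) : k) • (x q i * z q j) := by
  rw [h.z_mul, hatAct_of_mem_hatHomog _ (x_mem_hatHomog i), smul_mul_assoc]

/-- The algebra `B̂` is spanned by the products `x₂ᵃ x₁₂ᵇ x₁ᶜ z` with `a, b, c ≤ 2` and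
`z ∈ Z`. -/
theorem IsCubicA2.mem_cubicSpan_Z (h : IsCubicA2 q) (y : Hat q) : y ∈ cubicSpan (x q 1)
    (cubicSpan (x12 q) (cubicSpan (x q 0) (Subalgebra.toSubmodule (Z q)))) := by
  have H := h.pbw
  set N₀ := Subalgebra.toSubmodule (Z q)
  set N₁ := cubicSpan (x q 0) N₀
  set N₂ := cubicSpan (x12 q) N₁
  set N₃ := cubicSpan (x q 1) N₂
  have hz₀ (j : Fin 5) : ∀ e ∈ N₀, z q j * e ∈ N₀ := fun e he => (Z q).mul_mem (z_mem_Z j) he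
  have hz₁ (j : Fin 5) : ∀ e ∈ N₁, z q j * e ∈ N₁ := fun e he =>
    mul_mem_cubicSpan_of_comm (h.z_mul_x 0 j) (hz₀ j) he
  have hz₂ (j : Fin 5) : ∀ e ∈ N₂, z q j * e ∈ N₂ := fun e he =>
    mul_mem_cubicSpan_of_comm (c := (chi q (zWord j) (FreeMonoid.ofList [0, 1]) : k)) (by
      rw [h.z_mul, hatAct_of_mem_hatHomog _ x12_mem_hatHomog, smul_mul_assoc]) (hz₁ j) he
  have hz₃ (j : Fin 5) : ∀ e ∈ N₃, z q j * e ∈ N₃ := fun e he =>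
    mul_mem_cubicSpan_of_comm (h.z_mul_x 1 j) (hz₂ j) he
  have hx₁ : ∀ e ∈ N₁, x q 0 * e ∈ N₁ := fun e he =>
    mul_mem_cubicSpan_of_cube (by rw [← z_three]; exact hz₀ 3) he
  have hu₂ : ∀ e ∈ N₂, x12 q * e ∈ N₂ := fun e he =>
    mul_mem_cubicSpan_of_cube (by rw [← z_four]; exact hz₁ 4) he
  have hy₃ : ∀ e ∈ N₃, x q 1 * e ∈ N₃ := fun e he =>
    mul_mem_cubicSpan_of_cube (by rw [← z_zero]; exact hz₂ 0) he
  have hx₂ : N₂ ≤ N₂ ⊓ N₂.comap (LinearMap.mulLeft k (x q 0)) := by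
    refine cubicSpan_le (fun e he => ⟨le_cubicSpan _ _ he, le_cubicSpan _ _ (hx₁ e he)⟩) ?_
    rintro e ⟨he, hxe⟩
    rw [SetLike.mem_coe, Submodule.mem_comap, LinearMap.mulLeft_apply] at hxe
    refine ⟨hu₂ e he, ?_⟩
    rw [SetLike.mem_coe, Submodule.mem_comap, LinearMap.mulLeft_apply, ← mul_assoc, H.xu, add_mul,
      smul_mul_assoc, mul_assoc]
    exact add_mem (Submodule.smul_mem _ _ (hu₂ _ hxe)) (hz₂ 2 e he)
  have hxu₃ : N₃ ≤ N₃ ⊓ (N₃.comap (LinearMap.mulLeft k (x q 0)) ⊓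
      N₃.comap (LinearMap.mulLeft k (x12 q))) := by
    refine cubicSpan_le (fun e he => ⟨le_cubicSpan _ _ he, le_cubicSpan _ _ (hx₂ he).2,
      le_cubicSpan _ _ (hu₂ e he)⟩) ?_
    rintro e ⟨he, hxe, hue⟩
    rw [SetLike.mem_coe, Submodule.mem_comap, LinearMap.mulLeft_apply] at hxe hue
    refine ⟨hy₃ e he, ?_, ?_⟩ <;>
      rw [SetLike.mem_coe, Submodule.mem_comap, LinearMap.mulLeft_apply, ← mul_assoc]
    · rw [H.xy, add_mul, smul_mul_assoc, mul_assoc]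
      exact add_mem (Submodule.smul_mem _ _ (hy₃ _ hxe)) hue
    · rw [H.uy, add_mul, smul_mul_assoc, smul_mul_assoc, mul_assoc]
      exact add_mem (Submodule.smul_mem _ _ (hy₃ _ hue)) (Submodule.smul_mem _ _ (hz₃ 1 e he))
  refine hat_induction ?_ (fun i b hb => ?_) y
  · exact le_cubicSpan _ _ (le_cubicSpan _ _ (le_cubicSpan _ _ (one_mem (Z q))))
  · match i with
    | 0 => exact (hxu₃ hb).2.1
    | 1 => exact hy₃ b hb

variable {HB : BraidedHopf k (Hat q)} (hB : (hopf q).IsHom HB (toHat q))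

include hB

/-- Let `W` be a subspace of `Z` and `K` a subspace stable under the skew derivations `∂₁, ∂₂` with
`W ∩ K = 0`. Then the sum of the `x₂ᵃ x₁₂ᵇ x₁ᶜ W` with `a, b, c ≤ 2` meets `K` trivially, and an
element of it whose derivatives lie in `K` belongs to `W`. The exponents of `x₂`, `x₁₂`, `x₁` are
lowered by `∂₂`, `∂₂ ∂₁`, `∂₁`. -/
theorem IsCubicA2.derivation_criterion [CharZero k] (h : IsCubicA2 q) {W K : Submodule k (Hat q)}
    (hW : W ≤ Subalgebra.toSubmodule (Z q))
    (hK : ∀ i, ∀ e ∈ K, skewDeriv HB (FreeMonoid.of i) e ∈ K) (hWK : Disjoint W K) :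
    Disjoint (cubicSpan (x q 1) (cubicSpan (x12 q) (cubicSpan (x q 0) W))) K ∧
    ∀ y ∈ cubicSpan (x q 1) (cubicSpan (x12 q) (cubicSpan (x q 0) W)),
      (∀ i, skewDeriv HB (FreeMonoid.of i) y ∈ K) → y ∈ W := by
  have hr := h.root
  have hd := h.diag
  have hm := h.mono
  have hζ : (1 + q 0 0 : k) ≠ 0 := fun h0 => by
    have : (1 : k) = 0 := by linear_combination hr - (q 0 0 : k) * h0
    exact one_ne_zero this
  have hq : (1 - q 0 1 * q 1 0 : k) ≠ 0 := fun h0 => by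
    have : (3 : k) = 0 := by grind
    norm_num at this
  set D₁ := skewDeriv HB (FreeMonoid.of 0)
  set D₂ := skewDeriv HB (FreeMonoid.of 1)
  have d1x (e : Hat q) : D₁ (x q 0 * e) = e + (q 0 0 : k) • (x q 0 * D₁ e) := by
    simpa using skewDeriv_x_mul hB 0 0 e
  have d1y (e : Hat q) : D₁ (x q 1 * e) = (q 1 0 : k) • (x q 1 * D₁ e) := by
    simpa using skewDeriv_x_mul hB 0 1 e
  have d2x (e : Hat q) : D₂ (x q 0 * e) = (q 0 1 : k) • (x q 0 * D₂ e) := by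
    simpa using skewDeriv_x_mul hB 1 0 e
  have d2y (e : Hat q) : D₂ (x q 1 * e) = e + (q 0 0 : k) • (x q 1 * D₂ e) := by
    simpa [hd] using skewDeriv_x_mul hB 1 1 e
  have d1u (e : Hat q) : D₁ (x12 q * e) = (1 - q 0 1 * q 1 0 : k) • (x q 1 * e) +
      (q 0 0 * q 1 0 : k) • (x12 q * D₁ e) := by
    simpa using skewDeriv_x12_mul hB 0 e
  have d2u (e : Hat q) : D₂ (x12 q * e) = (q 0 1 * q 0 0 : k) • (x12 q * D₂ e) := by
    simpa [hd] using skewDeriv_x12_mul hB 1 e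
  have d1W : ∀ e ∈ W, D₁ e = 0 := fun e he => skewDeriv_Z hB h 0 (hW he)
  have d2W : ∀ e ∈ W, D₂ e = 0 := fun e he => skewDeriv_Z hB h 1 (hW he)
  set N₁ := cubicSpan (x q 0) W
  set N₂ := cubicSpan (x12 q) N₁
  have d2N₁ : ∀ e ∈ N₁, D₂ e = 0 := cubicSpan_le (M := LinearMap.ker D₂) d2W fun e he => by
    rw [LinearMap.mem_ker] at he ⊢; rw [d2x, he, mul_zero, smul_zero]
  have d2N₂ : ∀ e ∈ N₂, D₂ e = 0 := cubicSpan_le (M := LinearMap.ker D₂) d2N₁ fun e he => by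
    rw [LinearMap.mem_ker] at he ⊢; rw [d2u, he, mul_zero, smul_zero]
  have d1N₁ : ∀ e ∈ N₁, D₁ e ∈ N₁ := fun e he => by
    obtain ⟨e₀, h₀, e₁, h₁, e₂, h₂, rfl⟩ := mem_cubicSpan.mp he
    rw [map_add, map_add, d1x, d1x, d1x, d1W _ h₀, d1W _ h₁, d1W _ h₂]
    simp only [mul_zero, smul_zero, add_zero, zero_add]
    exact add_mem (le_cubicSpan _ _ h₁) (add_mem (mul_mem_cubicSpan h₂)
      (Submodule.smul_mem _ _ (mul_mem_cubicSpan h₂)))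
  -- Data for the three applications of `mem_of_mem_cubicSpan`.
  have a1 : ∀ e ∈ W, D₁ (x q 0 * e) = (1 : k) • e := fun e he => by
    rw [d1x, d1W e he]; simp
  have a2 : ∀ e ∈ W, D₁ (x q 0 * (x q 0 * e)) = (1 + q 0 0 : k) • (x q 0 * e) := fun e he => by
    rw [d1x, a1 e he]; simp [add_smul]
  have b0 : ∀ e ∈ N₁, (D₂ ∘ₗ D₁) e = 0 := fun e he => d2N₁ _ (d1N₁ e he)
  have b1 : ∀ e ∈ N₁, (D₂ ∘ₗ D₁) (x12 q * e) = (1 - q 0 1 * q 1 0 : k) • e := fun e he => by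
    rw [LinearMap.comp_apply, d1u, map_add, map_smul, map_smul, d2y, d2u, d2N₁ e he,
      d2N₁ _ (d1N₁ e he)]
    simp
  have b2 : ∀ e ∈ N₁, (D₂ ∘ₗ D₁) (x12 q * (x12 q * e)) =
      ((1 - q 0 1 * q 1 0) * (1 + q 0 0) : k) • (x12 q * e) := fun e he => by
    have := b1 e he
    rw [LinearMap.comp_apply] at this
    rw [LinearMap.comp_apply, d1u, map_add, map_smul, map_smul, d2y, d2u, d2u, d2N₁ e he, this]
    simp only [mul_zero, smul_zero, add_zero, mul_smul_comm, smul_smul, ← add_smul]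
    congr 1
    linear_combination ((1 - q 0 1 * q 1 0) * q 0 0 : k) * hm
  have c1 : ∀ e ∈ N₂, D₂ (x q 1 * e) = (1 : k) • e := fun e he => by
    rw [d2y, d2N₂ e he]; simp
  have c2 : ∀ e ∈ N₂, D₂ (x q 1 * (x q 1 * e)) = (1 + q 0 0 : k) • (x q 1 * e) := fun e he => by
    rw [d2y, c1 e he]; simp [add_smul]
  have hK1 : ∀ e ∈ K, D₁ e ∈ K := hK 0
  have hK2 : ∀ e ∈ K, D₂ e ∈ K := hK 1
  have hK21 : ∀ e ∈ K, (D₂ ∘ₗ D₁) e ∈ K := fun e he => hK2 _ (hK1 e he)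
  have disj₁ : Disjoint N₁ K := disjoint_cubicSpan one_ne_zero hζ d1W a1 a2 hK1 hWK
  have disj₂ : Disjoint N₂ K := disjoint_cubicSpan hq (mul_ne_zero hq hζ) b0 b1 b2 hK21 disj₁
  refine ⟨disjoint_cubicSpan one_ne_zero hζ d2N₂ c1 c2 hK2 disj₂, fun y hy hyK => ?_⟩
  have y2 : y ∈ N₂ := mem_of_mem_cubicSpan one_ne_zero hζ d2N₂ c1 c2 hK2 disj₂ hy (hyK 1)
  have y1 : y ∈ N₁ := mem_of_mem_cubicSpan hq (mul_ne_zero hq hζ) b0 b1 b2 hK21 disj₁ y2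
    (hK2 _ (hyK 0))
  exact mem_of_mem_cubicSpan one_ne_zero hζ d1W a1 a2 hK1 hWK y1 (hyK 0)

end RankTwo

/-! ### Linear independence of the ordered monomials -/

section LoweringOperator

variable {k V ι : Type*} [Field k] [AddCommGroup V] [Module k V]

/-- A family indexed by `ℕ × ι` is linearly independent if its part with first index `0` is so and
some operator lowers the first index by one, up to nonzero scalars. -/
theorem LinearIndependent.of_lowering {w : ℕ × ι → V} (E : V →ₗ[k] V) (s : ℕ → ι → k)
    (hs : ∀ n i, s n i ≠ 0) (h0 : ∀ i, E (w (0, i)) = 0)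
    (hE : ∀ n i, E (w (n + 1, i)) = s n i • w (n, i))
    (hw : LinearIndependent k fun i => w (0, i)) : LinearIndependent k w := by
  classical
  let σ : (ℕ × ι →₀ k) →ₗ[k] (ℕ × ι →₀ k) := Finsupp.linearCombination k fun p =>
    match p with
    | (0, _) => 0
    | (n + 1, i) => Finsupp.single (n, i) (s n i)
  have hσ (l : ℕ × ι →₀ k) (n : ℕ) (i : ι) : σ l (n, i) = s n i * l (n + 1, i) := by
    have : Finsupp.lapply (n, i) ∘ₗ σ = s n i • Finsupp.lapply (n + 1, i) := by
      refine Finsupp.lhom_ext fun p c => ?_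
      obtain ⟨m, j⟩ := p
      cases m with
      | zero => simp [σ]
      | succ m =>
        by_cases h : (m, j) = (n, i)
        · obtain ⟨rfl, rfl⟩ := Prod.mk.inj h
          simp [σ, mul_comm]
        · have h' : (m + 1, j) ≠ (n + 1, i) := fun h' => h (by simpa using h')
          simp [σ, h, h']
    exact LinearMap.congr_fun this l
  have hEσ (l : ℕ × ι →₀ k) :
      E (Finsupp.linearCombination k w l) = Finsupp.linearCombination k w (σ l) := by
    have : E ∘ₗ Finsupp.linearCombination k w = Finsupp.linearCombination k w ∘ₗ σ := by
      refine Finsupp.lhom_ext fun p c => ?_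
      obtain ⟨m, j⟩ := p
      cases m with
      | zero => simp [σ, h0]
      | succ m =>
        simp only [σ, LinearMap.comp_apply, Finsupp.linearCombination_single, map_smul, hE]
    exact LinearMap.congr_fun this l
  have key (N : ℕ) : ∀ l : ℕ × ι →₀ k, (∀ n i, N ≤ n → l (n, i) = 0) →
      Finsupp.linearCombination k w l = 0 → l = 0 := by
    induction N with
    | zero => exact fun l hl _ => Finsupp.ext fun p => hl p.1 p.2 (Nat.zero_le _)
    | succ N ih =>
      intro l hl hl0
      have h1 : σ l = 0 := ih _ (fun n i hn => by rw [hσ, hl _ _ (by lia), mul_zero])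
        (by rw [← hEσ, hl0, map_zero])
      have h2 (n : ℕ) (i : ι) : l (n + 1, i) = 0 := by
        have := hσ l n i
        rw [h1, Finsupp.zero_apply, eq_comm] at this
        exact (mul_eq_zero.mp this).resolve_left (hs n i)
      have hinj : Function.Injective fun i : ι => ((0 : ℕ), i) := fun i j h => by simpa using h
      set l₀ : ι →₀ k := l.comapDomain (fun i => ((0 : ℕ), i)) hinj.injOn
      have h3 : l = l₀.mapDomain fun i => ((0 : ℕ), i) := by
        refine (Finsupp.mapDomain_comapDomain _ hinj l fun p hp => ?_).symm
        obtain ⟨n, i⟩ := p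
        cases n with
        | zero => exact ⟨i, rfl⟩
        | succ n => exact absurd (h2 n i) (Finsupp.mem_support_iff.mp hp)
      rw [h3, Finsupp.linearCombination_mapDomain] at hl0
      rw [h3, linearIndependent_iff.mp hw l₀ hl0, Finsupp.mapDomain_zero]
  refine linearIndependent_iff.mpr fun l hl => key (l.support.sup Prod.fst + 1) l ?_ hl
  intro n i hn
  by_contra h
  have := Finset.le_sup (f := Prod.fst) (Finsupp.mem_support_iff.mpr h)
  simp only at this
  lia

end LoweringOperator

section SkewPowers

variable {k A : Type*} [Field k] [Ring A] [Algebra k A] {E : A →ₗ[k] A} {z : A}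

theorem map_pow_mul_of_skew {c : k} (h : ∀ y, E (z * y) = c • (z * E y)) (n : ℕ) (y : A) :
    E (z ^ n * y) = c ^ n • (z ^ n * E y) := by
  induction n with
  | zero => simp
  | succ n ih =>
    rw [pow_succ', mul_assoc, h, ih, mul_smul_comm, smul_smul, mul_assoc, pow_succ']

theorem map_pow_succ_mul_of_derivation (h : ∀ y, E (z * y) = y + z * E y) (n : ℕ) (y : A) :
    E (z ^ (n + 1) * y) = (n + 1 : k) • (z ^ n * y) + z ^ (n + 1) * E y := by
  induction n with
  | zero => simp [h]
  | succ n ih =>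
    rw [pow_succ', mul_assoc, h, ih, mul_add, mul_smul_comm, ← mul_assoc, ← pow_succ', ← mul_assoc,
      ← pow_succ', ← add_assoc]
    congr 1
    push_cast
    module

end SkewPowers

/-- The ordered monomials in `z 0, …, z 4` are linearly independent if there are operators
`D 0, …, D 3` which act on products like skew derivations with `D j (z i) = δ i j` for `i ≤ 3`, and
for which `D 3` lowers the exponent of `z 4` at the cost of a factor `z 0`. -/
theorem linearIndependent_of_skewDerivations {k A : Type*} [Field k] [CharZero k] [Ring A]
    [Algebra k A] (z : Fin 5 → A) (D : Fin 5 → A →ₗ[k] A) (r : Fin 5 → Fin 5 → kˣ) (a : k)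
    (ha : a ≠ 0) (hnt : (1 : A) ≠ 0)
    (hne : ∀ {i j : Fin 5}, i ≠ 4 → j ≠ 4 → j ≠ i → ∀ (n : ℕ) (y : A),
      D j (z i ^ n * y) = (r i j : k) ^ n • (z i ^ n * D j y))
    (hself : ∀ {j : Fin 5}, j ≠ 4 → ∀ (n : ℕ) (y : A),
      D j (z j ^ (n + 1) * y) = (n + 1 : k) • (z j ^ n * y) + z j ^ (n + 1) * D j y)
    (hone : ∀ {j : Fin 5}, j ≠ 4 → D j 1 = 0)
    (h04 : ∀ (n : ℕ) (y : A), D 0 (z 4 ^ n * y) = (r 4 0 : k) ^ n • (z 4 ^ n * D 0 y))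
    (h34 : ∀ n : ℕ, D 3 (z 4 ^ (n + 1)) = ((n + 1) * a : k) • (z 0 * z 4 ^ n)) :
    LinearIndependent k fun n : Fin 5 → ℕ =>
      z 0 ^ n 0 * z 1 ^ n 1 * z 2 ^ n 2 * z 3 ^ n 3 * z 4 ^ n 4 := by
  have hcast (n : ℕ) : (n + 1 : k) ≠ 0 := Nat.cast_add_one_ne_zero n
  have hchi (i j : Fin 5) (n : ℕ) : (r i j : k) ^ n ≠ 0 := pow_ne_zero _ (Units.ne_zero _)
  have hker {i : Fin 5} (hi : i ≠ 4) (hi0 : 0 ≠ i) (n : ℕ) {y : A} (hy : D 0 y = 0) :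
      D 0 (z i ^ n * y) = 0 := by
    rw [hne hi (by decide) hi0, hy, mul_zero, smul_zero]
  have h3 (n : ℕ) {y : A} (hy : D 0 y = 0) : D 0 (D 3 (z 3 ^ n * y)) =
      (r 3 0 : k) ^ n • (z 3 ^ n * D 0 (D 3 y)) := by
    cases n with
    | zero => rw [pow_zero, pow_zero, one_mul, one_mul, one_smul]
    | succ n =>
      rw [hself (by decide), map_add, map_smul, hker (by decide) (by decide) n hy, smul_zero,
        zero_add, hne (by decide) (by decide) (by decide)]
  let s₁ : ℕ → ℕ → ℕ → k := fun a b c => (r 1 3 : k) ^ a *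
    (r 2 3 : k) ^ b * (r 1 0 : k) ^ a *
    (r 2 0 : k) ^ b * (r 3 0 : k) ^ c
  have hs₁ (l m n : ℕ) : s₁ l m n ≠ 0 :=
    mul_ne_zero (mul_ne_zero (mul_ne_zero (mul_ne_zero (hchi _ _ _) (hchi _ _ _)) (hchi _ _ _))
      (hchi _ _ _)) (hchi _ _ _)
  have h03 (l m n : ℕ) {y : A} (hy : D 0 y = 0) :
      D 0 (D 3 (z 1 ^ l * (z 2 ^ m * (z 3 ^ n * y)))) =
        s₁ l m n • (z 1 ^ l * (z 2 ^ m * (z 3 ^ n * D 0 (D 3 y)))) := by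
    rw [hne (by decide) (by decide) (by decide), hne (by decide) (by decide) (by decide),
      mul_smul_comm, map_smul, map_smul, hne (by decide) (by decide) (by decide),
      hne (by decide) (by decide) (by decide), h3 n hy]
    simp only [mul_smul_comm, smul_smul, s₁, mul_assoc]
  have h0z4 (n : ℕ) : D 0 (z 4 ^ n) = 0 := by
    rw [← mul_one (z 4 ^ n), h04, hone (by decide), mul_zero, smul_zero]
  -- The exponents are lowered, in this order from the inside, by `D 3`, `D 2`, `D 1` (for `z₄`,
  -- `z₃`, `z₂`), by `D 0 ∘ D 3` (for `z₅`), and by `D 0` (for `z₁`).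
  let w₁ : ℕ × Unit → A := fun p => z 3 ^ p.1 * 1
  have L₁ : LinearIndependent k w₁ := by
    refine LinearIndependent.of_lowering (D 3) (fun n _ => n + 1) (fun n _ => hcast n)
      (fun i => ?_) (fun n i => ?_) ?_
    · simp [w₁, hone (show (3 : Fin 5) ≠ 4 by decide)]
    · simp only [w₁]
      rw [hself (by decide), hone (by decide), mul_zero, add_zero]
    · refine LinearIndependent.of_subsingleton (v := fun i : Unit => w₁ (0, i)) () ?_
      simpa [w₁] using hnt
  let w₂ : ℕ × (ℕ × Unit) → A := fun p => z 2 ^ p.1 * w₁ p.2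
  have L₂ : LinearIndependent k w₂ := by
    have h1 (i) : D 2 (w₁ i) = 0 := by
      simp only [w₁]
      rw [hne (by decide) (by decide) (by decide), hone (by decide), mul_zero, smul_zero]
    refine LinearIndependent.of_lowering (D 2) (fun n _ => n + 1) (fun n _ => hcast n)
      (fun i => ?_) (fun n i => ?_) ?_
    · simp only [w₂]
      rw [pow_zero, one_mul, h1]
    · simp only [w₂]
      rw [hself (by decide), h1, mul_zero, add_zero]
    · simpa only [w₂, pow_zero, one_mul] using L₁
  let w₃ : ℕ × (ℕ × (ℕ × Unit)) → A := fun p => z 1 ^ p.1 * w₂ p.2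
  have L₃ : LinearIndependent k w₃ := by
    have h1 (i) : D 1 (w₂ i) = 0 := by
      simp only [w₂, w₁]
      rw [hne (by decide) (by decide) (by decide), hne (by decide) (by decide) (by decide),
        hone (by decide), mul_zero, smul_zero, mul_zero, smul_zero]
    refine LinearIndependent.of_lowering (D 1) (fun n _ => n + 1) (fun n _ => hcast n)
      (fun i => ?_) (fun n i => ?_) ?_
    · simp only [w₃]
      rw [pow_zero, one_mul, h1]
    · simp only [w₃]
      rw [hself (by decide), h1, mul_zero, add_zero]
    · simpa only [w₃, pow_zero, one_mul] using L₂
  let w₄ : ℕ × (ℕ × (ℕ × (ℕ × Unit))) → A := fun p =>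
    z 1 ^ p.2.1 * (z 2 ^ p.2.2.1 * (z 3 ^ p.2.2.2.1 * z 4 ^ p.1))
  have L₄ : LinearIndependent k w₄ := by
    refine LinearIndependent.of_lowering (D 0 ∘ₗ D 3)
      (fun n i => s₁ i.1 i.2.1 i.2.2.1 * ((n + 1) * a))
      (fun n i => mul_ne_zero (hs₁ _ _ _) (mul_ne_zero (hcast n) ha))
      (fun i => ?_) (fun n i => ?_) ?_
    · rw [LinearMap.comp_apply, h03 _ _ _ (h0z4 0), pow_zero, hone (by decide)]
      simp
    · have e : D 0 (z 0 * z 4 ^ n) = z 4 ^ n := by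
        have := hself (show (0 : Fin 5) ≠ 4 by decide) 0 (z 4 ^ n)
        simpa [h0z4] using this
      rw [LinearMap.comp_apply, h03 _ _ _ (h0z4 _), h34, map_smul, e]
      simp only [mul_smul_comm, smul_smul, w₄]
    · simpa only [w₄, w₃, w₂, w₁, pow_zero] using L₃
  let w₅ : ℕ × (ℕ × (ℕ × (ℕ × (ℕ × Unit)))) → A := fun p => z 0 ^ p.1 * w₄ p.2
  have L₅ : LinearIndependent k w₅ := by
    have h1 (i) : D 0 (w₄ i) = 0 :=
      hker (by decide) (by decide) _ (hker (by decide) (by decide) _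
        (hker (by decide) (by decide) _ (h0z4 _)))
    refine LinearIndependent.of_lowering (D 0) (fun n _ => n + 1) (fun n _ => hcast n)
      (fun i => ?_) (fun n i => ?_) ?_
    · simp only [w₅]
      rw [pow_zero, one_mul, h1]
    · simp only [w₅]
      rw [hself (by decide), h1, mul_zero, add_zero]
    · simpa only [w₅, pow_zero, one_mul] using L₄
  have hcomp : (fun n : Fin 5 → ℕ => z 0 ^ n 0 * z 1 ^ n 1 * z 2 ^ n 2 * z 3 ^ n 3 * z 4 ^ n 4) =
      w₅ ∘ fun n : Fin 5 → ℕ => (n 0, n 4, n 1, n 2, n 3, ()) := by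
    funext n
    simp only [Function.comp_apply, w₅, w₄, mul_assoc]
  rw [hcomp]
  refine L₅.comp _ fun m n hmn => ?_
  simp only [Prod.mk.injEq, and_true] at hmn
  funext i
  fin_cases i
  exacts [hmn.1, hmn.2.2.1, hmn.2.2.2.1, hmn.2.2.2.2, hmn.2.1]

namespace RankTwo

open DiagTensor BraidedHopf

variable {k : Type*} [Field k] {q : Fin 2 → Fin 2 → kˣ}

theorem IsCubicA2.chi_zWord_self (h : IsCubicA2 q) {j : Fin 5} (hj : j ≠ 4) :
    (chi q (zWord j) (zWord j) : k) = 1 := by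
  obtain ⟨h1, h2, h3⟩ := h
  have h4 : (q 0 0 : k) ^ 3 = 1 := by linear_combination ((q 0 0 : k) - 1) * h1
  fin_cases j
  · simp [zWord, chi, FreeMonoid.lift_apply, h2]; grind
  · simp [zWord, chi, FreeMonoid.lift_apply, h2]; grind
  · simp [zWord, chi, FreeMonoid.lift_apply, h2]; grind
  · simp [zWord, chi, FreeMonoid.lift_apply]; grind
  · exact absurd rfl hj

theorem IsCubicA2.chi_zWord_four (h : IsCubicA2 q) :
    (chi q (zWord 4) (zWord 3) : k) * chi q (zWord 4) (zWord 0) = 1 := by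
  obtain ⟨h1, h2, h3⟩ := h
  have h4 : (q 0 0 : k) ^ 3 = 1 := by linear_combination ((q 0 0 : k) - 1) * h1
  simp [zWord, chi, FreeMonoid.lift_apply, h2]
  grind

theorem IsCubicA2.linearIndependent_zMonomial [CharZero k] (h : IsCubicA2 q)
    {HB : BraidedHopf k (Hat q)} (hB : (hopf q).IsHom HB (toHat q)) :
    LinearIndependent k (zMonomial q) := by
  obtain ⟨a, c, ha, hz⟩ := comul_z_four hB h
  set D : Fin 5 → Hat q →ₗ[k] Hat q := fun j => skewDeriv HB (zWord j) with hD
  have hl {j : Fin 5} (hj : j ≠ 4) : (zWord j).length ≤ 3 := by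
    revert j
    decide
  have hne {i j : Fin 5} (hi : i ≠ 4) (hj : j ≠ 4) (hij : j ≠ i) (n : ℕ) (y : Hat q) :
      D j (z q i ^ n * y) = (chi q (zWord i) (zWord j) : k) ^ n • (z q i ^ n * D j y) := by
    refine map_pow_mul_of_skew (fun y => ?_) n y
    rw [hD, skewDeriv_z_mul hB h (hl hj) hi, hatCoeff_z hj, if_neg hij, zero_smul, zero_add]
  have hself {j : Fin 5} (hj : j ≠ 4) (n : ℕ) (y : Hat q) :
      D j (z q j ^ (n + 1) * y) = (n + 1 : k) • (z q j ^ n * y) + z q j ^ (n + 1) * D j y := by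
    refine map_pow_succ_mul_of_derivation (fun y => ?_) n y
    rw [hD, skewDeriv_z_mul hB h (hl hj) hj, hatCoeff_z hj, if_pos rfl, h.chi_zWord_self hj,
      one_smul, one_smul]
  have hone {j : Fin 5} (hj : j ≠ 4) : D j 1 = 0 := by
    have : hatCoeff q (zWord j) 1 = 0 := by
      classical
      rw [← map_one (toHat q), hatCoeff_toHat (Nat.lt_succ_of_le (hl hj)), ← word_one, coeff_word,
        if_neg]
      intro e
      have e' : 0 = (zWord j).length := congrArg FreeMonoid.length e
      clear * - e' hj
      revert j
      decide
    simp [hD, skewDeriv, HB.comul_one, contractLeft_tmul, this]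
  have h04 (n : ℕ) (y : Hat q) :
      D 0 (z q 4 ^ n * y) = (chi q (zWord 4) (zWord 0) : k) ^ n • (z q 4 ^ n * D 0 y) := by
    refine map_pow_mul_of_skew (fun y => ?_) n y
    rw [hD, skewDeriv_z_four_mul hB hz (hl (by decide)), hatCoeff_z (by decide),
      hatCoeff_z (by decide)]
    simp
  have h34 (n : ℕ) : D 3 (z q 4 ^ (n + 1)) = ((n + 1) * a : k) • (z q 0 * z q 4 ^ n) := by
    have h1 (y : Hat q) : D 3 (z q 4 * y) = a • (z q 0 * y) +
        (chi q (zWord 4) (zWord 3) : k) • (z q 4 * D 3 y) := by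
      rw [hD, skewDeriv_z_four_mul hB hz (hl (by decide)), hatCoeff_z (by decide),
        hatCoeff_z (by decide)]
      simp
    induction n with
    | zero =>
      rw [zero_add, pow_one, ← mul_one (z q 4), h1, hone (by decide)]
      simp
    | succ n ih =>
      rw [pow_succ', h1, ih, mul_smul_comm, ← mul_assoc, h.z_comm 4 0, smul_mul_assoc, mul_assoc,
        ← pow_succ', smul_smul, smul_smul, ← add_smul]
      congr 1
      have := h.chi_zWord_four
      push_cast
      linear_combination ((n + 1) * a : k) * this
  refine linearIndependent_of_skewDerivations (z q) D (fun i j => chi q (zWord i) (zWord j)) a ha ?_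
    hne hself hone h04 h34
  intro h0
  have := HB.counit_one
  rw [h0, map_zero] at this
  exact zero_ne_one this

end RankTwo

/-! ### The defining ideal of the Nichols algebra -/

namespace DiagTensor

variable {k : Type*} [Field k] {ι : Type*}

theorem coeff_degreeProj (n : ℕ) (w : FreeMonoid ι) (x : FreeAlgebra k ι) :
    coeff k w (degreeProj k ι n x) = if w.length = n then coeff k w x else 0 := by
  classical
  have : coeff k w ∘ₗ degreeProj k ι n = if w.length = n then coeff k w else 0 :=
    (word k ι).ext fun v => by
      rw [LinearMap.comp_apply, degreeProj_word]
      by_cases h : v = w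
      · subst h
        split_ifs <;> simp
      · split_ifs <;> simp [coeff_word, h]
  have := LinearMap.congr_fun this x
  rw [LinearMap.comp_apply] at this
  rw [this]
  split_ifs <;> rfl

theorem degreeProj_one_mem (x : FreeAlgebra k ι) :
    degreeProj k ι 1 x ∈ Submodule.span k (Set.range (FreeAlgebra.ι k)) := by
  have hx := (word k ι).mem_span x
  refine (Submodule.span_le (p := Submodule.comap (degreeProj k ι 1)
    (Submodule.span k (Set.range (FreeAlgebra.ι k))))).mpr ?_ hx
  rintro _ ⟨w, rfl⟩
  rw [SetLike.mem_coe, Submodule.mem_comap, degreeProj_word]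
  split_ifs with h
  · obtain ⟨i, rfl⟩ := FreeMonoid.length_eq_one.mp h
    rw [word_of]
    exact Submodule.subset_span ⟨i, rfl⟩
  · exact zero_mem _

/-- The coefficients of the generators vanish on a graded ideal meeting `k ⊕ V` trivially. -/
theorem coeff_of_eq_zero_of_isGraded {I : TwoSidedIdeal (FreeAlgebra k ι)} (hI : IsGraded I)
    (hV : ∀ x ∈ I, x ∈ Submodule.span k ({1} ∪ Set.range (FreeAlgebra.ι k)) → x = 0)
    {x : FreeAlgebra k ι} (hx : x ∈ I) (i : ι) : coeff k (FreeMonoid.of i) x = 0 := by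
  have h0 := hV _ (hI x hx 1)
    (Submodule.span_mono Set.subset_union_right (degreeProj_one_mem x))
  have := coeff_degreeProj 1 (FreeMonoid.of i) x
  rwa [h0, map_zero, if_pos (FreeMonoid.length_of i), eq_comm] at this

theorem eq_zero_of_mem_span_one_union {n : ℕ} (hn : 2 ≤ n) {x : FreeAlgebra k ι}
    (hx : x ∈ Submodule.span k ({1} ∪ Set.range (FreeAlgebra.ι k)))
    (h : ∀ w : FreeMonoid ι, w.length < n → coeff k w x = 0) : x = 0 := by
  classical
  refine (word k ι).ext_elem fun w => ?_
  rw [map_zero, Finsupp.zero_apply]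
  change coeff k w x = 0
  by_cases hw : w.length < n
  · exact h w hw
  · refine (Submodule.span_le (p := LinearMap.ker (coeff k w))).mpr ?_ hx
    have hne (v : FreeMonoid ι) (hv : v.length ≤ 1) : coeff k w (word k ι v) = 0 := by
      rw [coeff_word, if_neg]
      rintro rfl
      lia
    rintro _ (rfl | ⟨i, rfl⟩)
    · rw [← word_one]; exact hne _ (by simp)
    · rw [← word_of]; exact hne _ (by simp)

end DiagTensor

namespace RankTwo

open DiagTensor BraidedHopf

variable {k : Type*} [Field k] {q : Fin 2 → Fin 2 → kˣ}

/-- The ideal of the tensor algebra generated by `x₂³`, `x₂₂₁`, `x₁₁₂`, `x₁³`, `x₁₂³`. -/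
def cubeIdeal (q : Fin 2 → Fin 2 → kˣ) : TwoSidedIdeal (FreeAlgebra k (Fin 2)) :=
  TwoSidedIdeal.span (Set.range (zLift q))

/-- The generators of `hatIdeal` are braided commutators with `x₂₂₁` and `x₁₁₂`. -/
theorem hatIdeal_le {J : TwoSidedIdeal (FreeAlgebra k (Fin 2))} (h1 : zLift q 1 ∈ J)
    (h2 : zLift q 2 ∈ J) : hatIdeal q ≤ J := by
  have key (i : Fin 2) (l : List (Fin 2)) (j : Fin 2) (hl : adWord q l j ∈ J) :
      adWord q (i :: l) j ∈ J := by
    rw [adWord_cons, act_of_mem_homog q _ (adWord_mem_homog q l j), smul_mul_assoc]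
    refine sub_mem (J.mul_mem_left _ _ hl) ((mem_idealSub (k := k)).mp (Submodule.smul_mem _ _
      ((mem_idealSub (k := k)).mpr (J.mul_mem_right _ _ hl))))
  refine TwoSidedIdeal.span_le.mpr ?_
  rintro g (rfl | rfl | rfl | rfl)
  exacts [key _ _ _ h2, key _ _ _ h1, key _ _ _ h2, key _ _ _ h1]

theorem zLift_mem_cubeIdeal (j : Fin 5) : zLift q j ∈ cubeIdeal q :=
  TwoSidedIdeal.subset_span ⟨j, rfl⟩

theorem hatIdeal_le_cubeIdeal : hatIdeal q ≤ cubeIdeal q :=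
  hatIdeal_le (zLift_mem_cubeIdeal 1) (zLift_mem_cubeIdeal 2)

variable {HB : BraidedHopf k (Hat q)} (hB : (hopf q).IsHom HB (toHat q))

include hB

theorem IsCubicA2.isHopfIdeal_cubeIdeal [CharZero k] (h : IsCubicA2 q) :
    (hopf q).IsHopfIdeal (cubeIdeal q) := by
  obtain ⟨a, c, -, hz⟩ := comul_z_four hB h
  have hlift (j : Fin 5) := zLift_mem_cubeIdeal (q := q) j
  have hsmul {J : TwoSidedIdeal (FreeAlgebra k (Fin 2))} (c : k) {x : FreeAlgebra k (Fin 2)}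
      (hx : x ∈ J) : c • x ∈ J :=
    (mem_idealSub (k := k)).mp (Submodule.smul_mem _ _ ((mem_idealSub (k := k)).mpr hx))
  -- The ideal generated by the first four generators, which are primitive.
  set J₀ := TwoSidedIdeal.span (zLift q '' {4}ᶜ) with hJ₀
  have hJ₀l {j : Fin 5} (hj : j ≠ 4) : zLift q j ∈ J₀ := TwoSidedIdeal.subset_span ⟨j, hj, rfl⟩
  have hJ₀le : J₀ ≤ cubeIdeal q := TwoSidedIdeal.span_le.mpr (by
    rintro _ ⟨j, -, rfl⟩; exact hlift j)
  obtain ⟨r, hr, hSr⟩ : ∃ r ∈ J₀, antipode q (zLift q 4) = -zLift q 4 + r := by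
    refine ⟨antipode q (zLift q 4) + zLift q 4, ?_, by abel⟩
    have h1 : antipode q (zLift q 4) + zLift q 4 - (a • (zLift q 3 * zLift q 0) +
        c • (zLift q 2 * zLift q 1)) ∈ hatIdeal q := by
      have h2 : toHat q (antipode q (zLift q 4)) = HB.antipode (z q 4) := by
        rw [← toHat_zLift]; exact hB.map_antipode _
      rw [← toHat_eq_zero_iff, map_sub, map_add, map_add, map_smul, map_smul, map_mul, map_mul,
        h2, antipode_z_four hB h hz]
      simp only [toHat_zLift]
      abel
    have h2 := add_mem (hatIdeal_le (hJ₀l (by decide)) (hJ₀l (by decide)) h1) (add_mem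
      (hsmul a (J₀.mul_mem_left (zLift q 3) _ (hJ₀l (show (0 : Fin 5) ≠ 4 by decide))))
      (hsmul c (J₀.mul_mem_left (zLift q 2) _ (hJ₀l (show (1 : Fin 5) ≠ 4 by decide)))))
    rwa [sub_add_cancel] at h2
  have hSr' : antipode (qinv q) (zLift q 4) = -zLift q 4 + antipode (qinv q) r := by
    have := congrArg (antipode (qinv q)) hSr
    rw [antipode_qinv_antipode, map_add, map_neg] at this
    rw [eq_neg_add_iff_add_eq, add_comm]
    exact eq_neg_add_iff_add_eq.mp this
  have hr' : antipode (qinv q) r ∈ J₀ := by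
    refine antipode_mem_span (qinv q) ?_ ?_ r hr
    · rintro _ ⟨j, -, rfl⟩ t
      exact exists_torus_eq_smul (zLift_mem_homog j) t
    · rintro _ ⟨j, hj, rfl⟩
      rw [(antipode_of_primitive q (h.comul_zLift hj)).2.2]
      exact neg_mem (hJ₀l hj)
  have hprim {j : Fin 5} (hj : j ≠ 4) := antipode_of_primitive q (h.comul_zLift hj)
  refine isHopfIdeal_span q ?_ ?_ ?_ ?_ ?_
  · rintro _ ⟨j, rfl⟩ t
    exact exists_torus_eq_smul (zLift_mem_homog j) t
  · rintro _ ⟨j, rfl⟩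
    change comul q (zLift q j) ∈ coidealSub k (cubeIdeal q)
    by_cases hj : j = 4
    · subst hj
      have h1 : comul q (zLift q 4) - (zLift q 4 ⊗ₜ 1 + a • (zLift q 3 ⊗ₜ[k] zLift q 0) +
          c • (zLift q 2 ⊗ₜ[k] zLift q 1) + 1 ⊗ₜ zLift q 4) ∈ coidealSub k (hatIdeal q) := by
        have hk := ker_tmap2 (toHat q) toHat_surjective (P := idealSub k (hatIdeal q))
          (fun a => toHat_eq_zero_iff.trans (mem_idealSub (k := k)).symm)
        rw [coidealSub, ← hk, LinearMap.mem_ker, map_sub, ← comul_toHat hB, toHat_zLift, hz]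
        simp [toHat_zLift]
      have h2 := add_mem (coidealSub_mono hatIdeal_le_cubeIdeal h1) (add_mem (add_mem (add_mem
        (tmul_mem_coidealSub_left (hlift 4) 1)
        (Submodule.smul_mem _ a (tmul_mem_coidealSub_left (hlift 3) (zLift q 0))))
        (Submodule.smul_mem _ c (tmul_mem_coidealSub_left (hlift 2) (zLift q 1))))
        (tmul_mem_coidealSub_right 1 (hlift 4)))
      rwa [sub_add_cancel] at h2
    · rw [h.comul_zLift hj]
      exact add_mem (tmul_mem_coidealSub_left (hlift j) _) (tmul_mem_coidealSub_right _ (hlift j))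
  · rintro _ ⟨j, rfl⟩
    rw [← counit_toHat hB, toHat_zLift, counit_z hB]
  · rintro _ ⟨j, rfl⟩
    by_cases hj : j = 4
    · rw [hj, hSr]
      exact add_mem (neg_mem (hlift 4)) (hJ₀le hr)
    · rw [(hprim hj).2.1]
      exact neg_mem (hlift j)
  · rintro _ ⟨j, rfl⟩
    by_cases hj : j = 4
    · rw [hj, hSr']
      exact add_mem (neg_mem (hlift 4)) (hJ₀le hr')
    · rw [(hprim hj).2.2]
      exact neg_mem (hlift j)

omit hB in
theorem coeff_eq_zero_of_mem_cubeIdeal {w : FreeMonoid (Fin 2)} (hw : w.length < 3)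
    {x : FreeAlgebra k (Fin 2)} (hx : x ∈ cubeIdeal q) : coeff k w x = 0 := by
  refine coeff_eq_zero_of_mem_span (n := 3) ?_ hw hx
  rintro _ ⟨j, rfl⟩
  refine ⟨_, ?_, zLift_mem_homog j⟩
  revert j
  decide

omit hB in
theorem isGraded_cubeIdeal : IsGraded (cubeIdeal q) := by
  refine isGraded_span ?_
  rintro _ ⟨j, rfl⟩
  exact ⟨_, zLift_mem_homog j⟩

/-- The image in `B̂` of a Hopf ideal without linear terms is stable under the skew derivations of
degree one. -/
theorem skewDeriv_mem_map {I : TwoSidedIdeal (FreeAlgebra k (Fin 2))}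
    (hI : (hopf q).IsHopfIdeal I) (hφ : ∀ x ∈ I, ∀ i, coeff k (FreeMonoid.of i) x = 0)
    (i : Fin 2) : ∀ e ∈ (idealSub k I).map (toHat q).toLinearMap,
      skewDeriv HB (FreeMonoid.of i) e ∈ (idealSub k I).map (toHat q).toLinearMap := by
  rintro _ ⟨x, hx, rfl⟩
  have hx' : comul q x ∈ coidealSub k I := hI.comul_mem x ((mem_idealSub (k := k)).mp hx)
  rw [skewDeriv, LinearMap.comp_apply, AlgHom.toLinearMap_apply, comul_toHat hB]
  refine (coidealSub_le (M := ((idealSub k I).map (toHat q).toLinearMap).comap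
    (contractLeft (hatCoeff q (FreeMonoid.of i)) ∘ₗ tmap2 (toHat q)))).mpr
    (fun a ha b => ⟨?_, ?_⟩) hx'
  · simp only [Submodule.mem_comap, LinearMap.comp_apply, TensorProduct.map_tmul,
      AlgHom.toLinearMap_apply, contractLeft_tmul]
    rw [hatCoeff_toHat (by simp), hφ a ha, zero_smul]
    exact zero_mem _
  · simp only [Submodule.mem_comap, LinearMap.comp_apply, TensorProduct.map_tmul,
      AlgHom.toLinearMap_apply, contractLeft_tmul]
    exact Submodule.smul_mem _ _ ⟨a, (mem_idealSub (k := k)).mpr ha, rfl⟩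

omit hB in
/-- Every element of `Z` is a constant modulo the ideal generated by the `z j`. -/
theorem Z_le_sup : Subalgebra.toSubmodule (Z q) ≤
    Submodule.span k {(1 : Hat q)} ⊔ (idealSub k (cubeIdeal q)).map (toHat q).toLinearMap := by
  intro b hb
  refine Z_induction (Submodule.mem_sup_left (Submodule.mem_span_singleton_self _))
    (fun j b _ _ => Submodule.mem_sup_right ?_) hb
  obtain ⟨b, rfl⟩ := toHat_surjective b
  refine ⟨zLift q j * b, (mem_idealSub (k := k)).mpr
    ((cubeIdeal q).mul_mem_right _ _ (zLift_mem_cubeIdeal j)), ?_⟩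
  rw [AlgHom.toLinearMap_apply, map_mul, toHat_zLift]

/-- The defining ideal of the Nichols algebra is generated by `x₂³`, `x₂₂₁`, `x₁₁₂`, `x₁³`, `x₁₂³`:
modulo these elements `B̂` is spanned by the `x₂ᵃ x₁₂ᵇ x₁ᶜ` with `a, b, c ≤ 2`, and this span meets
trivially every subspace stable under the skew derivations on which the counit vanishes. -/
theorem IsCubicA2.nicholsIdeal_eq [CharZero k] (h : IsCubicA2 q) :
    nicholsIdeal q = cubeIdeal q := by
  have hJV : ∀ x ∈ cubeIdeal q, x ∈ Submodule.span k ({1} ∪ Set.range (FreeAlgebra.ι k)) → x = 0 :=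
    fun x hx hxV => eq_zero_of_mem_span_one_union (n := 3) (by decide) hxV
      fun w hw => coeff_eq_zero_of_mem_cubeIdeal hw hx
  have hJ := h.isHopfIdeal_cubeIdeal hB
  refine le_antisymm (sSup_le ?_) (le_sSup ⟨hJ, isGraded_cubeIdeal, hJV⟩)
  rintro I ⟨hI, hIgr, hIV⟩ p hp
  set KI := (idealSub k I).map (toHat q).toLinearMap
  set KJ := (idealSub k (cubeIdeal q)).map (toHat q).toLinearMap
  have hK : ∀ i, ∀ e ∈ KI ⊔ KJ, skewDeriv HB (FreeMonoid.of i) e ∈ KI ⊔ KJ := by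
    intro i e he
    obtain ⟨e₁, h₁, e₂, h₂, rfl⟩ := Submodule.mem_sup.mp he
    rw [map_add]
    exact add_mem (Submodule.mem_sup_left (skewDeriv_mem_map hB hI
      (fun x hx => coeff_of_eq_zero_of_isGraded hIgr hIV hx) i _ h₁))
      (Submodule.mem_sup_right (skewDeriv_mem_map hB hJ
      (fun x hx => coeff_of_eq_zero_of_isGraded isGraded_cubeIdeal hJV hx) i _ h₂))
  have hε : KI ⊔ KJ ≤ LinearMap.ker HB.counit := by
    refine sup_le ?_ ?_
    · rintro _ ⟨x, hx, rfl⟩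
      exact (counit_toHat hB x).trans (hI.counit_eq x ((mem_idealSub (k := k)).mp hx))
    · rintro _ ⟨x, hx, rfl⟩
      exact (counit_toHat hB x).trans (hJ.counit_eq x ((mem_idealSub (k := k)).mp hx))
  have hdisj : Disjoint (Submodule.span k {(1 : Hat q)}) (KI ⊔ KJ) := by
    refine Submodule.disjoint_def.mpr fun e he heK => ?_
    obtain ⟨c, rfl⟩ := Submodule.mem_span_singleton.mp he
    have h1 : HB.counit (c • (1 : Hat q)) = 0 := hε heK
    rw [map_smul, HB.counit_one, smul_eq_mul, mul_one] at h1
    rw [h1, zero_smul]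
  have h1Z : Submodule.span k {(1 : Hat q)} ≤ Subalgebra.toSubmodule (Z q) :=
    Submodule.span_le.mpr (Set.singleton_subset_iff.mpr (one_mem (Z q)))
  have hD := (h.derivation_criterion hB h1Z hK hdisj).1
  set B := cubicSpan (x q 1) (cubicSpan (x12 q) (cubicSpan (x q 0)
    (Submodule.span k {(1 : Hat q)})))
  have hmul : ∀ b : Hat q, ∀ e ∈ KJ, b * e ∈ KJ := by
    rintro b _ ⟨x, hx, rfl⟩
    obtain ⟨b, rfl⟩ := toHat_surjective b
    exact ⟨b * x, (mem_idealSub (k := k)).mpr ((cubeIdeal q).mul_mem_left _ _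
      ((mem_idealSub (k := k)).mp hx)), map_mul (toHat q) _ _⟩
  have hKJ (b : Hat q) {N : Submodule k (Hat q)} (hN : N ≤ KJ) : cubicSpan b N ≤ KJ :=
    cubicSpan_le hN (hmul b)
  have htop (y : Hat q) : y ∈ B ⊔ KJ := by
    have := cubicSpan_mono (x q 1) (cubicSpan_mono (x12 q) (cubicSpan_mono (x q 0) Z_le_sup))
      (h.mem_cubicSpan_Z y)
    rw [cubicSpan_sup, cubicSpan_sup, cubicSpan_sup] at this
    exact sup_le_sup_left (hKJ _ (hKJ _ (hKJ _ le_rfl))) _ this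
  obtain ⟨e₁, h₁, e₂, h₂, he⟩ := Submodule.mem_sup.mp (htop (toHat q p))
  have hpK : toHat q p ∈ KI := ⟨p, (mem_idealSub (k := k)).mpr hp, rfl⟩
  have h₁0 : e₁ = 0 := by
    refine Submodule.disjoint_def.mp hD e₁ h₁ ?_
    rw [eq_sub_of_add_eq he]
    exact sub_mem (Submodule.mem_sup_left hpK) (Submodule.mem_sup_right h₂)
  rw [h₁0, zero_add] at he
  obtain ⟨y, hy, hye⟩ := h₂
  have hpy : p - y ∈ hatIdeal q := by
    rw [← toHat_eq_zero_iff, map_sub, ← he, ← hye, AlgHom.toLinearMap_apply, sub_self]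
  have := add_mem (hatIdeal_le_cubeIdeal hpy) ((mem_idealSub (k := k)).mp hy)
  rwa [sub_add_cancel] at this

end RankTwo

/-! ### The extension -/

namespace RankTwo

open DiagTensor BraidedHopf

variable {k : Type*} [Field k] {q : Fin 2 → Fin 2 → kˣ}

theorem toNichols_eq_zero_iff {a : FreeAlgebra k (Fin 2)} :
    toNichols q a = 0 ↔ a ∈ nicholsIdeal q :=
  mk_eq_zero_iff _ _

variable {HB : BraidedHopf k (Hat q)} (hB : (hopf q).IsHom HB (toHat q))
  {HN : BraidedHopf k (Nichols q)} (hN : (hopf q).IsHom HN (toNichols q))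
  {π : Hat q →ₐ[k] Nichols q} (hπ : π.comp (toHat q) = toNichols q)

include hπ in
theorem proj_toHat (a : FreeAlgebra k (Fin 2)) : π (toHat q a) = toNichols q a :=
  AlgHom.congr_fun hπ a

include hB hN hπ in
theorem isHom_proj : HB.IsHom HN π := by
  have h2 (t : FreeAlgebra k (Fin 2) ⊗[k] FreeAlgebra k (Fin 2)) :
      tmap2 π (tmap2 (toHat q) t) = tmap2 (toNichols q) t := by
    rw [← hπ]
    exact (LinearMap.congr_fun (TensorProduct.map_comp π.toLinearMap π.toLinearMap
      (toHat q).toLinearMap (toHat q).toLinearMap) t).symm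
  refine ⟨fun t => ?_, fun a => ?_, fun a => ?_, fun a => ?_⟩
  · have hs : Function.Surjective (tmap2 (toHat q)) :=
      TensorProduct.map_surjective toHat_surjective toHat_surjective
    obtain ⟨t, rfl⟩ := hs t
    exact (congrArg (tmap2 π) (hB.map_c t)).symm.trans ((h2 _).trans ((hN.map_c t).trans
      (congrArg HN.c (h2 t).symm)))
  · obtain ⟨a, rfl⟩ := toHat_surjective a
    exact (congrArg (tmap2 π) (hB.map_comul a)).symm.trans ((h2 _).trans ((hN.map_comul a).trans
      (congrArg HN.comul (proj_toHat hπ a).symm)))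
  · obtain ⟨a, rfl⟩ := toHat_surjective a
    rw [proj_toHat hπ, hN.map_counit, hB.map_counit]
  · obtain ⟨a, rfl⟩ := toHat_surjective a
    rw [proj_toHat hπ, ← hB.map_antipode, proj_toHat hπ, hN.map_antipode]

include hB in
/-- The left ideal generated by the `z j` is the image of the ideal defining the Nichols
algebra. -/
theorem IsCubicA2.toHat_mem_span_z [CharZero k] (h : IsCubicA2 q) {a : FreeAlgebra k (Fin 2)}
    (ha : a ∈ nicholsIdeal q) : toHat q a ∈ Ideal.span (Set.range (z q)) := by
  rw [h.nicholsIdeal_eq hB] at ha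
  have hr (i : Fin 2) : ∀ e ∈ Ideal.span (Set.range (z q)),
      e * x q i ∈ Ideal.span (Set.range (z q)) := by
    intro e he
    induction he using Submodule.span_induction with
    | zero => rw [zero_mul]; exact zero_mem _
    | add a b _ _ ha hb => rw [add_mul]; exact add_mem ha hb
    | smul c a _ ha => rw [smul_eq_mul, mul_assoc]; exact Ideal.mul_mem_left _ _ ha
    | mem a ha =>
      obtain ⟨j, rfl⟩ := ha
      rw [h.z_mul]
      exact Ideal.mul_mem_left _ _ (Ideal.subset_span ⟨j, rfl⟩)
  refine mem_of_mem_span (((Ideal.span (Set.range (z q))).restrictScalars k).comap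
    (toHat q).toLinearMap) ?_ (fun i y hy => ?_) (fun i y hy => ?_) ha
  · rintro _ ⟨j, rfl⟩
    change toHat q (zLift q j) ∈ Ideal.span (Set.range (z q))
    rw [toHat_zLift]
    exact Ideal.subset_span ⟨j, rfl⟩
  · change toHat q (X k i * y) ∈ Ideal.span (Set.range (z q))
    rw [map_mul]
    exact Ideal.mul_mem_left _ _ hy
  · change toHat q (y * X k i) ∈ Ideal.span (Set.range (z q))
    rw [map_mul]
    exact hr i _ hy

include hB hπ in
/-- On `Z` the projection to the Nichols algebra is the counit. -/
theorem IsCubicA2.proj_Z [CharZero k] (h : IsCubicA2 q) {b : Hat q} (hb : b ∈ Z q) :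
    π b = HB.counit b • (1 : Nichols q) := by
  refine Z_induction (M := LinearMap.eqLocus π.toLinearMap (HB.counit.smulRight (1 : Nichols q)))
    ?_ (fun j b _ _ => ?_) hb
  · simp [LinearMap.mem_eqLocus, HB.counit_one]
  · have hz : π (z q j) = 0 := by
      rw [← toHat_zLift, proj_toHat hπ, toNichols_eq_zero_iff, h.nicholsIdeal_eq hB]
      exact zLift_mem_cubeIdeal j
    simp [LinearMap.mem_eqLocus, HB.counit_mul, counit_z hB, hz]

include hB hπ in
theorem IsCubicA2.coinvariant_of_mem_Z [CharZero k] (h : IsCubicA2 q) {b : Hat q} (hb : b ∈ Z q) :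
    π.toLinearMap.rTensor (Hat q) (HB.comul b) = 1 ⊗ₜ b := by
  have key : ∀ t ∈ tensorSub (Subalgebra.toSubmodule (Z q)) (Subalgebra.toSubmodule (Z q)),
      π.toLinearMap.rTensor (Hat q) t = 1 ⊗ₜ contractLeft HB.counit t := by
    refine tensorSub_le (M := LinearMap.eqLocus (π.toLinearMap.rTensor (Hat q))
      (TensorProduct.mk k (Nichols q) (Hat q) 1 ∘ₗ contractLeft HB.counit)) |>.mpr ?_
    intro a ha c _
    simp only [LinearMap.mem_eqLocus, LinearMap.rTensor_tmul, AlgHom.toLinearMap_apply,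
      LinearMap.comp_apply, contractLeft_tmul, TensorProduct.mk_apply]
    rw [h.proj_Z hB hπ ha, TensorProduct.smul_tmul]
  rw [key _ (h.comul_mem_Z hB hb)]
  congr 1
  exact HB.counit_comul_left' b

include hB hπ in
/-- A left coinvariant is killed by the skew derivations of degree one, hence lies in `Z`. -/
theorem IsCubicA2.mem_Z_of_coinvariant [CharZero k] (h : IsCubicA2 q) {b : Hat q}
    (hb : π.toLinearMap.rTensor (Hat q) (HB.comul b) = 1 ⊗ₜ b) : b ∈ Z q := by
  refine (h.derivation_criterion hB (W := Subalgebra.toSubmodule (Z q)) (K := ⊥) le_rfl ?_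
    disjoint_bot_right).2 b (h.mem_cubicSpan_Z b) fun i => ?_
  · rintro i e he
    rw [(Submodule.mem_bot k).mp he, map_zero]
    exact zero_mem _
  · -- The coefficient of a generator factors through the Nichols algebra.
    obtain ⟨φ, hφ⟩ := exists_descend (toNichols q).toLinearMap
      (Ideal.Quotient.mkₐ_surjective k _) (coeff k (FreeMonoid.of i)) (fun a ha => by
        rw [AlgHom.toLinearMap_apply, toNichols_eq_zero_iff, h.nicholsIdeal_eq hB] at ha
        exact coeff_eq_zero_of_mem_cubeIdeal (by simp) ha)
    have hφπ (e : Hat q) : φ (π e) = hatCoeff q (FreeMonoid.of i) e := by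
      obtain ⟨a, rfl⟩ := toHat_surjective e
      rw [proj_toHat hπ, hatCoeff_toHat (by simp)]
      exact hφ a
    have hφ1 : φ 1 = 0 := by
      have h1 := hφ 1
      rw [AlgHom.toLinearMap_apply, map_one] at h1
      classical
      rw [h1, ← word_one, coeff_word, if_neg]
      exact fun h => by simpa using congrArg FreeMonoid.length h
    obtain ⟨ψ, hψ⟩ : ∃ ψ : Nichols q ⊗[k] Hat q →ₗ[k] Hat q, ∀ c d, ψ (c ⊗ₜ d) = φ c • d :=
      ⟨(TensorProduct.lid k (Hat q)).toLinearMap ∘ₗ φ.rTensor (Hat q), fun _ _ => rfl⟩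
    have hcontr (t : Hat q ⊗[k] Hat q) : contractLeft (hatCoeff q (FreeMonoid.of i)) t =
        ψ (π.toLinearMap.rTensor (Hat q) t) := by
      induction t with
      | zero => simp only [map_zero]
      | add s t hs ht => simp only [map_add, hs, ht]
      | tmul c d =>
        rw [contractLeft_tmul, ← hφπ, LinearMap.rTensor_tmul, hψ]
        rfl
    rw [Submodule.mem_bot, skewDeriv, LinearMap.comp_apply, hcontr, hb, hψ, hφ1, zero_smul]

include hB hN hπ in
theorem IsCubicA2.isExtension [CharZero k] (h : IsCubicA2 q) {HZ : BraidedHopf k (Z q)}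
    (hZ : HZ.IsHom HB (Z q).val) : BraidedHopf.IsExtension HZ HB HN (Z q).val π where
  hom_left := hZ
  hom_right := isHom_proj hB hN hπ
  injective := Subtype.val_injective
  surjective := fun a => by
    obtain ⟨a, rfl⟩ := Ideal.Quotient.mkₐ_surjective k _ a
    exact ⟨toHat q a, proj_toHat hπ a⟩
  ker_eq := by
    have hZε (b : Z q) : HZ.counit b = HB.counit (b : Hat q) := (hZ.map_counit b).symm
    refine le_antisymm (fun e he => ?_) (Ideal.span_le.mpr ?_)
    · obtain ⟨a, rfl⟩ := toHat_surjective e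
      rw [RingHom.mem_ker] at he
      change π (toHat q a) = 0 at he
      rw [proj_toHat hπ, toNichols_eq_zero_iff] at he
      refine Ideal.span_mono ?_ (h.toHat_mem_span_z hB he)
      rintro _ ⟨j, rfl⟩
      exact ⟨⟨z q j, z_mem_Z j⟩, (hZε _).trans (counit_z hB j), rfl⟩
    · rintro _ ⟨b, hb, rfl⟩
      change π (b : Hat q) = 0
      rw [h.proj_Z hB hπ b.2, ← hZε, hb, zero_smul]
  range_eq := by
    rw [Subalgebra.range_val]
    ext b
    exact ⟨fun hb => h.coinvariant_of_mem_Z hB hπ hb, fun hb => h.mem_Z_of_coinvariant hB hπ hb⟩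

end RankTwo

/-- For `q` of type `A₂` at a primitive cube root of unity: `B̂` and the Nichols algebra are braided
Hopf algebra quotients of `T(V)`, `Z` is a normal braided Hopf subalgebra of `B̂` whose generators
commute up to the nonzero scalars given by the braiding and whose ordered monomials form a basis,
and `k → Z → B̂ → B_q → k` is an extension of braided Hopf algebras. The structures `HB`, `HN`, `HZ`
and the map `π` are unique, by the compatibility with `toHat`, `toNichols` and the inclusion. -/
theorem proposition4p11 {k : Type*} [Field k] [IsAlgClosed k] [CharZero k]
    (ζ : k) (hζ : IsPrimitiveRoot ζ 3) (q : Fin 2 → Fin 2 → kˣ)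
    (hq0 : (q 0 0 : k) = ζ) (hq1 : (q 1 1 : k) = ζ) (hq01 : (q 0 1 : k) * (q 1 0 : k) = ζ⁻¹) :
    ∃ (HB : BraidedHopf k (RankTwo.Hat q)) (HN : BraidedHopf k (DiagTensor.Nichols q))
      (HZ : BraidedHopf k (RankTwo.Z q)) (π : RankTwo.Hat q →ₐ[k] DiagTensor.Nichols q),
      (DiagTensor.hopf q).IsHom HB (RankTwo.toHat q) ∧
      (DiagTensor.hopf q).IsHom HN (RankTwo.toNichols q) ∧
      π.comp (RankTwo.toHat q) = RankTwo.toNichols q ∧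
      HB.IsHopfSubalgebra (RankTwo.Z q) ∧
      HB.IsNormal (RankTwo.Z q) ∧
      (∃ r : Fin 5 → Fin 5 → kˣ, ∀ i j : Fin 5,
        HB.c (TensorProduct.tmul k (RankTwo.z q i) (RankTwo.z q j)) =
          (r i j : k) • TensorProduct.tmul k (RankTwo.z q j) (RankTwo.z q i) ∧
        RankTwo.z q i * RankTwo.z q j = (r i j : k) • (RankTwo.z q j * RankTwo.z q i)) ∧
      LinearIndependent k (RankTwo.zMonomial q) ∧
      Submodule.span k (Set.range (RankTwo.zMonomial q)) =
        Subalgebra.toSubmodule (RankTwo.Z q) ∧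
      BraidedHopf.IsExtension HZ HB HN (RankTwo.Z q).val π := by
  have h : RankTwo.IsCubicA2 q := by
    refine ⟨?_, hq1.trans hq0.symm, ?_⟩
    · rw [hq0]
      have := hζ.geom_sum_eq_zero (by decide)
      simp only [Finset.sum_range_succ, Finset.sum_range_zero] at this
      linear_combination this
    · rw [hq01, hq0]
      exact inv_mul_cancel₀ (hζ.ne_zero (by decide))
  obtain ⟨HB, hB⟩ := h.isHopfIdeal_hatIdeal.exists_quotient
  replace hB : (DiagTensor.hopf q).IsHom HB (RankTwo.toHat q) := hB
  have hJ := h.isHopfIdeal_cubeIdeal hB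
  rw [← h.nicholsIdeal_eq hB] at hJ
  obtain ⟨HN, hN⟩ := hJ.exists_quotient
  replace hN : (DiagTensor.hopf q).IsHom HN (RankTwo.toNichols q) := hN
  have hsub := h.isHopfSubalgebra_Z hB
  obtain ⟨HZ, hZ⟩ := hsub.exists_sub
  obtain ⟨π, hπ⟩ : ∃ π : RankTwo.Hat q →ₐ[k] DiagTensor.Nichols q,
      π.comp (RankTwo.toHat q) = RankTwo.toNichols q := by
    refine ⟨Ideal.Quotient.liftₐ (RankTwo.hatIdeal q).asIdeal (RankTwo.toNichols q)
      fun a ha => ?_, rfl⟩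
    rw [RankTwo.toNichols_eq_zero_iff, h.nicholsIdeal_eq hB]
    exact RankTwo.hatIdeal_le_cubeIdeal (TwoSidedIdeal.mem_asIdeal.mp ha)
  refine ⟨HB, HN, HZ, π, hB, hN, hπ, hsub, h.isNormal hB,
    ⟨fun i j => DiagTensor.chi q (RankTwo.zWord i) (RankTwo.zWord j), fun i j =>
      ⟨?_, h.z_comm i j⟩⟩, h.linearIndependent_zMonomial hB, h.span_zMonomial,
    h.isExtension hB hN hπ hZ⟩
  rw [RankTwo.c_of_mem_left hB (RankTwo.z_mem_hatHomog i),
    RankTwo.hatAct_of_mem_hatHomog _ (RankTwo.z_mem_hatHomog j), TensorProduct.smul_tmul']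

end
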